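/- Let $\tau$ be a (perfect) matching of the points $1,\dots,2n$. Call $\tau$ *3-noncrossing* if no three of its pairs cross pairwise, where $\{a,c\}$ and $\{b,d\}$ cross if $a<b<c<d$. A *strand diagram* of $\tau$ is a drawing of $\tau$ by $n$ arcs (strands) in general position in a disk with the points $1,\dots,2n$ in clockwise order on its boundary, such that no strand intersects itself and no two strands cross more than once; strand diagrams are considered up to deformation (isotopy of the disk fixing the boundary points). A region of a strand diagram is *interior* if none of its sides lies on the boundary circle. A *cactus network* is a finite weighted graph embedded in a cactus, i.e. in the union of disks obtained from a disk with boundary vertices $\bar1,\dots,\bar n$ (in clockwise order) by identifying boundary vertices according to a noncrossing partition. Its *medial graph* has boundary points $t_1,\dots,t_{2n}$ in clockwise order, with $\bar i$ between $t_{2i-1}$ and $t_{2i}$, and a 4-valent vertex $t_e$ on each edge $e$; $t_e$ and $t_{e'}$ are joined whenever $e,e'$ are consecutive around a vertex and incident to a common face there, and each $t_j$ is joined to the $t_e$ of the edge adjacent to it at its boundary vertex (or to the other boundary point of the same sector if there is no such edge). Its *wires* are the curves that go straight through each $t_e$, and the *medial pairing* is the matching of $\{1,\dots,2n\}$ given by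 the ends of the wires. The network is *reduced* if no wire of its medial graph intersects itself and no two wires cross more than once. Then the following are equivalent: 1. $\tau$ is 3-noncrossing; 2. every interior region of every strand diagram of $\tau$ has at least 4 sides; 3. $\tau$ has a strand diagram all of whose interior regions have at least 4 sides; 4. $\tau$ has a unique strand diagram; 5. there is a reduced cactus network with medial pairing $\tau$ that has no triangular faces (faces with exactly three sides, all of them edges of the network) and no interior vertices of degree less than 4. -/

import Mathlib

/-! Matchings, combinatorial planar maps with a boundary, strand diagrams, cactus networks. -/

/-- A (perfect) matching of the `2n` points `0, 1, …, 2n - 1`, given by its partner map. -/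
structure PointMatching (n : ℕ) where
  partner : Fin (2 * n) → Fin (2 * n)
  partner_partner : ∀ i, partner (partner i) = i
  partner_ne : ∀ i, partner i ≠ i

/-- `k`-noncrossing: there are no `k` pairs that cross pairwise. A pair is named by its left
endpoint `i < partner i`; the pairs of `i < j` cross iff `i < j < partner i < partner j`. -/
def PointMatching.IsNoncrossing {n : ℕ} (τ : PointMatching n) (k : ℕ) : Prop :=
  ¬ ∃ L : Finset (Fin (2 * n)), L.card = k ∧ (∀ i ∈ L, i < τ.partner i) ∧
    ∀ i ∈ L, ∀ j ∈ L, i < j → j < τ.partner i ∧ τ.partner i < τ.partner j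

/-- A combinatorial map (rotation system). A dart is an edge with a direction, `flip` reverses
it, and `rot d` is the next dart counterclockwise around the vertex from which `d` departs. -/
structure DartMap (D : Type) where
  rot : Equiv.Perm D
  flip : Equiv.Perm D
  flip_flip : ∀ d, flip (flip d) = d
  flip_ne : ∀ d, flip d ≠ d

namespace DartMap

variable {D : Type} (M : DartMap D)

/-- The next dart along the boundary of the face on the left of `d`. -/
def faceNext : Equiv.Perm D := M.rot⁻¹ * M.flip

/-- Vertices are the cycles of `rot`. -/
def vertexRel : Setoid D := Equiv.Perm.SameCycle.setoid M.rot

/-- Edges are the cycles of `flip`. -/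
def edgeRel : Setoid D := Equiv.Perm.SameCycle.setoid M.flip

/-- Boundary walks of faces are the cycles of `faceNext`. -/
def walkRel : Setoid D := Equiv.Perm.SameCycle.setoid M.faceNext

/-- Two darts lie in the same connected component of the graph. -/
def componentRel : Setoid D :=
  Relation.EqvGen.setoid fun x y => y = M.rot x ∨ y = M.flip x

/-- The number of classes of `r` that meet `S`. -/
noncomputable def countIn (r : Setoid D) (S : Set D) : ℕ := ((Quotient.mk r) '' S).ncard

/-- Every connected component has genus zero: `V - E + F = 2`. -/
def IsPlanar : Prop :=
  ∀ d : D, countIn M.vertexRel {x | M.componentRel d x} + countIn M.walkRel {x | M.componentRel d x}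
    = countIn M.edgeRel {x | M.componentRel d x} + 2

end DartMap

/-- A finite planar map with a distinguished outer boundary walk with `m` labelled vertices in
clockwise order. `arc i` is the boundary arc from the `i`-th boundary vertex to the next one
clockwise, so that the outside is on its left; the other side of an arc never faces the outside.
(The closed walk may visit a vertex repeatedly: the inside of the walk is a cactus, that is, a
tree-like union of disks glued at boundary vertices. It is a disk if no vertex is repeated.) -/
structure BoundedMap (m : ℕ) where
  Dart : Type
  finite : Finite Dart
  map : DartMap Dart
  planar : map.IsPlanar
  arc : Fin m → Dart
  arc_injective : Function.Injective arc
  flip_arc_ne : ∀ i j, map.flip (arc i) ≠ arc j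
  faceNext_arc : ∀ i, map.faceNext (arc i) = arc (finRotate m i)

namespace BoundedMap

variable {m : ℕ} (B : BoundedMap m)

/-- The dart runs along the boundary (in either direction). -/
def IsArc (d : B.Dart) : Prop := ∃ i, d = B.arc i ∨ d = B.map.flip (B.arc i)

/-- The vertex from which `d` departs is not a boundary vertex. -/
def IsInner (d : B.Dart) : Prop := ∀ i, ¬ B.map.vertexRel (B.arc i) d

end BoundedMap

/-! ### Strand diagrams -/

/-- A system of arcs drawn in general position in a disk with `2n` boundary points: the planar
map formed by the boundary circle and the arcs. Each boundary point is the end of exactly one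
arc, all other vertices are transversal crossings of two arcs. -/
structure DiskDrawing (n : ℕ) extends BoundedMap (2 * n) where
  boundary_degree : ∀ j, {x | map.vertexRel (arc j) x}.ncard = 3
  crossing_degree : ∀ d, toBoundedMap.IsInner d → {x | map.vertexRel d x}.ncard = 4

namespace DiskDrawing

variable {n : ℕ} (S : DiskDrawing n)

/-- The dart entering the disk at the `j`-th boundary point. -/
def strandStart (j : Fin (2 * n)) : S.Dart := S.map.rot⁻¹ (S.arc j)

/-- Two darts lie on the same strand: strands follow edges and go straight through crossings. -/
def strandRel : Setoid S.Dart :=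
  Relation.EqvGen.setoid fun x y =>
    (¬ S.IsArc x ∧ y = S.map.flip x) ∨ (S.IsInner x ∧ y = S.map.rot (S.map.rot x))

end DiskDrawing

/-- A strand diagram: a drawing by strands running from boundary to boundary (so no closed
curves), none of which intersects itself and no two of which cross twice. -/
structure StrandDiagram (n : ℕ) extends DiskDrawing n where
  no_closed_strand : ∀ d, ¬ toBoundedMap.IsArc d →
    ∃ j, toDiskDrawing.strandRel (toDiskDrawing.strandStart j) d
  no_self_crossing : ∀ d, toBoundedMap.IsInner d → ¬ toDiskDrawing.strandRel d (map.rot d)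
  no_double_crossing : ∀ d e, toBoundedMap.IsInner d → toBoundedMap.IsInner e →
    toDiskDrawing.strandRel d e → toDiskDrawing.strandRel (map.rot d) (map.rot e) →
    map.vertexRel d e

namespace StrandDiagram

variable {n : ℕ}

/-- `S` is a strand diagram of `τ`: its strands join the boundary points that `τ` pairs. -/
def IsDiagramOf (S : StrandDiagram n) (τ : PointMatching n) : Prop :=
  ∀ j k, S.strandRel (S.strandStart j) (S.strandStart k) ↔ k = j ∨ k = τ.partner j

/-- The same strand diagram up to deformation: an isomorphism of the planar maps that preserves
the orientation and the labels of the boundary points. -/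
structure Iso (S T : StrandDiagram n) where
  toEquiv : S.Dart ≃ T.Dart
  map_rot : ∀ d, toEquiv (S.map.rot d) = T.map.rot (toEquiv d)
  map_flip : ∀ d, toEquiv (S.map.flip d) = T.map.flip (toEquiv d)
  map_arc : ∀ j, toEquiv (S.arc j) = T.arc j

/-- Every interior region (a region without a side on the boundary circle) has at least four
sides. -/
def InteriorRegionsHaveFourSides (S : StrandDiagram n) : Prop :=
  ∀ d, (∀ x, S.map.walkRel d x → ¬ S.IsArc x) → 4 ≤ {x | S.map.walkRel d x}.ncard

end StrandDiagram

/-! ### Cactus networks -/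

/-- A cactus network with boundary vertices `0, …, n - 1` in clockwise order, without its edge
weights: a finite graph (loops and multiple edges allowed, not necessarily connected), embedded
in a cactus. The map consists of the boundary arcs and the edges of the network; boundary vertices
are identified when they lie in the same cycle of `rot`. Interior vertices of degree zero are
listed separately. As a disconnected graph is not placed by its rotations alone, each boundary
walk and each isolated vertex is assigned to a face; in a drawing on the sphere the incidences
between components and faces, one for each boundary walk, form a tree
(`faces_connected` and `faces_tree`; isolated vertices are leaves of that tree). -/
structure CactusNetwork (n : ℕ) extends BoundedMap n where
  Isolated : Type
  finite_isolated : Finite Isolated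
  Face : Type
  finite_face : Finite Face
  face : Dart → Face
  isolatedFace : Isolated → Face
  face_faceNext : ∀ d, face (map.faceNext d) = face d
  faces_connected : ∀ x y : Dart ⊕ Face, Relation.EqvGen
    (fun x y => (∃ d e, map.componentRel d e ∧ x = Sum.inl d ∧ y = Sum.inl e) ∨
      ∃ d, x = Sum.inl d ∧ y = Sum.inr (face d)) x y
  faces_tree : Nat.card (Quotient map.walkRel) + 1 =
    Nat.card (Quotient map.componentRel) + Nat.card Face
  outside_only_arcs : ∀ i d, face d = face (arc i) → ∃ j, d = arc j
  outside_not_isolated : ∀ i v, isolatedFace v ≠ face (arc i)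

namespace CactusNetwork

variable {n : ℕ} (N : CactusNetwork n)

/-- The vertices of the network. -/
def Vertex : Type := Quotient N.map.vertexRel ⊕ N.Isolated

/-- A vertex that is not on the boundary. -/
def IsInteriorVertex : N.Vertex → Prop
  | Sum.inl q => ∀ i, Quotient.mk N.map.vertexRel (N.arc i) ≠ q
  | Sum.inr _ => True

/-- The number of edges of the network (boundary arcs excluded) at a vertex; loops count twice. -/
noncomputable def degree : N.Vertex → ℕ
  | Sum.inl q => {d : N.Dart | ¬ N.IsArc d ∧ Quotient.mk N.map.vertexRel d = q}.ncard
  | Sum.inr _ => 0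

/-- A face with exactly three sides, all of which are edges of the network. -/
def IsTriangularFace (f : N.Face) : Prop :=
  (∀ d, N.face d = f → ¬ N.IsArc d) ∧ {d | N.face d = f}.ncard = 3

/-- The wires of the medial graph. The medial graph has a vertex `t_e` on each edge `e`, and one
edge through each angle between `d` and `rot d` inside the cactus (that is, unless `d` is an `arc`,
when the angle is outside). At `t_e`, for an edge `e` with darts `d` and `flip d`, the two wires
that cross are written `(d, true)`, which joins the angle left of `d` at its tail to the angle
right of `d` at its head, and `(d, false)`, which joins the two other angles. On a boundary arc the
two wires do not meet, but end in the two boundary points of the medial graph on that arc. -/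
def wireRel : Setoid (N.Dart × Bool) :=
  Relation.EqvGen.setoid fun x y =>
    (∃ d s, x = (d, s) ∧ y = (N.map.flip d, s)) ∨
    (∃ d, (∀ i, d ≠ N.arc i) ∧ x = (d, true) ∧ y = (N.map.rot d, false))

/-- The wire end at the boundary point `j` of the medial graph. Boundary vertex `i` lies between
the points `2 * i` (on the arc that precedes it) and `2 * i + 1` (on the arc that follows it). -/
def wireEnd (j : Fin (2 * n)) : N.Dart × Bool :=
  let i : Fin n := ⟨j.val / 2, by omega⟩
  if j.val % 2 = 0 then (N.arc ((finRotate n).symm i), true) else (N.arc i, false)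

/-- The medial pairing of the network is `τ`. -/
def HasMedialPairing (τ : PointMatching n) : Prop :=
  ∀ j k, N.wireRel (N.wireEnd j) (N.wireEnd k) ↔ k = j ∨ k = τ.partner j

/-- The medial graph is lensless: no wire crosses itself and no two wires cross twice. -/
def IsReduced : Prop :=
  (∀ d, ¬ N.IsArc d → ¬ N.wireRel (d, true) (d, false)) ∧
  ∀ d e s, ¬ N.IsArc d → ¬ N.IsArc e → N.wireRel (d, true) (e, s) →
    N.wireRel (d, false) (e, !s) → e = d ∨ e = N.map.flip d

end CactusNetwork

/-! The topological input is that each strand of a diagram cuts the disk into two sides. For a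
rotation system of genus zero this is linear algebra mod 2: face boundaries are cycles, and Euler's
formula makes the dimensions agree, so every cycle of edges bounds a set of faces
(`IsPlanar.exists_face_potential`). Applied to a strand together with the boundary arcs under its
chord, this gives the two sides (`exists_side`). Since two strands cross at most once, watching on
which side of one strand another one runs shows that strands cross exactly when their chords do, at
one crossing and with prescribed orientation (`cr_of_isInner`, `exists_isInner`, `isInner_unique`).

An interior region with one or two sides would force a self-crossing or a double crossing, and one
with three sides is bounded by three pairwise crossing strands; hence 1 implies 2. Conversely, three
pairwise crossing strands bound a triangle. A strand that enters it through one side leaves through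
another and cuts off a triangle crossed by fewer strands, and a triangle that no strand crosses is a
region with three sides (`not_fourSides_of_cross`); hence 3 implies 1. For 2 implies 3 a diagram is
needed: put the points on a diagonal and draw each chord as a vertical followed by a horizontal
segment (`gridDiagram`). Genus is never negative, so it suffices for planarity to exhibit enough
faces, which are told apart by labels.

If no three chords cross pairwise, two strands that cross a third do not cross each other, so the
order of the crossings along every strand can be read off the matching and determines the whole map
(`nonempty_iso`); this is 1 implies 4. For a crossing triple, grid diagrams drawn from two different
starting points show two crossings on one strand in opposite orders, so the diagram is not unique
(`isNoncrossing_of_unique`).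

For 5, the regions of the medial graph of a network correspond to its vertices and faces. A parity
argument excludes closed wires in a reduced network, so the network is connected and its medial
graph is a strand diagram (`medialDiagram`). Conversely, colour the regions of a strand diagram
black and white; the black regions are the vertices and the crossings the edges of a reduced network
(`network`). Triangular faces and interior vertices of degree three are then the interior regions
with three sides, and smaller ones do not occur. -/

theorem Equiv.Perm.SameCycle.apply_eq_of_invariant {α β : Type*} {f : Equiv.Perm α} {g : α → β}
    (h : ∀ x, g (f x) = g x) {x y : α} (hxy : f.SameCycle x y) : g x = g y := by
  have hinv : ∀ x, g (f⁻¹ x) = g x := fun x => by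
    rw [← h (f⁻¹ x)]; simp
  obtain ⟨i, rfl⟩ := hxy
  induction i with
  | zero => simp
  | succ i ih => rw [add_comm, zpow_add, zpow_one, Equiv.Perm.mul_apply, h]; exact ih
  | pred i ih =>
    rw [sub_eq_add_neg, add_comm, zpow_add, zpow_neg_one, Equiv.Perm.mul_apply, hinv]; exact ih

/-! ### Combinatorial maps: homology mod 2 and Euler's formula. -/

namespace DartMap

section Basic

variable {D : Type} (M : DartMap D)

theorem edgeRel_iff {x y : D} : M.edgeRel x y ↔ y = x ∨ y = M.flip x := by
  constructor
  · rintro ⟨i, rfl⟩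
    induction i with
    | zero => simp
    | succ i ih =>
      rw [add_comm, zpow_add, zpow_one, Equiv.Perm.mul_apply]
      rcases ih with h | h <;> rw [h] <;> simp [M.flip_flip]
    | pred i ih =>
      have hinv : M.flip⁻¹ = M.flip := by
        ext z; rw [Equiv.Perm.inv_eq_iff_eq]; exact (M.flip_flip z).symm
      rw [sub_eq_add_neg, add_comm, zpow_add, zpow_neg_one, Equiv.Perm.mul_apply, hinv]
      rcases ih with h | h <;> rw [h] <;> simp [M.flip_flip]
  · rintro (rfl | rfl)
    · exact Equiv.Perm.SameCycle.refl _ _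
    · exact ⟨1, by simp⟩

theorem componentRel_faceNext (x : D) : M.componentRel (M.faceNext x) x := by
  have h1 : M.componentRel (M.flip x) x :=
    Relation.EqvGen.symm _ _ (Relation.EqvGen.rel _ _ (Or.inr rfl))
  refine Relation.EqvGen.trans _ _ _ (Relation.EqvGen.rel _ _ (Or.inl ?_)) h1
  simp [faceNext]

theorem rot_faceNext (x : D) : M.rot (M.faceNext x) = M.flip x := by simp [faceNext]

theorem faceNext_flip (x : D) : M.faceNext (M.flip x) = M.rot⁻¹ x := by
  simp [faceNext, M.flip_flip]

theorem faceNext_flip_rot (x : D) : M.faceNext (M.flip (M.rot x)) = x := by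
  simp [faceNext, M.flip_flip]

theorem vertexRel_rot (x : D) : M.vertexRel x (M.rot x) := ⟨1, by simp⟩

theorem walkRel_faceNext (x : D) : M.walkRel x (M.faceNext x) := ⟨1, by simp⟩

theorem componentRel_rot (x : D) : M.componentRel x (M.rot x) :=
  Relation.EqvGen.rel _ _ (Or.inl rfl)

theorem componentRel_flip (x : D) : M.componentRel x (M.flip x) :=
  Relation.EqvGen.rel _ _ (Or.inr rfl)

theorem componentRel_of_vertexRel {x y : D} (h : M.vertexRel x y) : M.componentRel x y := by
  have := Equiv.Perm.SameCycle.apply_eq_of_invariant (g := Quotient.mk M.componentRel)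
    (fun x => Quotient.sound (M.componentRel.symm' (M.componentRel_rot x))) h
  exact Quotient.exact this

theorem componentRel_of_edgeRel {x y : D} (h : M.edgeRel x y) : M.componentRel x y := by
  have := Equiv.Perm.SameCycle.apply_eq_of_invariant (g := Quotient.mk M.componentRel)
    (fun x => Quotient.sound (M.componentRel.symm' (M.componentRel_flip x))) h
  exact Quotient.exact this

theorem componentRel_of_walkRel {x y : D} (h : M.walkRel x y) : M.componentRel x y := by
  have := Equiv.Perm.SameCycle.apply_eq_of_invariant (g := Quotient.mk M.componentRel)
    (fun x => Quotient.sound (M.componentRel_faceNext x)) h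
  exact Quotient.exact this

end Basic

section Homology

open scoped Classical

variable {D : Type} [Fintype D] (M : DartMap D)

/-- The incidence matrix over `ZMod 2` between the classes of `r` and the edges. -/
noncomputable def incidence (r : Setoid D) : Matrix (Quotient r) (Quotient M.edgeRel) (ZMod 2) :=
  fun v e => ∑ d : D, if Quotient.mk r d = v ∧ Quotient.mk M.edgeRel d = e then 1 else 0

theorem incidence_mulVec (r : Setoid D) (w : Quotient M.edgeRel → ZMod 2) (v : Quotient r) :
    (M.incidence r).mulVec w v =
      ∑ d : D, if Quotient.mk r d = v then w (Quotient.mk _ d) else 0 := by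
  simp only [Matrix.mulVec, dotProduct, incidence, Finset.sum_mul]
  rw [Finset.sum_comm]
  refine Finset.sum_congr rfl fun d _ => ?_
  by_cases h : Quotient.mk r d = v <;> simp [h]

theorem incidence_transpose_mulVec (r : Setoid D) (h : Quotient r → ZMod 2) (x : D) :
    (M.incidence r).transpose.mulVec h (Quotient.mk _ x) =
      h (Quotient.mk _ x) + h (Quotient.mk _ (M.flip x)) := by
  have h1 : (M.incidence r).transpose.mulVec h (Quotient.mk _ x) =
      ∑ d : D, if Quotient.mk M.edgeRel d = Quotient.mk _ x then h (Quotient.mk _ d) else 0 := by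
    simp only [Matrix.mulVec, dotProduct, incidence, Matrix.transpose]
    simp only [Matrix.of_apply, Finset.sum_mul]
    rw [Finset.sum_comm]
    refine Finset.sum_congr rfl fun d _ => ?_
    by_cases h : Quotient.mk M.edgeRel d = Quotient.mk _ x <;> simp [h]
  rw [h1, ← Finset.sum_filter]
  have h2 : Finset.univ.filter (fun d => Quotient.mk M.edgeRel d = Quotient.mk _ x) =
      {x, M.flip x} := by
    ext d
    simp only [Finset.mem_filter, Finset.mem_univ, true_and, Finset.mem_insert,
      Finset.mem_singleton]
    rw [eq_comm, Quotient.eq]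
    exact M.edgeRel_iff
  rw [h2, Finset.sum_pair (M.flip_ne x).symm]

/-- The kernel of the transpose consists of the functions on classes that agree across every edge.
By `hc` these are the functions on the components, so its dimension is the number of components. -/
theorem rank_incidence (r : Setoid D) (hr : ∀ x y, r x y → M.componentRel x y)
    (hc : ∀ h : D → ZMod 2, (∀ x y, r x y → h x = h y) → (∀ x, h (M.flip x) = h x) →
      ∀ x y, M.componentRel x y → h x = h y) :
    (M.incidence r).rank + Nat.card (Quotient M.componentRel) = Nat.card (Quotient r) := by
  rw [← Matrix.rank_transpose, Matrix.rank]
  have h1 := LinearMap.finrank_range_add_finrank_ker (M.incidence r).transpose.mulVecLin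
  rw [Module.finrank_fintype_fun_eq_card] at h1
  let p : Quotient r → Quotient M.componentRel :=
    Quotient.map' id hr
  have hp : Function.Surjective p := by
    intro q; induction q using Quotient.inductionOn with | h d => exact ⟨Quotient.mk _ d, rfl⟩
  have hker : (M.incidence r).transpose.mulVecLin.ker =
      (LinearMap.funLeft (ZMod 2) (ZMod 2) p).range := by
    ext h
    simp only [LinearMap.mem_ker, Matrix.mulVecLin_apply, LinearMap.mem_range]
    constructor
    · intro hh
      have h0 : ∀ x, h (Quotient.mk _ (M.flip x)) = h (Quotient.mk _ x) := fun x => by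
        have := congrFun hh (Quotient.mk _ x)
        rw [incidence_transpose_mulVec, Pi.zero_apply, CharTwo.add_eq_zero] at this
        exact this.symm
      refine ⟨Quotient.lift (fun d => h (Quotient.mk _ d)) ?_, ?_⟩
      · exact hc (fun d => h (Quotient.mk _ d)) (fun x y hxy => by rw [Quotient.sound hxy]) h0
      · ext q
        induction q using Quotient.inductionOn with | h d => rfl
    · rintro ⟨g, rfl⟩
      ext e
      induction e using Quotient.inductionOn with
      | h d =>
        rw [incidence_transpose_mulVec, Pi.zero_apply, CharTwo.add_eq_zero]
        refine congrArg g (Quotient.sound ?_)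
        exact Relation.EqvGen.rel _ _ (Or.inr rfl)
  rw [hker, LinearMap.finrank_range_of_inj
    (LinearMap.funLeft_injective_of_surjective _ _ _ hp), Module.finrank_fintype_fun_eq_card] at h1
  rw [Nat.card_eq_fintype_card, Nat.card_eq_fintype_card]
  exact h1

theorem rank_incidence_vertexRel :
    (M.incidence M.vertexRel).rank + Nat.card (Quotient M.componentRel) =
      Nat.card (Quotient M.vertexRel) := by
  refine M.rank_incidence _ (fun _ _ => M.componentRel_of_vertexRel) fun h h1 h2 x y hxy => ?_
  · induction hxy with
    | rel x y h =>
      rcases h with rfl | rfl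
      · exact h1 _ _ ⟨1, by simp⟩
      · exact (h2 _).symm
    | refl => rfl
    | symm _ _ _ ih => exact ih.symm
    | trans _ _ _ _ _ ih1 ih2 => exact ih1.trans ih2

/-- Components are generated by `rot` and `flip`, but also by `faceNext` and `flip`: `x` is the
successor of `flip (rot x)` on a boundary walk. -/
theorem rank_incidence_walkRel :
    (M.incidence M.walkRel).rank + Nat.card (Quotient M.componentRel) =
      Nat.card (Quotient M.walkRel) := by
  refine M.rank_incidence _ (fun _ _ => M.componentRel_of_walkRel) fun h h1 h2 x y hxy => ?_
  · induction hxy with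
    | rel x y h =>
      rcases h with rfl | rfl
      · rw [← h2 (M.rot x)]
        refine (h1 _ _ ⟨1, ?_⟩).symm
        rw [zpow_one, faceNext_flip_rot]
      · exact (h2 _).symm
    | refl => rfl
    | symm _ _ _ ih => exact ih.symm
    | trans _ _ _ _ _ ih1 ih2 => exact ih1.trans ih2

/-- The boundary of a boundary is zero: `flip d` and `rot⁻¹ d` have the same face on the left, so
around a vertex each angle is counted twice. -/
theorem sum_fiber_eq_zero_of_faceNext (g : D → ZMod 2) (hg : ∀ d, g (M.faceNext d) = g d)
    (v : Quotient M.vertexRel) :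
    (∑ d : D, if Quotient.mk M.vertexRel d = v then g d + g (M.flip d) else 0) = 0 := by
  have h1 : ∀ d, g (M.flip d) = g (M.rot⁻¹ d) := fun d => by
    rw [← hg (M.flip d), faceNext_flip]
  have h2 : (∑ d : D, if Quotient.mk M.vertexRel d = v then g (M.rot⁻¹ d) else 0) =
      ∑ d : D, if Quotient.mk M.vertexRel d = v then g d else 0 := by
    refine Fintype.sum_equiv M.rot⁻¹ _ _ fun d => ?_
    have : Quotient.mk M.vertexRel (M.rot⁻¹ d) = Quotient.mk M.vertexRel d :=
      Quotient.sound ⟨1, by simp⟩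
    rw [this]
  simp only [h1]
  have h3 : ∀ d : D, (if Quotient.mk M.vertexRel d = v then g d + g (M.rot⁻¹ d) else 0) =
      (if Quotient.mk M.vertexRel d = v then g d else 0) +
      (if Quotient.mk M.vertexRel d = v then g (M.rot⁻¹ d) else 0) := fun d => by
    split_ifs <;> simp
  rw [Finset.sum_congr rfl fun d _ => h3 d, Finset.sum_add_distrib, h2, CharTwo.add_self_eq_zero]

theorem range_incidence_walkRel_le :
    (M.incidence M.walkRel).transpose.mulVecLin.range ≤
      (M.incidence M.vertexRel).mulVecLin.ker := by
  rintro _ ⟨g, rfl⟩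
  rw [LinearMap.mem_ker]
  ext v
  simp only [Matrix.mulVecLin_apply, incidence_mulVec, incidence_transpose_mulVec]
  exact M.sum_fiber_eq_zero_of_faceNext (fun d => g (Quotient.mk _ d))
    (fun d => congrArg g (Quotient.sound ((Equiv.Perm.SameCycle.refl _ _).apply_left))) v

theorem finrank_ker_incidence_vertexRel :
    (M.incidence M.vertexRel).rank + Module.finrank (ZMod 2)
      (M.incidence M.vertexRel).mulVecLin.ker = Nat.card (Quotient M.edgeRel) := by
  have h1 := LinearMap.finrank_range_add_finrank_ker (M.incidence M.vertexRel).mulVecLin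
  rw [Module.finrank_fintype_fun_eq_card] at h1
  rw [Matrix.rank, Nat.card_eq_fintype_card]
  exact h1

/-- Every component has non-negative genus. -/
theorem card_vertex_add_card_walk_le :
    Nat.card (Quotient M.vertexRel) + Nat.card (Quotient M.walkRel) ≤
      Nat.card (Quotient M.edgeRel) + 2 * Nat.card (Quotient M.componentRel) := by
  have h1 := M.rank_incidence_vertexRel
  have h2 := M.rank_incidence_walkRel
  have h3 := M.finrank_ker_incidence_vertexRel
  -- With `C` components the face boundaries span a space of dimension `F - C`, inside the cycle
  -- space, which has dimension `E - (V - C)`.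
  have h4 := Submodule.finrank_mono M.range_incidence_walkRel_le
  rw [← Matrix.rank_transpose, Matrix.rank] at h2
  omega

theorem card_quotient_eq_sum_countIn (r : Setoid D) (hr : ∀ x y, r x y → M.componentRel x y) :
    Nat.card (Quotient r) = ∑ c : Quotient M.componentRel,
      countIn r {x | Quotient.mk M.componentRel x = c} := by
  let p : Quotient r → Quotient M.componentRel := Quotient.map' id hr
  rw [Nat.card_eq_fintype_card, ← Finset.card_univ,
    Finset.card_eq_sum_card_fiberwise (f := p) (t := Finset.univ) (by simp)]
  refine Finset.sum_congr rfl fun c _ => ?_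
  rw [countIn, ← Set.ncard_coe_finset]
  congr 1
  ext q
  induction q using Quotient.inductionOn with
  | h d =>
    simp only [Finset.coe_filter, Finset.mem_univ, true_and, Set.mem_ofPred_eq, Set.mem_image]
    constructor
    · intro h; exact ⟨d, h, rfl⟩
    · rintro ⟨x, hx, hxd⟩
      rw [← hx]
      exact Quotient.sound (hr _ _ (Quotient.exact hxd.symm))

variable {M}

theorem IsPlanar.euler (hM : M.IsPlanar) :
    Nat.card (Quotient M.vertexRel) + Nat.card (Quotient M.walkRel) =
      Nat.card (Quotient M.edgeRel) + 2 * Nat.card (Quotient M.componentRel) := by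
  rw [M.card_quotient_eq_sum_countIn _ fun _ _ => M.componentRel_of_vertexRel, M.card_quotient_eq_sum_countIn _ fun _ _ => M.componentRel_of_edgeRel,
    M.card_quotient_eq_sum_countIn _ fun _ _ => M.componentRel_of_walkRel, ← Finset.sum_add_distrib]
  have : 2 * Nat.card (Quotient M.componentRel) = ∑ c : Quotient M.componentRel, 2 := by
    rw [Finset.sum_const, Finset.card_univ, Nat.card_eq_fintype_card, smul_eq_mul, mul_comm]
  rw [this, ← Finset.sum_add_distrib]
  refine Finset.sum_congr rfl fun c _ => ?_
  induction c using Quotient.inductionOn with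
  | h d =>
    have h1 : {x | Quotient.mk M.componentRel x = Quotient.mk _ d} = {x | M.componentRel d x} := by
      ext x
      simp only [Set.mem_ofPred_eq, Quotient.eq]
      exact ⟨fun h => M.componentRel.symm' h, fun h => M.componentRel.symm' h⟩
    rw [h1]
    exact hM d

/-- On a planar map, a set of edges that meets each vertex evenly separates the faces. -/
theorem IsPlanar.exists_face_potential (hM : M.IsPlanar) (w : D → ZMod 2)
    (hw : ∀ d, w (M.flip d) = w d)
    (hv : ∀ d, ∑ x ∈ Finset.univ.filter (fun x => M.vertexRel d x), w x = 0) :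
    ∃ g : D → ZMod 2, (∀ d, g (M.faceNext d) = g d) ∧ ∀ d, g d + g (M.flip d) = w d := by
  have h1 := M.rank_incidence_vertexRel
  have h2 := M.rank_incidence_walkRel
  have h3 := M.finrank_ker_incidence_vertexRel
  have h4 := hM.euler
  rw [← Matrix.rank_transpose, Matrix.rank] at h2
  -- Genus zero makes the dimensions equal, so every cycle is a sum of face boundaries; the
  -- coefficients are the potential.
  have h5 := Submodule.eq_of_le_of_finrank_le M.range_incidence_walkRel_le (by omega)
  let w' : Quotient M.edgeRel → ZMod 2 := Quotient.lift w fun x y h => by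
    rcases M.edgeRel_iff.1 h with rfl | rfl
    · rfl
    · exact (hw _).symm
  have h6 : w' ∈ (M.incidence M.vertexRel).mulVecLin.ker := by
    rw [LinearMap.mem_ker]
    ext v
    induction v using Quotient.inductionOn with
    | h d =>
      rw [Matrix.mulVecLin_apply, incidence_mulVec, ← Finset.sum_filter, Pi.zero_apply, ← hv d]
      refine Finset.sum_congr ?_ fun x _ => rfl
      ext x
      simp only [Finset.mem_filter, Finset.mem_univ, true_and, Quotient.eq]
      exact ⟨fun h => M.vertexRel.symm' h, fun h => M.vertexRel.symm' h⟩
  rw [← h5] at h6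
  obtain ⟨g, hg⟩ := h6
  refine ⟨fun d => g (Quotient.mk _ d), fun d => ?_, fun d => ?_⟩
  · exact congrArg g (Quotient.sound ((Equiv.Perm.SameCycle.refl _ _).apply_left))
  · have := congrFun hg (Quotient.mk _ d)
    rw [Matrix.mulVecLin_apply, incidence_transpose_mulVec] at this
    exact this

/-- A connected map with sufficiently many faces is planar. -/
theorem isPlanar_of_connected (hc : ∀ x y, M.componentRel x y)
    (h : Nat.card (Quotient M.edgeRel) + 2 ≤
      Nat.card (Quotient M.vertexRel) + Nat.card (Quotient M.walkRel)) : M.IsPlanar := by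
  intro d
  have h1 : {x | M.componentRel d x} = Set.univ := Set.eq_univ_of_forall fun x => hc d x
  have h2 : ∀ r : Setoid D, countIn r Set.univ = Nat.card (Quotient r) := fun r => by
    rw [countIn, Set.image_univ_of_surjective Quotient.mk_surjective, Set.ncard_univ]
  have h3 := M.card_vertex_add_card_walk_le
  have h4 : Nat.card (Quotient M.componentRel) ≤ 1 := by
    rw [Nat.card_eq_fintype_card, Fintype.card_le_one_iff]
    intro a b
    induction a using Quotient.inductionOn
    induction b using Quotient.inductionOn
    exact Quotient.sound (hc _ _)
  rw [h1, h2, h2, h2]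
  omega

end Homology

end DartMap

/-! ### Drawings in a disk: darts at the vertices, and strands. -/

theorem Equiv.Perm.SameCycle.pow_eq_iff_of_ncard {α : Type*} [Finite α] {f : Equiv.Perm α} {x : α}
    {k : ℕ} (h : {y | f.SameCycle x y}.ncard = k) :
    (∀ n, (f ^ n) x = x ↔ k ∣ n) ∧ ∀ y, f.SameCycle x y → ∃ n < k, (f ^ n) x = y := by
  classical
  have := Fintype.ofFinite α
  let s : Finset α := {y | f.SameCycle x y}.toFinset
  have hs : f.IsCycleOn (s : Set α) := by
    refine ⟨⟨fun y hy => ?_, f.injective.injOn, fun y hy => ?_⟩, fun y hy z hz => ?_⟩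
    · have hy' : f.SameCycle x y := by simpa [s] using hy
      simpa [s] using hy'
    · have hy' : f.SameCycle x y := by simpa [s] using hy
      refine ⟨f⁻¹ y, ?_, by simp⟩
      simpa [s] using hy'
    · have hy' : f.SameCycle x y := by simpa [s] using hy
      have hz' : f.SameCycle x z := by simpa [s] using hz
      exact hy'.symm.trans hz'
  have hk : s.card = k := by
    rw [← h, Set.ncard_eq_toFinset_card']
  have hx : x ∈ s := by simp [s, Equiv.Perm.SameCycle.refl]
  refine ⟨fun n => ?_, fun y hy => ?_⟩
  · rw [← hk]; exact hs.pow_apply_eq hx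
  · rw [← hk]
    exact hs.exists_pow_eq hx (by simpa [s] using hy)

namespace BoundedMap

variable {m : ℕ} (B : BoundedMap m)

theorem rot_arc_finRotate (i : Fin m) :
    B.map.rot (B.arc (finRotate m i)) = B.map.flip (B.arc i) := by
  rw [← B.faceNext_arc, DartMap.rot_faceNext]

theorem rot_arc (i : Fin m) :
    B.map.rot (B.arc i) = B.map.flip (B.arc ((finRotate m).symm i)) := by
  rw [← B.rot_arc_finRotate, Equiv.apply_symm_apply]

variable {B}

theorem IsArc.flip {x : B.Dart} (h : B.IsArc x) : B.IsArc (B.map.flip x) := by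
  obtain ⟨i, rfl | rfl⟩ := h
  · exact ⟨i, Or.inr rfl⟩
  · exact ⟨i, Or.inl (B.map.flip_flip _)⟩

theorem isArc_flip_iff {x : B.Dart} : B.IsArc (B.map.flip x) ↔ B.IsArc x :=
  ⟨fun h => by simpa [B.map.flip_flip] using h.flip, IsArc.flip⟩

theorem isInner_congr {x y : B.Dart} (h : B.map.vertexRel x y) : B.IsInner x ↔ B.IsInner y :=
  forall_congr' fun _ => not_congr ⟨fun h' => B.map.vertexRel.trans' h' h,
    fun h' => B.map.vertexRel.trans' h' (B.map.vertexRel.symm' h)⟩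

theorem isInner_rot_iff {x : B.Dart} : B.IsInner (B.map.rot x) ↔ B.IsInner x :=
  (isInner_congr (B.map.vertexRel_rot x)).symm

theorem isArc_arc (i : Fin m) : B.IsArc (B.arc i) := ⟨i, Or.inl rfl⟩

theorem isArc_flip_arc (i : Fin m) : B.IsArc (B.map.flip (B.arc i)) := ⟨i, Or.inr rfl⟩

theorem not_isInner_arc (i : Fin m) : ¬ B.IsInner (B.arc i) :=
  fun h => h i (B.map.vertexRel.refl' _)

theorem IsInner.not_isArc {x : B.Dart} (h : B.IsInner x) : ¬ B.IsArc x := by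
  rintro ⟨i, rfl | rfl⟩
  · exact not_isInner_arc i h
  · rw [← B.rot_arc_finRotate, isInner_rot_iff] at h
    exact not_isInner_arc _ h

end BoundedMap

namespace DiskDrawing

open BoundedMap

variable {n : ℕ} (S : DiskDrawing n)

theorem rot_strandStart (j : Fin (2 * n)) : S.map.rot (S.strandStart j) = S.arc j := by
  simp [strandStart]

theorem strandStart_injective : Function.Injective S.strandStart := fun i j h => by
  have := congrArg S.map.rot h
  rw [rot_strandStart, rot_strandStart] at this
  exact S.arc_injective this

theorem rot_rot_arc (j : Fin (2 * n)) : S.map.rot (S.map.rot (S.arc j)) = S.strandStart j := by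
  have := S.finite
  have h := (Equiv.Perm.SameCycle.pow_eq_iff_of_ncard (S.boundary_degree j)).1 3
  have h3 : S.map.rot (S.map.rot (S.map.rot (S.arc j))) = S.arc j := h.2 (dvd_refl 3)
  apply S.map.rot.injective
  rw [h3, rot_strandStart]

theorem rot_flip_arc (j : Fin (2 * n)) :
    S.map.rot (S.map.flip (S.arc j)) = S.strandStart (finRotate _ j) := by
  rw [← S.rot_arc_finRotate, rot_rot_arc]

theorem vertexRel_arc_iff {j : Fin (2 * n)} {x : S.Dart} : S.map.vertexRel (S.arc j) x ↔
    x = S.arc j ∨ x = S.map.rot (S.arc j) ∨ x = S.strandStart j := by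
  have := S.finite
  constructor
  · intro hx
    obtain ⟨k, hk, rfl⟩ := (Equiv.Perm.SameCycle.pow_eq_iff_of_ncard (S.boundary_degree j)).2 _ hx
    interval_cases k
    · exact Or.inl rfl
    · exact Or.inr (Or.inl rfl)
    · exact Or.inr (Or.inr (S.rot_rot_arc j))
  · rintro (rfl | rfl | rfl)
    · exact S.map.vertexRel.refl' _
    · exact S.map.vertexRel_rot _
    · have := S.map.vertexRel_rot (S.strandStart j)
      rw [rot_strandStart] at this
      exact S.map.vertexRel.symm' this

theorem not_isInner_strandStart (j : Fin (2 * n)) : ¬ S.IsInner (S.strandStart j) :=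
  fun h => h j (S.vertexRel_arc_iff.2 (Or.inr (Or.inr rfl)))

theorem not_isArc_strandStart (j : Fin (2 * n)) : ¬ S.IsArc (S.strandStart j) := by
  rintro ⟨k, h | h⟩
  · have := congrArg S.map.rot h
    rw [rot_strandStart, S.rot_arc] at this
    exact S.flip_arc_ne _ _ this.symm
  · rw [← rot_rot_arc, ← S.rot_arc_finRotate, S.map.rot.apply_eq_iff_eq, S.rot_arc] at h
    exact S.flip_arc_ne _ _ h

theorem exists_eq_strandStart {x : S.Dart} (h : ¬ S.IsArc x) (h' : ¬ S.IsInner x) :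
    ∃ j, x = S.strandStart j := by
  simp only [IsInner, not_forall, not_not] at h'
  obtain ⟨j, hj⟩ := h'
  rcases S.vertexRel_arc_iff.1 hj with rfl | rfl | rfl
  · exact absurd (isArc_arc j) h
  · rw [S.rot_arc] at h
    exact absurd (isArc_flip_arc _) h
  · exact ⟨j, rfl⟩

variable {S}

theorem rot_four {x : S.Dart} (h : S.IsInner x) :
    S.map.rot (S.map.rot (S.map.rot (S.map.rot x))) = x := by
  have := S.finite
  exact ((Equiv.Perm.SameCycle.pow_eq_iff_of_ncard (S.crossing_degree x h)).1 4).2 (dvd_refl 4)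

theorem rot_rot_ne {x : S.Dart} (h : S.IsInner x) : S.map.rot (S.map.rot x) ≠ x := by
  have := S.finite
  intro h2
  have := ((Equiv.Perm.SameCycle.pow_eq_iff_of_ncard (S.crossing_degree x h)).1 2).1 h2
  omega

theorem rot_ne {x : S.Dart} (h : S.IsInner x) : S.map.rot x ≠ x := fun h2 =>
  rot_rot_ne h (by rw [h2, h2])

theorem vertexRel_iff_of_isInner {x y : S.Dart} (h : S.IsInner x) : S.map.vertexRel x y ↔
    y = x ∨ y = S.map.rot x ∨ y = S.map.rot (S.map.rot x) ∨
      y = S.map.rot (S.map.rot (S.map.rot x)) := by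
  have := S.finite
  constructor
  · intro hx
    obtain ⟨k, hk, rfl⟩ := (Equiv.Perm.SameCycle.pow_eq_iff_of_ncard (S.crossing_degree x h)).2 _ hx
    interval_cases k
    · exact Or.inl rfl
    · exact Or.inr (Or.inl rfl)
    · exact Or.inr (Or.inr (Or.inl rfl))
    · exact Or.inr (Or.inr (Or.inr rfl))
  · rintro (rfl | rfl | rfl | rfl)
    · exact S.map.vertexRel.refl' _
    · exact ⟨1, rfl⟩
    · exact ⟨2, rfl⟩
    · exact ⟨3, rfl⟩

variable (S)

/-- The dart `x` runs into the boundary point `a` after `m` crossings. -/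
inductive Ahead : S.Dart → Fin (2 * n) → ℕ → Prop
  | finish {x : S.Dart} {a : Fin (2 * n)} : S.map.flip x = S.strandStart a → Ahead x a 0
  | step {x : S.Dart} {a : Fin (2 * n)} {m : ℕ} : S.IsInner (S.map.flip x) →
      Ahead (S.map.rot (S.map.rot (S.map.flip x))) a m → Ahead x a (m + 1)

variable {S}

theorem Ahead.unique {x : S.Dart} {a b : Fin (2 * n)} {m k : ℕ} (h : S.Ahead x a m)
    (h' : S.Ahead x b k) : a = b ∧ m = k := by
  induction h generalizing k with
  | finish h1 =>
    cases h' with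
    | finish h2 => exact ⟨S.strandStart_injective (h1.symm.trans h2), rfl⟩
    | step h2 _ => rw [h1] at h2; exact absurd h2 (S.not_isInner_strandStart _)
  | step h1 _ ih =>
    cases h' with
    | finish h2 => rw [h2] at h1; exact absurd h1 (S.not_isInner_strandStart _)
    | step h2 h3 =>
      obtain ⟨h4, h5⟩ := ih h3
      exact ⟨h4, by rw [h5]⟩

/-- A strand can be traced back from its end in only one way. Darts on strands thus have coordinates
`(a, m)`, by which different diagrams can be compared. -/
theorem Ahead.injective {x y : S.Dart} {a : Fin (2 * n)} {m : ℕ} (h : S.Ahead x a m)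
    (h' : S.Ahead y a m) : x = y := by
  induction h generalizing y with
  | finish h1 =>
    cases h' with
    | finish h2 => exact S.map.flip.injective (h1.trans h2.symm)
  | step h1 _ ih =>
    cases h' with
    | step h2 h3 =>
      exact S.map.flip.injective (S.map.rot.injective (S.map.rot.injective (ih h3)))

theorem Ahead.not_isArc {x : S.Dart} {a : Fin (2 * n)} {m : ℕ} (h : S.Ahead x a m) :
    ¬ S.IsArc x := by
  rw [← isArc_flip_iff]
  cases h with
  | finish h => rw [h]; exact S.not_isArc_strandStart a
  | step h _ => exact h.not_isArc

theorem strandRel_flip {x : S.Dart} (h : ¬ S.IsArc x) : S.strandRel x (S.map.flip x) :=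
  Relation.EqvGen.rel _ _ (Or.inl ⟨h, rfl⟩)

theorem strandRel_rot_rot {x : S.Dart} (h : S.IsInner x) :
    S.strandRel x (S.map.rot (S.map.rot x)) :=
  Relation.EqvGen.rel _ _ (Or.inr ⟨h, rfl⟩)

theorem Ahead.strandRel {x : S.Dart} {a : Fin (2 * n)} {m : ℕ} (h : S.Ahead x a m) :
    S.strandRel x (S.strandStart a) := by
  induction h with
  | finish h =>
    rw [← h]
    exact strandRel_flip (by rw [← isArc_flip_iff, h]; exact S.not_isArc_strandStart _)
  | step h _ ih =>
    exact S.strandRel.trans' (strandRel_flip (isArc_flip_iff.not.1 h.not_isArc))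
      (S.strandRel.trans' (strandRel_rot_rot h) ih)

variable (S)

/-- The strand through `x` runs from the boundary point `b` to the boundary point `a`. -/
def Joins (x : S.Dart) (a b : Fin (2 * n)) : Prop :=
  (∃ m, S.Ahead x a m) ∧ ∃ m, S.Ahead (S.map.flip x) b m

/-- Moving on along a strand is injective, hence a permutation of the finite set of darts that never
reach the boundary. A dart that starts at the boundary has no predecessor, so it is not in this set.
-/
theorem exists_ahead_strandStart (j : Fin (2 * n)) : ∃ a m, S.Ahead (S.strandStart j) a m := by
  have := S.finite
  by_contra hj
  let Q : Set S.Dart := {x | ¬ S.IsArc x ∧ ¬ ∃ a m, S.Ahead x a m}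
  have hQ : ∀ x ∈ Q, S.IsInner (S.map.flip x) := fun x hx => by
    by_contra h
    obtain ⟨a, ha⟩ := S.exists_eq_strandStart (isArc_flip_iff.not.2 hx.1) h
    exact hx.2 ⟨a, 0, .finish ha⟩
  have hQ2 : ∀ x ∈ Q, S.map.rot (S.map.rot (S.map.flip x)) ∈ Q := fun x hx => by
    refine ⟨IsInner.not_isArc ?_, fun ⟨a, m, h⟩ => hx.2 ⟨a, m + 1, .step (hQ x hx) h⟩⟩
    rw [isInner_rot_iff, isInner_rot_iff]
    exact hQ x hx
  let f : Q → Q := fun x => ⟨_, hQ2 x.1 x.2⟩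
  have hf : Function.Injective f := fun x y h => by
    have := congrArg Subtype.val h
    exact Subtype.ext (S.map.flip.injective (S.map.rot.injective (S.map.rot.injective this)))
  obtain ⟨y, hy⟩ := Finite.surjective_of_injective hf ⟨_, S.not_isArc_strandStart j, hj⟩
  have h1 : S.map.rot (S.map.rot (S.map.flip y.1)) = S.strandStart j := congrArg Subtype.val hy
  apply S.not_isInner_strandStart j
  rw [← h1, isInner_rot_iff, isInner_rot_iff]
  exact hQ y.1 y.2

variable {S}

theorem Joins.flip {x : S.Dart} {a b : Fin (2 * n)} (h : S.Joins x a b) :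
    S.Joins (S.map.flip x) b a := ⟨h.2, by rw [S.map.flip_flip]; exact h.1⟩

theorem Joins.rot_rot {x : S.Dart} {a b : Fin (2 * n)} (h : S.Joins x a b) (hx : S.IsInner x) :
    S.Joins (S.map.rot (S.map.rot x)) b a := by
  obtain ⟨⟨m, h1⟩, ⟨k, h2⟩⟩ := h
  constructor
  · cases h2 with
    | finish h => rw [S.map.flip_flip] at h; rw [h] at hx; exact absurd hx (S.not_isInner_strandStart _)
    | step h h' => rw [S.map.flip_flip] at h'; exact ⟨_, h'⟩
  · refine ⟨m + 1, .step ?_ ?_⟩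
    · rw [S.map.flip_flip, isInner_rot_iff, isInner_rot_iff]; exact hx
    · rw [S.map.flip_flip, rot_four hx]; exact h1

/-- Both generators of `strandRel` only exchange the two ends. -/
theorem Joins.strandRel {x y : S.Dart} {a b : Fin (2 * n)} (h : S.Joins x a b)
    (hxy : S.strandRel x y) : S.Joins y a b ∨ S.Joins y b a := by
  have key : (S.Joins x a b ∨ S.Joins x b a) ↔ (S.Joins y a b ∨ S.Joins y b a) := by
    clear h
    induction hxy with
    | rel x y h =>
      rcases h with ⟨_, rfl⟩ | ⟨hx, rfl⟩
      · constructor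
        · rintro (h | h)
          · exact Or.inr h.flip
          · exact Or.inl h.flip
        · rintro (h | h)
          · right; simpa [S.map.flip_flip] using h.flip
          · left; simpa [S.map.flip_flip] using h.flip
      · have hx2 : S.IsInner (S.map.rot (S.map.rot x)) := by
          rw [isInner_rot_iff, isInner_rot_iff]; exact hx
        constructor
        · rintro (h | h)
          · exact Or.inr (h.rot_rot hx)
          · exact Or.inl (h.rot_rot hx)
        · rintro (h | h)
          · right; simpa [rot_four hx] using h.rot_rot hx2
          · left; simpa [rot_four hx] using h.rot_rot hx2
    | refl => rfl
    | symm _ _ _ ih => exact ih.symm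
    | trans _ _ _ _ _ ih1 ih2 => exact ih1.trans ih2
  exact key.1 (Or.inl h)

theorem Joins.unique {x : S.Dart} {a b c d : Fin (2 * n)} (h : S.Joins x a b)
    (h' : S.Joins x c d) : a = c ∧ b = d :=
  ⟨(h.1.choose_spec.unique h'.1.choose_spec).1, (h.2.choose_spec.unique h'.2.choose_spec).1⟩

theorem Joins.not_isArc {x : S.Dart} {a b : Fin (2 * n)} (h : S.Joins x a b) : ¬ S.IsArc x :=
  h.1.choose_spec.not_isArc

end DiskDrawing

namespace StrandDiagram

open BoundedMap DiskDrawing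

variable {n : ℕ} {S : StrandDiagram n} {τ : PointMatching n}

/-- The strands that start at `a` and at `partner a` are the same. Traversed in the same direction
they would start at the same point, so one is the reverse of the other. -/
theorem IsDiagramOf.joins_strandStart (h : S.IsDiagramOf τ) (a : Fin (2 * n)) :
    S.Joins (S.strandStart a) (τ.partner a) a := by
  have key : ∀ j, ∃ c, S.Joins (S.strandStart j) c j := fun j => by
    obtain ⟨c, m, hc⟩ := S.exists_ahead_strandStart j
    exact ⟨c, ⟨m, hc⟩, 0, .finish (S.map.flip_flip _)⟩
  obtain ⟨c, hc⟩ := key a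
  obtain ⟨d, hd⟩ := key (τ.partner a)
  rcases hc.strandRel ((h a (τ.partner a)).2 (Or.inr rfl)) with h1 | h1
  · exact absurd (h1.unique hd).2.symm (τ.partner_ne a)
  · rw [← (h1.unique hd).2]; exact hc

theorem IsDiagramOf.exists_joins (h : S.IsDiagramOf τ) {x : S.Dart} (hx : ¬ S.IsArc x) :
    ∃ a, S.Joins x a (τ.partner a) := by
  obtain ⟨j, hj⟩ := S.no_closed_strand x hx
  rcases (h.joins_strandStart j).strandRel hj with h1 | h1
  · refine ⟨τ.partner j, ?_⟩
    rwa [τ.partner_partner]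
  · exact ⟨_, h1⟩

theorem IsDiagramOf.eq_partner (h : S.IsDiagramOf τ) {x : S.Dart} {a b : Fin (2 * n)}
    (hx : S.Joins x a b) : b = τ.partner a := by
  obtain ⟨c, hc⟩ := h.exists_joins hx.not_isArc
  obtain ⟨rfl, rfl⟩ := hx.unique hc
  rfl

theorem IsDiagramOf.strandRel_iff (h : S.IsDiagramOf τ) {x y : S.Dart} {a b c d : Fin (2 * n)}
    (hx : S.Joins x a c) (hy : S.Joins y b d) : S.strandRel x y ↔ b = a ∨ b = τ.partner a := by
  constructor
  · intro hxy
    rcases hx.strandRel hxy with h1 | h1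
    · exact Or.inl (hy.unique h1).1
    · right
      rw [(hy.unique h1).1]
      exact h.eq_partner hx
  · intro hab
    obtain ⟨⟨m, h1⟩, -⟩ := hx
    obtain ⟨⟨k, h2⟩, -⟩ := hy
    exact S.strandRel.trans' h1.strandRel
      (S.strandRel.trans' ((h a b).2 hab) (S.strandRel.symm' h2.strandRel))

end StrandDiagram

/-! ### Chords of the matching and the two sides of a strand. -/

theorem val_finRotate {m : ℕ} (i : Fin m) :
    (finRotate m i).val = if i.val + 1 = m then 0 else i.val + 1 := by
  cases m with
  | zero => exact i.elim0
  | succ m =>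
    rw [coe_finRotate]
    simp [Fin.ext_iff]

theorem val_finRotate_symm {m : ℕ} (i : Fin m) :
    ((finRotate m).symm i).val = if i.val = 0 then m - 1 else i.val - 1 := by
  have h := val_finRotate ((finRotate m).symm i)
  rw [Equiv.apply_symm_apply] at h
  have := ((finRotate m).symm i).isLt
  split_ifs at h ⊢ <;> omega

theorem eq_of_finRotate_invariant {m : ℕ} {β : Type*} {f : Fin m → β}
    (h : ∀ i, f (finRotate m i) = f i) (i j : Fin m) : f i = f j := by
  have key : ∀ (k : ℕ) (hk : k < m) (h0 : 0 < m), f ⟨k, hk⟩ = f ⟨0, h0⟩ := by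
    intro k
    induction k with
    | zero => intros; rfl
    | succ k ih =>
      intro hk h0
      rw [← ih (by omega) h0, ← h ⟨k, by omega⟩]
      congr 1
      ext
      rw [val_finRotate]
      simp only
      split_ifs <;> omega
  rw [key i i.2 (by have := i.2; omega), key j j.2]

namespace PointMatching

variable {n : ℕ} (τ : PointMatching n)

/-- The boundary arc from `j` to `j + 1` lies under the chord at `p`. -/
def Under (p j : Fin (2 * n)) : Prop :=
  (p ≤ j ∧ j < τ.partner p) ∨ (τ.partner p ≤ j ∧ j < p)

/-- The chord of `b` crosses the chord from `τ a` to `a` and `b` is on the left. -/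
def Cr (a b : Fin (2 * n)) : Prop :=
  b ≠ a ∧ b ≠ τ.partner a ∧ (τ.Under a b ↔ τ.partner a < a) ∧
    (τ.Under a (τ.partner b) ↔ a < τ.partner a)

variable {τ}

theorem partner_eq_iff {a b : Fin (2 * n)} : τ.partner a = b ↔ a = τ.partner b :=
  ⟨fun h => by rw [← h, τ.partner_partner], fun h => by rw [h, τ.partner_partner]⟩

theorem partner_injective : Function.Injective τ.partner := fun a b h => by
  rw [partner_eq_iff, τ.partner_partner] at h; exact h

end PointMatching

namespace DiskDrawing

open BoundedMap

variable {n : ℕ} (S : DiskDrawing n)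

/-- The dart `x` runs towards the boundary point `a`. -/
def Toward (x : S.Dart) (a : Fin (2 * n)) : Prop := ∃ m, S.Ahead x a m

variable {S}

theorem Toward.unique {x : S.Dart} {a b : Fin (2 * n)} (h : S.Toward x a) (h' : S.Toward x b) :
    a = b := (h.choose_spec.unique h'.choose_spec).1

theorem Toward.not_isArc {x : S.Dart} {a : Fin (2 * n)} (h : S.Toward x a) : ¬ S.IsArc x :=
  h.choose_spec.not_isArc

end DiskDrawing

namespace StrandDiagram

open BoundedMap DiskDrawing

namespace IsDiagramOf

variable {n : ℕ} {S : StrandDiagram n} {τ : PointMatching n} (h : S.IsDiagramOf τ)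
include h

theorem joins {x : S.Dart} {a : Fin (2 * n)} (hx : S.Toward x a) : S.Joins x a (τ.partner a) := by
  obtain ⟨b, hb⟩ := h.exists_joins hx.not_isArc
  rw [hx.unique hb.1]; exact hb

theorem exists_toward {x : S.Dart} (hx : ¬ S.IsArc x) : ∃ a, S.Toward x a :=
  let ⟨a, ha⟩ := h.exists_joins hx
  ⟨a, ha.1⟩

theorem toward_flip {x : S.Dart} {a : Fin (2 * n)} (hx : S.Toward x a) :
    S.Toward (S.map.flip x) (τ.partner a) := (h.joins hx).2

theorem toward_flip_iff {x : S.Dart} {a : Fin (2 * n)} :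
    S.Toward (S.map.flip x) a ↔ S.Toward x (τ.partner a) :=
  ⟨fun hx => by simpa [S.map.flip_flip] using h.toward_flip hx,
    fun hx => by simpa [τ.partner_partner] using h.toward_flip hx⟩

theorem toward_rot_rot {x : S.Dart} {a : Fin (2 * n)} (hx : S.Toward x a) (hi : S.IsInner x) :
    S.Toward (S.map.rot (S.map.rot x)) (τ.partner a) := ((h.joins hx).rot_rot hi).1

theorem toward_strandStart (a : Fin (2 * n)) : S.Toward (S.strandStart a) (τ.partner a) :=
  (h.joins_strandStart a).1

theorem strandRel_iff_toward {x y : S.Dart} {a b : Fin (2 * n)}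
    (hx : S.Toward x a) (hy : S.Toward y b) : S.strandRel x y ↔ b = a ∨ b = τ.partner a :=
  h.strandRel_iff (h.joins hx) (h.joins hy)

/-- Two strands cross at most once. -/
theorem eq_of_crossing {x y : S.Dart} {a b c d : Fin (2 * n)} (hx : S.IsInner x) (hy : S.IsInner y)
    (hxa : S.Toward x a) (hya : S.Toward y b) (hab : b = a ∨ b = τ.partner a)
    (hxb : S.Toward (S.map.rot x) c) (hyb : S.Toward (S.map.rot y) d)
    (hcd : d = c ∨ d = τ.partner c) : (y = x ∧ b = a) ∨
      (y = S.map.rot (S.map.rot x) ∧ b = τ.partner a) := by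
  have h1 := S.no_double_crossing x y hx hy ((h.strandRel_iff_toward hxa hya).2 hab)
    ((h.strandRel_iff_toward hxb hyb).2 hcd)
  have h2 : ¬ S.strandRel x (S.map.rot x) := S.no_self_crossing x hx
  rcases (vertexRel_iff_of_isInner hx).1 h1 with rfl | rfl | rfl | rfl
  · exact Or.inl ⟨rfl, hya.unique hxa⟩
  · exact absurd ((h.strandRel_iff_toward hxa hya).2 hab) h2
  · exact Or.inr ⟨rfl, hya.unique (h.toward_rot_rot hxa hx)⟩
  · refine absurd (S.strandRel.trans' ((h.strandRel_iff_toward hxa hya).2 hab) ?_) h2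
    exact S.strandRel.symm' (strandRel_rot_rot (isInner_rot_iff.2 hx))

omit h in
-- Walking around the boundary, one enters or leaves the part under a chord only at its ends. The
-- last arc, from `2n - 1` to `0`, lies under no chord.
theorem _root_.PointMatching.under_pred (p j : Fin (2 * n)) :
    (τ.Under p j ↔ τ.Under p ((finRotate (2 * n)).symm j)) ↔ ¬ (j = p ∨ j = τ.partner p) := by
  have h1 := val_finRotate_symm j
  have h2 := p.isLt
  have h3 := (τ.partner p).isLt
  have h4 : (τ.partner p).val ≠ p.val := fun h => τ.partner_ne p (Fin.ext h)
  simp only [PointMatching.Under, Fin.le_def, Fin.lt_def, Fin.ext_iff]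
  split_ifs at h1 <;> omega

/-- Every strand separates the disk into the side under it and the other side. -/
theorem exists_side (p : Fin (2 * n)) : ∃ g : S.Dart → Prop,
    (∀ x, g (S.map.faceNext x) ↔ g x) ∧
    (∀ x a, S.Toward x a → a ≠ p → a ≠ τ.partner p → (g (S.map.flip x) ↔ g x)) ∧
    (∀ x a, S.Toward x a → (a = p ∨ a = τ.partner p) → (g (S.map.flip x) ↔ ¬ g x)) ∧
    (∀ j, g (S.strandStart j) ↔ τ.Under p j) ∧ ∀ j, ¬ g (S.arc j) := by
  classical
  have := S.finite
  have := Fintype.ofFinite S.Dart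
  -- The closed curve formed by the strand at `p` and the boundary arcs under its chord.
  let w : S.Dart → ZMod 2 := fun x =>
    if (∃ j, (x = S.arc j ∨ x = S.map.flip (S.arc j)) ∧ τ.Under p j) ∨
      (S.Toward x p ∨ S.Toward x (τ.partner p)) then 1 else 0
  have hflip : ∀ x, w (S.map.flip x) = w x := fun x => by
    refine if_congr (or_congr (exists_congr fun j => and_congr ?_ Iff.rfl) ?_) rfl rfl
    · rw [S.map.flip.apply_eq_iff_eq, or_comm]
      refine or_congr Iff.rfl ⟨fun h => ?_, fun h => ?_⟩
      · rw [← h, S.map.flip_flip]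
      · rw [h, S.map.flip_flip]
    · rw [h.toward_flip_iff, h.toward_flip_iff, τ.partner_partner, or_comm]
  have harc : ∀ j, w (S.arc j) = if τ.Under p j then 1 else 0 := fun j => by
    refine if_congr ?_ rfl rfl
    constructor
    · rintro (⟨i, hi | hi, hu⟩ | hh | hh)
      · rwa [S.arc_injective hi]
      · exact absurd hi.symm (S.flip_arc_ne _ _)
      · exact absurd (isArc_arc j) hh.not_isArc
      · exact absurd (isArc_arc j) hh.not_isArc
    · exact fun hu => Or.inl ⟨j, Or.inl rfl, hu⟩
  have hnon : ∀ x a, S.Toward x a → w x = if a = p ∨ a = τ.partner p then 1 else 0 := by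
    intro x a hx
    refine if_congr ?_ rfl rfl
    constructor
    · rintro (⟨i, hi | hi, -⟩ | hh | hh)
      · rw [hi] at hx; exact absurd (isArc_arc i) hx.not_isArc
      · rw [hi] at hx; exact absurd (isArc_flip_arc i) hx.not_isArc
      · exact Or.inl (hx.unique hh)
      · exact Or.inr (hx.unique hh)
    · rintro (rfl | rfl)
      · exact Or.inr (Or.inl hx)
      · exact Or.inr (Or.inr hx)
  have hrr : ∀ x, S.IsInner x → w (S.map.rot (S.map.rot x)) = w x := fun x hx => by
    obtain ⟨a, ha⟩ := h.exists_toward hx.not_isArc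
    rw [hnon x a ha, hnon _ _ (h.toward_rot_rot ha hx)]
    refine if_congr ?_ rfl rfl
    rw [PointMatching.partner_eq_iff, PointMatching.partner_eq_iff, τ.partner_partner, or_comm]
  have hstart : ∀ j, w (S.strandStart j) = if j = p ∨ j = τ.partner p then 1 else 0 := fun j => by
    rw [hnon _ _ (h.toward_strandStart j)]
    refine if_congr ?_ rfl rfl
    rw [PointMatching.partner_eq_iff, PointMatching.partner_eq_iff, τ.partner_partner, or_comm]
  -- The curve is a cycle: at a crossing, opposite darts have equal weight; at a boundary point the
  -- two arcs have different weights exactly if the strand at `p` ends there.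
  obtain ⟨g, hg1, hg2⟩ := S.planar.exists_face_potential w hflip (fun d => by
    by_cases hd : S.IsInner d
    · have hs : Finset.univ.filter (fun x => S.map.vertexRel d x) =
          {d, S.map.rot d, S.map.rot (S.map.rot d), S.map.rot (S.map.rot (S.map.rot d))} := by
        ext x
        simp only [Finset.mem_filter, Finset.mem_univ, true_and, Finset.mem_insert,
          Finset.mem_singleton]
        exact vertexRel_iff_of_isInner hd
      have hd1 := isInner_rot_iff.2 hd
      have n1 := rot_ne hd
      have n2 := rot_rot_ne hd
      rw [hs, Finset.sum_insert, Finset.sum_insert, Finset.sum_insert, Finset.sum_singleton,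
        hrr _ hd, hrr _ hd1]
      · generalize w d = u
        generalize w (S.map.rot d) = v
        revert u v; decide
      · simp only [Finset.mem_singleton, S.map.rot.apply_eq_iff_eq]
        exact n1.symm
      · simp only [Finset.mem_singleton, Finset.mem_insert, S.map.rot.apply_eq_iff_eq, not_or]
        exact ⟨n1.symm, n2.symm⟩
      · simp only [Finset.mem_singleton, Finset.mem_insert, not_or]
        refine ⟨n1.symm, n2.symm, fun h3 => ?_⟩
        have := congrArg S.map.rot h3
        rw [rot_four hd] at this
        exact n1 this
    · simp only [IsInner, not_forall, not_not] at hd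
      obtain ⟨j, hj⟩ := hd
      have hs : Finset.univ.filter (fun x => S.map.vertexRel d x) =
          {S.arc j, S.map.rot (S.arc j), S.strandStart j} := by
        ext x
        simp only [Finset.mem_filter, Finset.mem_univ, true_and, Finset.mem_insert,
          Finset.mem_singleton]
        rw [← S.vertexRel_arc_iff]
        exact ⟨S.map.vertexRel.trans' hj, S.map.vertexRel.trans' (S.map.vertexRel.symm' hj)⟩
      have n1 : S.arc j ≠ S.strandStart j := fun h => by
        have := isArc_arc (B := S.toBoundedMap) j
        rw [h] at this; exact S.not_isArc_strandStart j this
      rw [hs, Finset.sum_insert, Finset.sum_insert, Finset.sum_singleton, S.rot_arc, hflip, harc,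
        harc, hstart]
      · have := PointMatching.under_pred (τ := τ) p j
        by_cases h1 : τ.Under p j <;>
        by_cases h2 : τ.Under p ((finRotate (2 * n)).symm j) <;>
        by_cases h3 : j = p ∨ j = τ.partner p <;> simp only [h1, h2, h3, if_true, if_false] <;>
        first | (exfalso; tauto) | decide
      · rw [S.rot_arc, Finset.mem_singleton]
        intro h
        have := isArc_flip_arc (B := S.toBoundedMap) ((finRotate (2 * n)).symm j)
        rw [h] at this; exact S.not_isArc_strandStart j this
      · rw [S.rot_arc, Finset.mem_insert, Finset.mem_singleton, not_or]
        exact ⟨fun h => S.flip_arc_ne _ _ h.symm, n1⟩)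
  have hout : ∀ j, g (S.arc j) = g (S.arc p) := fun j =>
    eq_of_finRotate_invariant (f := fun j => g (S.arc j))
      (fun i => by rw [← S.faceNext_arc]; exact hg1 _) j p
  have z2 : ∀ a b c : ZMod 2, a + b = 1 → (b + c = 1 ↔ ¬ a + c = 1) := by decide
  have z3 : ∀ a b c : ZMod 2, a + b = 0 → (b + c = 1 ↔ a + c = 1) := by decide
  -- A potential is determined up to a constant only; here it is made zero outside.
  refine ⟨fun x => g x + g (S.arc p) = 1, fun x => by beta_reduce; rw [hg1], fun x a hx h1 h2 => ?_,
    fun x a hx h1 => ?_, fun j => ?_, fun j => ?_⟩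
  · have := hg2 x
    rw [hnon x a hx, if_neg (by tauto)] at this
    exact z3 _ _ _ this
  · have := hg2 x
    rw [hnon x a hx, if_pos h1] at this
    exact z2 _ _ _ this
  · have h1 : S.map.faceNext (S.map.flip (S.arc j)) = S.strandStart j := by
      rw [DartMap.faceNext_flip]; rfl
    have h2 := hg2 (S.arc j)
    beta_reduce
    rw [← h1, hg1, ← hout j, add_comm, h2, harc]
    split_ifs with h3 <;> simp [h3]
  · beta_reduce
    rw [hout, CharTwo.add_self_eq_zero]
    decide

end IsDiagramOf

end StrandDiagram

namespace PointMatching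

variable {n : ℕ} {τ : PointMatching n}

/-- The quarter turn at a crossing. It reflects that counterclockwise the ends of the two strands
follow each other as `a`, `b`, `partner a`, `partner b`. -/
theorem Cr.rot {a b : Fin (2 * n)} (h : τ.Cr a b) : τ.Cr b (τ.partner a) := by
  have h1 := a.isLt
  have h2 := b.isLt
  have h3 := (τ.partner a).isLt
  have h4 := (τ.partner b).isLt
  have h5 : (τ.partner a).val ≠ a.val := fun h => τ.partner_ne a (Fin.ext h)
  have h6 : (τ.partner b).val ≠ b.val := fun h => τ.partner_ne b (Fin.ext h)
  have h7 : τ.partner b = a ↔ b = τ.partner a := partner_eq_iff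
  have h8 : τ.partner b = τ.partner a ↔ b = a := partner_injective.eq_iff
  simp only [Cr, Under, ne_eq, Fin.le_def, Fin.lt_def, Fin.ext_iff, τ.partner_partner] at *
  omega

/-- Of the two ends of a crossing chord only one is on the left. -/
theorem Cr.not_partner {a b : Fin (2 * n)} (h : τ.Cr a b) : ¬ τ.Cr a (τ.partner b) := fun h' => by
  have := h.2.2.2.symm.trans h'.2.2.1
  have h5 := τ.partner_ne a
  rcases lt_or_gt_of_ne h5 with h6 | h6
  · exact absurd (this.2 h6) h6.not_gt
  · exact absurd (this.1 h6) h6.not_gt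

end PointMatching

namespace StrandDiagram.IsDiagramOf

open BoundedMap DiskDrawing

variable {n : ℕ} {S : StrandDiagram n} {τ : PointMatching n} (h : S.IsDiagramOf τ)

/-- The face on the left of the dart lies under the strand at `p`. -/
noncomputable def side (p : Fin (2 * n)) : S.Dart → Prop := (h.exists_side p).choose

theorem side_faceNext (p : Fin (2 * n)) (x : S.Dart) :
    h.side p (S.map.faceNext x) ↔ h.side p x := (h.exists_side p).choose_spec.1 x

theorem side_flip {p a : Fin (2 * n)} {x : S.Dart} (hx : S.Toward x a)
    (hp : ¬ (a = p ∨ a = τ.partner p)) : h.side p (S.map.flip x) ↔ h.side p x :=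
  (h.exists_side p).choose_spec.2.1 x a hx (fun h => hp (Or.inl h)) fun h => hp (Or.inr h)

theorem side_flip_on {p a : Fin (2 * n)} {x : S.Dart} (hx : S.Toward x a)
    (hp : a = p ∨ a = τ.partner p) : h.side p (S.map.flip x) ↔ ¬ h.side p x :=
  (h.exists_side p).choose_spec.2.2.1 x a hx hp

theorem side_strandStart (p j : Fin (2 * n)) : h.side p (S.strandStart j) ↔ τ.Under p j :=
  (h.exists_side p).choose_spec.2.2.2.1 j

theorem side_flip_arc (p j : Fin (2 * n)) : h.side p (S.map.flip (S.arc j)) ↔ τ.Under p j := by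
  rw [← side_strandStart h, ← side_faceNext h, DartMap.faceNext_flip]
  rfl

theorem side_flip_rot (p : Fin (2 * n)) (x : S.Dart) :
    h.side p (S.map.flip (S.map.rot x)) ↔ h.side p x := by
  rw [← side_faceNext h, DartMap.faceNext_flip_rot]

theorem side_rot {p a : Fin (2 * n)} {x : S.Dart} (hx : S.Toward (S.map.rot x) a)
    (hp : ¬ (a = p ∨ a = τ.partner p)) : h.side p (S.map.rot x) ↔ h.side p x := by
  rw [← h.side_flip hx hp, side_flip_rot]

theorem side_rot_on {p a : Fin (2 * n)} {x : S.Dart} (hx : S.Toward (S.map.rot x) a)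
    (hp : a = p ∨ a = τ.partner p) : h.side p (S.map.rot x) ↔ ¬ h.side p x := by
  have := h.side_flip_on hx hp
  rw [side_flip_rot] at this
  tauto

theorem ahead_next {x : S.Dart} {a : Fin (2 * n)} (hx : S.Toward x a)
    (hi : S.IsInner (S.map.flip x)) : S.Toward (S.map.rot (S.map.rot (S.map.flip x))) a := by
  obtain ⟨m, hm⟩ := hx
  cases hm with
  | finish h => rw [h] at hi; exact absurd hi (S.not_isInner_strandStart _)
  | step _ h => exact ⟨_, h⟩

theorem on_partner {a p : Fin (2 * n)} :
    (τ.partner a = p ∨ τ.partner a = τ.partner p) ↔ (a = p ∨ a = τ.partner p) := by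
  rw [PointMatching.partner_eq_iff, PointMatching.partner_injective.eq_iff, or_comm]

include h in
theorem not_on_rot {x : S.Dart} {a b p : Fin (2 * n)} (hi : S.IsInner x) (hx : S.Toward x a)
    (hy : S.Toward (S.map.rot x) b) (hp : a = p ∨ a = τ.partner p) :
    ¬ (b = p ∨ b = τ.partner p) := by
  intro hb
  refine S.no_self_crossing x hi ((h.strandRel_iff_toward hx hy).2 ?_)
  rcases hp with rfl | rfl
  · exact hb
  · rw [τ.partner_partner]; exact hb.symm

/-- Going around the crossing from the left face before it to the left face after it, one crosses
the strand of `x` twice and the other strand once. So nothing changes even if `x` itself lies on the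
strand at `p`. -/
theorem side_next {x : S.Dart} {a b p : Fin (2 * n)} (hx : S.Toward x a)
    (hi : S.IsInner (S.map.flip x)) (hb : S.Toward (S.map.rot (S.map.flip x)) b)
    (hp : ¬ (b = p ∨ b = τ.partner p)) :
    h.side p (S.map.rot (S.map.rot (S.map.flip x))) ↔ h.side p x := by
  have hy := ahead_next hx hi
  by_cases ha : a = p ∨ a = τ.partner p
  · rw [h.side_rot_on hy ha, h.side_rot hb hp, h.side_flip_on hx ha, not_not]
  · rw [h.side_rot hy ha, h.side_rot hb hp, h.side_flip hx ha]

theorem side_next_on {x : S.Dart} {a b p : Fin (2 * n)} (hx : S.Toward x a)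
    (hi : S.IsInner (S.map.flip x)) (hb : S.Toward (S.map.rot (S.map.flip x)) b)
    (hp : b = p ∨ b = τ.partner p) :
    h.side p (S.map.rot (S.map.rot (S.map.flip x))) ↔ ¬ h.side p x := by
  have hy := ahead_next hx hi
  have ha : ¬ (a = p ∨ a = τ.partner p) := by
    have := h.not_on_rot (p := p) (isInner_rot_iff.2 hi) hb hy hp
    exact this
  rw [h.side_rot hy ha, h.side_rot_on hb hp, h.side_flip hx ha]

/-- The left side of a strand. -/
theorem side_self {x : S.Dart} {a p : Fin (2 * n)} (hx : S.Toward x a)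
    (hp : a = p ∨ a = τ.partner p) : h.side p x ↔ τ.partner a < a := by
  obtain ⟨m, hm⟩ := hx
  induction hm with
  | @finish x a h1 =>
    have h2 := h.side_flip_on ⟨0, .finish h1⟩ hp
    rw [h1, side_strandStart] at h2
    have h3 : τ.Under p a ↔ a < τ.partner a := by
      rcases hp with rfl | rfl
      · simp only [PointMatching.Under, le_refl, true_and, lt_irrefl, and_false, or_false]
      · simp only [PointMatching.Under, τ.partner_partner, le_refl, true_and, lt_irrefl,
          and_false, false_or]
    have h4 := τ.partner_ne a
    rw [h3] at h2
    rw [← not_iff_not, ← h2, not_lt]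
    exact ⟨le_of_lt, fun h => lt_of_le_of_ne h h4.symm⟩
  | @step x a m h1 h2 ih =>
    rw [← ih hp]
    obtain ⟨b, hb⟩ := h.exists_toward (isInner_rot_iff.2 h1).not_isArc
    have := h.not_on_rot (isInner_rot_iff.2 (isInner_rot_iff.2 h1)) ⟨m, h2⟩
      (h.toward_rot_rot hb (isInner_rot_iff.2 h1)) hp
    rw [on_partner] at this
    exact (h.side_next ⟨_, .step h1 h2⟩ h1 hb this).symm

/-- A dart is on the same side of a strand as the boundary point that it runs towards, unless it
runs into a crossing with that strand. -/
theorem side_iff_of_ahead {x : S.Dart} {a p : Fin (2 * n)} {m : ℕ} (hx : S.Ahead x a m)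
    (hp : ¬ (a = p ∨ a = τ.partner p)) : (h.side p x ↔ τ.Under p a) ↔
      ¬ ∃ y k b, k < m ∧ S.Ahead y a k ∧ S.IsInner y ∧ S.Toward (S.map.rot y) b ∧
        (b = p ∨ b = τ.partner p) := by
  induction hx with
  | @finish x a h1 =>
    have : h.side p x ↔ τ.Under p a := by
      rw [← h.side_flip ⟨0, .finish h1⟩ hp, h1, side_strandStart]
    simp [this]
  | @step x a m h1 h2 ih =>
    obtain ⟨b, hb⟩ := h.exists_toward (isInner_rot_iff.2 h1).not_isArc
    have hr := h.toward_rot_rot hb (isInner_rot_iff.2 h1)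
    have hi : S.IsInner (S.map.rot (S.map.rot (S.map.flip x))) :=
      isInner_rot_iff.2 (isInner_rot_iff.2 h1)
    by_cases hbp : b = p ∨ b = τ.partner p
    · have h3 := h.side_next_on ⟨_, .step h1 h2⟩ h1 hb hbp
      -- The strand at `p` is crossed here and cannot be met a second time, so the remaining part
      -- stays on the side of its end.
      have h4 : ¬ ∃ y k b, k < m ∧ S.Ahead y a k ∧ S.IsInner y ∧ S.Toward (S.map.rot y) b ∧
          (b = p ∨ b = τ.partner p) := by
        rintro ⟨y, k, c, hk, hy, hyi, hyc, hc⟩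
        have hbc : c = τ.partner b ∨ c = τ.partner (τ.partner b) := by
          rw [τ.partner_partner]
          rcases hbp with rfl | rfl <;> rcases hc with rfl | rfl <;> simp [τ.partner_partner]
        rcases h.eq_of_crossing hi hyi ⟨_, h2⟩ ⟨_, hy⟩ (Or.inl rfl) hr hyc hbc with
          ⟨h5, -⟩ | ⟨-, h5⟩
        · rw [h5] at hy
          exact hk.ne (hy.unique h2).2
        · exact τ.partner_ne a h5.symm
      have h5 := (ih hp).2 h4
      have h6 : ∃ y k b, k < m + 1 ∧ S.Ahead y a k ∧ S.IsInner y ∧ S.Toward (S.map.rot y) b ∧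
          (b = p ∨ b = τ.partner p) :=
        ⟨_, m, _, Nat.lt_succ_self m, h2, hi, hr, on_partner.2 hbp⟩
      rw [h3] at h5
      exact iff_of_false (fun h7 => not_iff_self (by rwa [h7] at h5)) (not_not.2 h6)
    · have h3 := h.side_next ⟨_, .step h1 h2⟩ h1 hb hbp
      rw [← h3, ih hp]
      refine not_congr ⟨fun ⟨y, k, c, hk, hr⟩ => ⟨y, k, c, Nat.lt_succ_of_lt hk, hr⟩, ?_⟩
      rintro ⟨y, k, c, hk, hy, hyi, hyc, hc⟩
      rcases (Nat.lt_succ_iff_lt_or_eq.1 hk) with hk | rfl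
      · exact ⟨y, k, c, hk, hy, hyi, hyc, hc⟩
      · rw [hy.injective h2] at hyc
        rw [hyc.unique hr, on_partner] at hc
        exact absurd hc hbp

/-- Beyond a crossing a strand stays on the same side of the strand that it has crossed. -/
theorem side_iff_of_crossing {x : S.Dart} {a b p : Fin (2 * n)} (hi : S.IsInner x)
    (hx : S.Toward x a) (hy : S.Toward (S.map.rot x) b) (hp : b = p ∨ b = τ.partner p) :
    h.side p x ↔ τ.Under p a := by
  have ha : ¬ (a = p ∨ a = τ.partner p) := fun ha => h.not_on_rot hi hx hy ha hp
  obtain ⟨m, hm⟩ := hx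
  rw [h.side_iff_of_ahead hm ha]
  rintro ⟨y, k, c, hk, hy', hyi, hyc, hc⟩
  have hbc : c = b ∨ c = τ.partner b := by
    rcases hp with rfl | rfl <;> rcases hc with rfl | rfl <;> simp [τ.partner_partner]
  rcases h.eq_of_crossing hi hyi ⟨_, hm⟩ ⟨_, hy'⟩ (Or.inl rfl) hy hyc hbc with ⟨h5, -⟩ | ⟨-, h5⟩
  · rw [h5] at hy'
    exact hk.ne (hy'.unique hm).2
  · exact τ.partner_ne a h5.symm

include h in
-- At the crossing itself `side_self` tells which side is the left of the strand towards `a`; the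
-- strand towards `b` then stays on that side up to the boundary, where sides are given by `Under`.
theorem cr_aux {x : S.Dart} {a b : Fin (2 * n)} (hi : S.IsInner x)
    (hx : S.Toward x a) (hy : S.Toward (S.map.rot x) b) : τ.Under a b ↔ τ.partner a < a := by
  have h1 := isInner_rot_iff.2 hi
  rw [← h.side_iff_of_crossing h1 hy (h.toward_rot_rot hx hi) (Or.inr rfl),
    h.side_rot hy (h.not_on_rot hi hx hy (Or.inl rfl)), h.side_self hx (Or.inl rfl)]

include h in
-- The condition on `partner b` is that of `cr_aux` after a half turn at the crossing.
theorem cr_of_isInner {x : S.Dart} {a b : Fin (2 * n)} (hi : S.IsInner x)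
    (hx : S.Toward x a) (hy : S.Toward (S.map.rot x) b) : τ.Cr a b := by
  have h1 := isInner_rot_iff.2 hi
  have h2 := h.not_on_rot hi hx hy (Or.inl rfl)
  refine ⟨fun h => h2 (Or.inl h), fun h => h2 (Or.inr h), h.cr_aux hi hx hy, ?_⟩
  have h3 := h.cr_aux (isInner_rot_iff.2 h1) (h.toward_rot_rot hx hi) (h.toward_rot_rot hy h1)
  rw [τ.partner_partner] at h3
  rw [← h3]
  simp only [PointMatching.Under, τ.partner_partner]
  exact or_comm

include h in
-- The strand towards `b` starts and ends on different sides of the strand at `a`, so it meets that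
-- strand. If it crossed in the wrong direction, `partner b` would be on the left.
theorem exists_isInner {a b : Fin (2 * n)} (hab : τ.Cr a b) :
    ∃ x, S.IsInner x ∧ S.Toward x a ∧ S.Toward (S.map.rot x) b := by
  obtain ⟨m, hm⟩ : S.Toward (S.strandStart (τ.partner b)) b := by
    simpa [τ.partner_partner] using h.toward_strandStart (τ.partner b)
  have h0 : ¬ (b = a ∨ b = τ.partner a) := fun h => h.elim hab.1 hab.2.1
  have h1 := h.side_iff_of_ahead hm h0
  have h2 : ¬ (h.side a (S.strandStart (τ.partner b)) ↔ τ.Under a b) := by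
    rw [side_strandStart, hab.2.2.1, hab.2.2.2]
    intro h3
    rcases lt_or_gt_of_ne (τ.partner_ne a) with h6 | h6
    · exact absurd (h3.2 h6) h6.not_gt
    · exact absurd (h3.1 h6) h6.not_gt
  rw [h1, not_not] at h2
  obtain ⟨y, k, c, -, hy, hyi, hc, rfl | rfl⟩ := h2
  · have hyi1 := isInner_rot_iff.2 hyi
    exact absurd (h.cr_of_isInner hyi1 hc (h.toward_rot_rot ⟨k, hy⟩ hyi)) hab.not_partner
  · have hyi1 := isInner_rot_iff.2 hyi
    refine ⟨S.map.rot (S.map.rot (S.map.rot y)), isInner_rot_iff.2 (isInner_rot_iff.2 hyi1), ?_, ?_⟩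
    · simpa [τ.partner_partner] using h.toward_rot_rot hc hyi1
    · rw [rot_four hyi]; exact ⟨k, hy⟩

include h in
theorem isInner_unique {x y : S.Dart} {a b : Fin (2 * n)} (hx : S.IsInner x) (hxa : S.Toward x a)
    (hxb : S.Toward (S.map.rot x) b) (hy : S.IsInner y) (hya : S.Toward y a)
    (hyb : S.Toward (S.map.rot y) b) : x = y := by
  rcases h.eq_of_crossing hx hy hxa hya (Or.inl rfl) hxb hyb (Or.inl rfl) with ⟨h1, -⟩ | ⟨-, h1⟩
  · exact h1.symm
  · exact absurd h1.symm (τ.partner_ne a)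

end StrandDiagram.IsDiagramOf

/-! ### Pairwise crossing chords and regions with few sides. -/

namespace PointMatching

variable {n : ℕ} {τ : PointMatching n}

variable (τ) in
/-- The chords at `p` and `q` are distinct and cross. -/
def Cross (p q : Fin (2 * n)) : Prop :=
  q ≠ p ∧ q ≠ τ.partner p ∧ ¬ (τ.Under p q ↔ τ.Under p (τ.partner q))

theorem Cr.cross {a b : Fin (2 * n)} (h : τ.Cr a b) : τ.Cross a b := by
  refine ⟨h.1, h.2.1, fun h3 => ?_⟩
  rw [h.2.2.1, h.2.2.2] at h3
  rcases lt_or_gt_of_ne (τ.partner_ne a) with h6 | h6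
  · exact absurd (h3.1 h6) h6.not_gt
  · exact absurd (h3.2 h6) h6.not_gt

theorem Cross.cr_or {a b : Fin (2 * n)} (h : τ.Cross a b) : τ.Cr a b ∨ τ.Cr a (τ.partner b) := by
  obtain ⟨h1, h2, h3⟩ := h
  have h4 : τ.partner b ≠ a := fun h => h2 (partner_eq_iff.1 h)
  have h5 : τ.partner b ≠ τ.partner a := fun h => h1 (partner_injective h)
  have h6 := τ.partner_ne a
  have h7 : a < τ.partner a ↔ ¬ τ.partner a < a :=
    ⟨fun h => h.not_gt, fun h => lt_of_le_of_ne (not_lt.1 h) h6.symm⟩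
  simp only [Cr, τ.partner_partner, h7]
  by_cases c1 : τ.Under a b <;> by_cases c2 : τ.Under a (τ.partner b) <;>
    by_cases c3 : τ.partner a < a <;> simp_all

theorem cross_partner_left {p q : Fin (2 * n)} : τ.Cross (τ.partner p) q ↔ τ.Cross p q := by
  simp only [Cross, Under, τ.partner_partner]
  tauto

theorem cross_partner_right {p q : Fin (2 * n)} : τ.Cross p (τ.partner q) ↔ τ.Cross p q := by
  have h1 : τ.partner q = p ↔ q = τ.partner p := partner_eq_iff
  have h2 : τ.partner q = τ.partner p ↔ q = p := partner_injective.eq_iff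
  simp only [Cross, τ.partner_partner, ne_eq, h1, h2]
  tauto

theorem cross_iff_of_lt {p q : Fin (2 * n)} (hp : p < τ.partner p) (hq : q < τ.partner q)
    (hpq : p < q) : τ.Cross p q ↔ q < τ.partner p ∧ τ.partner p < τ.partner q := by
  have h4 : τ.partner q = τ.partner p ↔ q = p := partner_injective.eq_iff
  simp only [Cross, Under, ne_eq, Fin.le_def, Fin.lt_def, Fin.ext_iff] at *
  omega

/-- The definition is not symmetric, but the quarter turn `Cr.rot` exchanges the two chords. -/
theorem Cross.symm {p q : Fin (2 * n)} (h : τ.Cross p q) : τ.Cross q p := by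
  rcases h.cr_or with h1 | h1
  · exact cross_partner_right.1 h1.rot.cross
  · exact cross_partner_left.1 (cross_partner_right.1 h1.rot.cross)

theorem exists_left (τ : PointMatching n) (p : Fin (2 * n)) :
    ∃ q, (q = p ∨ q = τ.partner p) ∧ q < τ.partner q := by
  rcases lt_or_gt_of_ne (τ.partner_ne p) with h6 | h6
  · exact ⟨τ.partner p, Or.inr rfl, by rwa [τ.partner_partner]⟩
  · exact ⟨p, Or.inl rfl, h6⟩

/-- Three noncrossing fails if and only if three chords cross pairwise. -/
theorem not_isNoncrossing_three_iff : ¬ τ.IsNoncrossing 3 ↔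
    ∃ p q r, τ.Cross p q ∧ τ.Cross q r ∧ τ.Cross p r := by
  rw [IsNoncrossing, not_not]
  constructor
  · rintro ⟨L, hL, h1, h2⟩
    obtain ⟨p, q, r, hpq, hpr, hqr, rfl⟩ := Finset.card_eq_three.1 hL
    have key : ∀ i ∈ ({p, q, r} : Finset (Fin (2 * n))), ∀ j ∈ ({p, q, r} : Finset (Fin (2 * n))),
        i ≠ j → τ.Cross i j := fun i hi j hj hij => by
      rcases lt_or_gt_of_ne hij with h3 | h3
      · exact (cross_iff_of_lt (h1 i hi) (h1 j hj) h3).2 (h2 i hi j hj h3)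
      · exact ((cross_iff_of_lt (h1 j hj) (h1 i hi) h3).2 (h2 j hj i hi h3)).symm
    exact ⟨p, q, r, key _ (by simp) _ (by simp) hpq, key _ (by simp) _ (by simp) hqr,
      key _ (by simp) _ (by simp) hpr⟩
  · rintro ⟨p, q, r, hpq, hqr, hpr⟩
    obtain ⟨p', hp, hp'⟩ := τ.exists_left p
    obtain ⟨q', hq, hq'⟩ := τ.exists_left q
    obtain ⟨r', hr, hr'⟩ := τ.exists_left r
    have c : ∀ {p q p' q' : Fin (2 * n)}, τ.Cross p q → (p' = p ∨ p' = τ.partner p) →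
        (q' = q ∨ q' = τ.partner q) → τ.Cross p' q' := by
      rintro p q p' q' h (rfl | rfl) (rfl | rfl)
      · exact h
      · exact cross_partner_right.2 h
      · exact cross_partner_left.2 h
      · exact cross_partner_left.2 (cross_partner_right.2 h)
    have c1 := c hpq hp hq
    have c2 := c hqr hq hr
    have c3 := c hpr hp hr
    refine ⟨{p', q', r'}, Finset.card_eq_three.2 ⟨p', q', r', c1.1.symm, c3.1.symm, c2.1.symm, rfl⟩,
      fun i hi => ?_, fun i hi j hj hij => ?_⟩
    · simp only [Finset.mem_insert, Finset.mem_singleton] at hi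
      rcases hi with rfl | rfl | rfl <;> assumption
    · have hl : ∀ i ∈ ({p', q', r'} : Finset (Fin (2 * n))), i < τ.partner i := fun i hi => by
        simp only [Finset.mem_insert, Finset.mem_singleton] at hi
        rcases hi with rfl | rfl | rfl <;> assumption
      refine (cross_iff_of_lt (hl i hi) (hl j hj) hij).1 ?_
      simp only [Finset.mem_insert, Finset.mem_singleton] at hi hj
      rcases hi with rfl | rfl | rfl <;> rcases hj with rfl | rfl | rfl <;>
        first
        | exact absurd hij (lt_irrefl _)
        | assumption
        | exact c1.symm
        | exact c2.symm
        | exact c3.symm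

end PointMatching

namespace StrandDiagram

open BoundedMap DiskDrawing

variable {n : ℕ} {S : StrandDiagram n} {τ : PointMatching n}

/-- A region with a corner at a boundary point has a side on the circle, as `strandStart j` is the
successor of `flip (arc j)` on its walk. -/
theorem isInner_of_walkRel {d x : S.Dart} (hd : ∀ x, S.map.walkRel d x → ¬ S.IsArc x)
    (hx : S.map.walkRel d x) : S.IsInner x := by
  by_contra hi
  obtain ⟨j, rfl⟩ := S.exists_eq_strandStart (hd x hx) hi
  refine hd (S.map.flip (S.arc j)) (S.map.walkRel.trans' hx (S.map.walkRel.symm' ⟨1, ?_⟩))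
    (isArc_flip_arc j)
  rw [zpow_one, DartMap.faceNext_flip]
  rfl

/-- Around a region with one side a strand would return to its own crossing. -/
theorem faceNext_ne {x : S.Dart} (hx : S.IsInner x) : S.map.faceNext x ≠ x := fun h => by
  have h1 := S.map.rot_faceNext x
  rw [h] at h1
  exact S.no_self_crossing x hx (by rw [h1]; exact strandRel_flip hx.not_isArc)

/-- The two sides would lie on strands that cross at both corners, so both corners are the same
crossing; each of the four positions of the second dart at this crossing is then excluded. -/
theorem faceNext_faceNext_ne {x : S.Dart} (hx : S.IsInner x) (hy : S.IsInner (S.map.faceNext x)) :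
    S.map.faceNext (S.map.faceNext x) ≠ x := fun h => by
  have h1 := S.map.rot_faceNext x
  have h2 := S.map.rot_faceNext (S.map.faceNext x)
  rw [h] at h2
  have hxy := faceNext_ne hx
  generalize S.map.faceNext x = y at *
  have h3 : S.strandRel x (S.map.rot y) := by rw [h1]; exact strandRel_flip hx.not_isArc
  have h4 : S.strandRel y (S.map.rot x) := by rw [h2]; exact strandRel_flip hy.not_isArc
  have h5 := S.no_double_crossing x (S.map.rot y) hx (isInner_rot_iff.2 hy) h3
    (S.strandRel.trans' (S.strandRel.symm' h4) (strandRel_rot_rot hy))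
  have h6 : S.map.vertexRel x y := S.map.vertexRel.trans' h5
    (S.map.vertexRel.symm' (S.map.vertexRel_rot y))
  rcases (vertexRel_iff_of_isInner hx).1 h6 with h7 | h7 | h7 | h7
  · exact hxy h7
  · exact S.map.flip_ne y (by rw [← h2, h7])
  · apply S.no_self_crossing x hx
    refine S.strandRel.trans' (strandRel_rot_rot hx) ?_
    rw [← h7]; exact h4
  · have := rot_four hx
    rw [← h7, h1] at this
    exact S.map.flip_ne x this

theorem faceNext_pow_ncard (d : S.Dart) :
    ((S.map.faceNext) ^ ({x | S.map.walkRel d x}.ncard)) d = d := by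
  have := S.finite
  exact ((Equiv.Perm.SameCycle.pow_eq_iff_of_ncard
    (f := S.map.faceNext) (x := d) rfl).1 _).2 (dvd_refl _)

theorem three_le_ncard_walk {d : S.Dart} (hd : ∀ x, S.map.walkRel d x → ¬ S.IsArc x) :
    3 ≤ {x | S.map.walkRel d x}.ncard := by
  have := S.finite
  have h0 : 0 < {x | S.map.walkRel d x}.ncard :=
    (Set.ncard_pos).2 ⟨d, S.map.walkRel.refl' d⟩
  have h1 := faceNext_pow_ncard d
  have i0 := isInner_of_walkRel hd (S.map.walkRel.refl' d)
  have i1 := isInner_of_walkRel hd (S.map.walkRel_faceNext d)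
  by_contra hlt
  interval_cases h : {x | S.map.walkRel d x}.ncard
  · exact faceNext_ne i0 h1
  · exact faceNext_faceNext_ne i0 i1 h1

theorem IsDiagramOf.interiorRegionsHaveFourSides (h : S.IsDiagramOf τ) (hτ : τ.IsNoncrossing 3) :
    S.InteriorRegionsHaveFourSides := by
  intro d hd
  have h0 := three_le_ncard_walk hd
  by_contra hlt
  have h1 := faceNext_pow_ncard d
  have h2 : {x | S.map.walkRel d x}.ncard = 3 := by omega
  rw [h2] at h1
  have w1 := S.map.walkRel_faceNext d
  have w2 := S.map.walkRel.trans' w1 (S.map.walkRel_faceNext _)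
  have i0 := isInner_of_walkRel hd (S.map.walkRel.refl' d)
  have i1 := isInner_of_walkRel hd w1
  have i2 := isInner_of_walkRel hd w2
  obtain ⟨a, ha⟩ := h.exists_toward i0.not_isArc
  obtain ⟨b, hb⟩ := h.exists_toward i1.not_isArc
  obtain ⟨c, hc⟩ := h.exists_toward i2.not_isArc
  have h3 : S.map.faceNext (S.map.faceNext (S.map.faceNext d)) = d := h1
  have r1 := S.map.rot_faceNext d
  have r2 := S.map.rot_faceNext (S.map.faceNext d)
  have r3 := S.map.rot_faceNext (S.map.faceNext (S.map.faceNext d))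
  rw [h3] at r3
  -- Each corner of the region is a crossing of the strands on two successive sides.
  have c1 := h.cr_of_isInner i1 hb (by rw [r1]; exact h.toward_flip ha)
  have c2 := h.cr_of_isInner i2 hc (by rw [r2]; exact h.toward_flip hb)
  have c3 := h.cr_of_isInner i0 ha (by rw [r3]; exact h.toward_flip hc)
  refine PointMatching.not_isNoncrossing_three_iff.2 ⟨a, b, c, ?_, ?_, ?_⟩ hτ
  · exact (PointMatching.cross_partner_right.1 c1.cross).symm
  · exact (PointMatching.cross_partner_right.1 c2.cross).symm
  · exact PointMatching.cross_partner_right.1 c3.cross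

end StrandDiagram

/-! ### Three pairwise crossing strands enclose a region with three sides. -/

namespace StrandDiagram.IsDiagramOf

open BoundedMap DiskDrawing

variable {n : ℕ} {S : StrandDiagram n} {τ : PointMatching n} (h : S.IsDiagramOf τ)

/-- The dart lies on the strand at `p`. -/
@[nolint unusedArguments]
def On (_ : S.IsDiagramOf τ) (p : Fin (2 * n)) (x : S.Dart) : Prop :=
  S.Toward x p ∨ S.Toward x (τ.partner p)

variable {h}

theorem On.exists_toward {p : Fin (2 * n)} {x : S.Dart} (hx : h.On p x) :
    ∃ a, S.Toward x a ∧ (a = p ∨ a = τ.partner p) :=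
  hx.elim (fun hx => ⟨_, hx, Or.inl rfl⟩) fun hx => ⟨_, hx, Or.inr rfl⟩

theorem on_of_toward {p a : Fin (2 * n)} {x : S.Dart} (hx : S.Toward x a)
    (ha : a = p ∨ a = τ.partner p) : h.On p x :=
  ha.elim (fun e => Or.inl (e ▸ hx)) fun e => Or.inr (e ▸ hx)

theorem On.flip {p : Fin (2 * n)} {x : S.Dart} (hx : h.On p x) : h.On p (S.map.flip x) := by
  rcases hx with hx | hx
  · exact Or.inr (h.toward_flip hx)
  · left; simpa [τ.partner_partner] using h.toward_flip hx

theorem On.rot_rot {p : Fin (2 * n)} {x : S.Dart} (hx : h.On p x) (hi : S.IsInner x) :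
    h.On p (S.map.rot (S.map.rot x)) := by
  rcases hx with hx | hx
  · exact Or.inr (h.toward_rot_rot hx hi)
  · left; simpa [τ.partner_partner] using h.toward_rot_rot hx hi

theorem On.on_iff {p q : Fin (2 * n)} {x : S.Dart} (hx : h.On p x) :
    h.On q x ↔ p = q ∨ p = τ.partner q := by
  obtain ⟨a, ha, hap⟩ := hx.exists_toward
  constructor
  · intro hq
    obtain ⟨b, hb, hbq⟩ := hq.exists_toward
    rw [ha.unique hb] at hap
    rcases hap with rfl | rfl
    · exact hbq
    · exact on_partner.1 hbq
  · rintro (rfl | rfl)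
    · exact hx
    · refine on_of_toward ha ?_
      rw [τ.partner_partner] at hap; exact hap.symm

theorem on_unique {p q : Fin (2 * n)} {x y : S.Dart} (hx : S.IsInner x) (hy : S.IsInner y)
    (hxp : h.On p x) (hyp : h.On p y) (hxq : h.On q (S.map.rot x)) (hyq : h.On q (S.map.rot y)) :
    y = x ∨ y = S.map.rot (S.map.rot x) := by
  obtain ⟨a, ha, hap⟩ := hxp.exists_toward
  obtain ⟨b, hb, hbp⟩ := hyp.exists_toward
  obtain ⟨c, hc, hcq⟩ := hxq.exists_toward
  obtain ⟨d, hd, hdq⟩ := hyq.exists_toward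
  have aux : ∀ {a b p : Fin (2 * n)}, (a = p ∨ a = τ.partner p) → (b = p ∨ b = τ.partner p) →
      b = a ∨ b = τ.partner a := by
    rintro a b p (rfl | rfl) (rfl | rfl) <;> simp [τ.partner_partner]
  rcases h.eq_of_crossing hx hy ha hb (aux hap hbp) hc hd (aux hcq hdq) with h1 | h1
  · exact Or.inl h1.1
  · exact Or.inr h1.1

theorem On.side_rot {p r : Fin (2 * n)} {x : S.Dart} (hx : h.On p (S.map.rot x))
    (hp : ¬ (p = r ∨ p = τ.partner r)) : h.side r (S.map.rot x) ↔ h.side r x := by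
  obtain ⟨a, ha, rfl | rfl⟩ := hx.exists_toward
  · exact h.side_rot ha hp
  · exact h.side_rot ha (on_partner.not.2 hp)

theorem On.side_rot_self {p : Fin (2 * n)} {x : S.Dart} (hx : h.On p (S.map.rot x)) :
    h.side p (S.map.rot x) ↔ ¬ h.side p x := by
  obtain ⟨a, ha, hap⟩ := hx.exists_toward
  exact h.side_rot_on ha hap

theorem On.cross {p q : Fin (2 * n)} {x : S.Dart} (hi : S.IsInner x) (hp : h.On p x)
    (hq : h.On q (S.map.rot x)) : τ.Cross p q := by
  obtain ⟨a, ha, hap⟩ := hp.exists_toward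
  obtain ⟨b, hb, hbq⟩ := hq.exists_toward
  have := (h.cr_of_isInner hi ha hb).cross
  rcases hap with rfl | rfl <;> rcases hbq with rfl | rfl <;>
    simpa only [PointMatching.cross_partner_left, PointMatching.cross_partner_right] using this

variable (h) in
theorem exists_cross {p q : Fin (2 * n)} (hpq : τ.Cross p q) :
    ∃ y, S.IsInner y ∧ S.Toward y p ∧ h.On q (S.map.rot y) := by
  rcases hpq.cr_or with h1 | h1
  · obtain ⟨y, hy1, hy2, hy3⟩ := h.exists_isInner h1
    exact ⟨y, hy1, hy2, Or.inl hy3⟩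
  · obtain ⟨y, hy1, hy2, hy3⟩ := h.exists_isInner h1
    exact ⟨y, hy1, hy2, Or.inr hy3⟩

variable (h) in
/-- The crossing of the strands at `p` and `q` lies under the strand at `r`. -/
def crossSide (r p q : Fin (2 * n)) : Prop :=
  ∃ y, S.IsInner y ∧ h.On p y ∧ h.On q (S.map.rot y) ∧ h.side r y

/-- All four faces at the crossing are on the same side of a third strand, so the dart in
`crossSide` can be chosen freely. -/
theorem crossSide_iff {r p q : Fin (2 * n)} {y : S.Dart} (hi : S.IsInner y) (hp : h.On p y)
    (hq : h.On q (S.map.rot y)) (hpr : ¬ (p = r ∨ p = τ.partner r))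
    (hqr : ¬ (q = r ∨ q = τ.partner r)) : h.crossSide r p q ↔ h.side r y := by
  constructor
  · rintro ⟨z, hz, hzp, hzq, hzr⟩
    rcases on_unique hi hz hp hzp hq hzq with rfl | rfl
    · exact hzr
    · rwa [(hp.rot_rot hi).side_rot hpr, hq.side_rot hqr] at hzr
  · exact fun hy => ⟨y, hi, hp, hq, hy⟩

theorem crossSide_comm {r p q : Fin (2 * n)} (hpq : τ.Cross p q)
    (hpr : ¬ (p = r ∨ p = τ.partner r)) (hqr : ¬ (q = r ∨ q = τ.partner r)) :
    h.crossSide r p q ↔ h.crossSide r q p := by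
  obtain ⟨y, hi, hp, hq⟩ := h.exists_cross hpq
  have hp' : h.On p y := Or.inl hp
  rw [crossSide_iff hi hp' hq hpr hqr,
    crossSide_iff (isInner_rot_iff.2 hi) hq (hp'.rot_rot hi) hqr hpr, hq.side_rot hqr]

variable (h) in
/-- The number of crossings between the crossing with the strand at `q` and the end `p`. -/
noncomputable def pos (p q : Fin (2 * n)) : ℕ :=
  sInf {k | ∃ y, S.Ahead y p k ∧ S.IsInner y ∧ h.On q (S.map.rot y)}

/-- As strands cross at most once, the set whose infimum defines `pos` has a single element. For
strands that do not cross it is empty and `pos` has the meaningless value `0`. -/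
theorem pos_eq {p q : Fin (2 * n)} {y : S.Dart} {k : ℕ} (hy : S.Ahead y p k) (hi : S.IsInner y)
    (hq : h.On q (S.map.rot y)) : h.pos p q = k := by
  have : {k | ∃ y, S.Ahead y p k ∧ S.IsInner y ∧ h.On q (S.map.rot y)} = {k} := by
    ext l
    simp only [Set.mem_ofPred_eq, Set.mem_singleton_iff]
    constructor
    · rintro ⟨z, hz, hzi, hzq⟩
      rcases on_unique hi hzi (Or.inl ⟨_, hy⟩) (Or.inl ⟨_, hz⟩) hq hzq with rfl | rfl
      · exact (hz.unique hy).2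
      · exact absurd ((h.toward_rot_rot ⟨_, hy⟩ hi).unique ⟨_, hz⟩) (τ.partner_ne p)
    · rintro rfl
      exact ⟨y, hy, hi, hq⟩
  rw [pos, this, csInf_singleton]

theorem exists_pos {p q : Fin (2 * n)} (hpq : τ.Cross p q) :
    ∃ y, S.Ahead y p (h.pos p q) ∧ S.IsInner y ∧ h.On q (S.map.rot y) := by
  obtain ⟨y, hi, ⟨k, hk⟩, hq⟩ := h.exists_cross hpq
  exact ⟨y, by rwa [pos_eq hk hi hq], hi, hq⟩

theorem pos_ne {p q r : Fin (2 * n)} (hpq : τ.Cross p q) (hpr : τ.Cross p r)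
    (hqr : ¬ (q = r ∨ q = τ.partner r)) : h.pos p q ≠ h.pos p r := by
  intro he
  obtain ⟨y, hy, -, hq⟩ := h.exists_pos hpq
  obtain ⟨z, hz, -, hr⟩ := h.exists_pos hpr
  rw [← he] at hz
  rw [← hy.injective hz] at hr
  exact hqr (hq.on_iff.1 hr)

/-- On the way from the crossing with `q` to the end `p` the side of `r` changes exactly if `r` is
crossed. This dictionary between sides and the order along a strand carries the argument about
triangles. -/
theorem crossSide_iff_pos {p q r : Fin (2 * n)} (hpq : τ.Cross p q) (hpr : τ.Cross p r)
    (hqr : ¬ (q = r ∨ q = τ.partner r)) :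
    (h.crossSide r p q ↔ τ.Under r p) ↔ h.pos p q < h.pos p r := by
  obtain ⟨y, hy, hyi, hq⟩ := h.exists_pos hpq
  obtain ⟨z, hz, hzi, hr⟩ := h.exists_pos hpr
  have hpr' : ¬ (p = r ∨ p = τ.partner r) := fun e =>
    e.elim hpr.symm.1 hpr.symm.2.1
  rw [crossSide_iff hyi (Or.inl ⟨_, hy⟩) hq hpr' hqr, h.side_iff_of_ahead hy hpr']
  have h1 : (∃ y k b, k < h.pos p q ∧ S.Ahead y p k ∧ S.IsInner y ∧ S.Toward (S.map.rot y) b ∧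
      (b = r ∨ b = τ.partner r)) ↔ h.pos p r < h.pos p q := by
    constructor
    · rintro ⟨x, k, b, hk, hx, hxi, hb, hbr⟩
      rwa [pos_eq hx hxi (on_of_toward hb hbr)]
    · intro hlt
      obtain ⟨b, hb, hbr⟩ := hr.exists_toward
      exact ⟨z, _, b, hlt, hz, hzi, hb, hbr⟩
  rw [h1, not_lt]
  have := pos_ne (h := h) hpq hpr hqr
  omega

end StrandDiagram.IsDiagramOf

namespace PointMatching

variable {n : ℕ} {τ : PointMatching n}

theorem Cross.not_or {p q : Fin (2 * n)} (h : τ.Cross p q) : ¬ (p = q ∨ p = τ.partner q) :=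
  fun e => e.elim h.symm.1 h.symm.2.1

theorem Cross.not_or' {p q : Fin (2 * n)} (h : τ.Cross p q) : ¬ (q = p ∨ q = τ.partner p) :=
  h.symm.not_or

theorem under_partner {p j : Fin (2 * n)} : τ.Under (τ.partner p) j ↔ τ.Under p j := by
  rw [Under, Under, τ.partner_partner, or_comm]

/-- The pattern of the triangle between three crossing chords does not occur on the boundary. -/
theorem not_boundary_pattern_of_left {i j k m : Fin (2 * n)} {ti tj tk : Prop}
    (hi : i < τ.partner i) (hj : j < τ.partner j) (hk : k < τ.partner k)
    (hij : τ.Cross i j) (hjk : τ.Cross j k) (hik : τ.Cross i k)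
    (h1 : (tj ↔ τ.Under j i) ↔ ¬ (tk ↔ τ.Under k i))
    (h2 : (ti ↔ τ.Under i j) ↔ ¬ (tk ↔ τ.Under k j)) :
    ¬ ((τ.Under i m ↔ ti) ∧ (τ.Under j m ↔ tj) ∧ (τ.Under k m ↔ tk)) := by
  rintro ⟨e1, e2, e3⟩
  rw [← e1, ← e3] at h2
  rw [← e2, ← e3] at h1
  have u : ∀ {p : Fin (2 * n)} (q), p < τ.partner p →
      (τ.Under p q ↔ p.val ≤ q.val ∧ q.val < (τ.partner p).val) := by
    intro p q hp
    simp only [Under, Fin.le_def, Fin.lt_def] at *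
    omega
  have c : ∀ {p q : Fin (2 * n)}, p < τ.partner p → q < τ.partner q → τ.Cross p q →
      (p.val < q.val ∧ q.val < (τ.partner p).val ∧ (τ.partner p).val < (τ.partner q).val ∧
        τ.Under p q ∧ ¬ τ.Under q p) ∨
      (q.val < p.val ∧ p.val < (τ.partner q).val ∧ (τ.partner q).val < (τ.partner p).val ∧
        τ.Under q p ∧ ¬ τ.Under p q) := by
    intro p q hp hq hpq
    rw [u _ hp, u _ hq]
    rcases lt_or_gt_of_ne hpq.1 with hlt | hlt
    · have := (cross_iff_of_lt hq hp hlt).1 hpq.symm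
      simp only [Fin.lt_def] at *
      omega
    · have := (cross_iff_of_lt hp hq hlt).1 hpq
      simp only [Fin.lt_def] at *
      omega
  have a1 := u m hi
  have a2 := u m hj
  have a3 := u m hk
  -- Any two of the chords interleave in one of two ways; in each case the pattern required of the
  -- arc `m` contradicts the order of the six ends.
  rcases c hi hj hij with ⟨b1, b2, b3, b4, b5⟩ | ⟨b1, b2, b3, b4, b5⟩ <;>
  rcases c hj hk hjk with ⟨c1, c2, c3, c4, c5⟩ | ⟨c1, c2, c3, c4, c5⟩ <;>
  rcases c hi hk hik with ⟨d1, d2, d3, d4, d5⟩ | ⟨d1, d2, d3, d4, d5⟩ <;>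
  by_cases f1 : τ.Under i m <;> by_cases f2 : τ.Under j m <;> by_cases f3 : τ.Under k m <;>
  simp only [b4, b5, c4, c5, d4, d5, f1, f2, f3, not_true_eq_false, iff_self, iff_false,
    iff_true, true_iff, false_iff, not_false_eq_true] at h1 h2 a1 a2 a3 <;>
  omega

end PointMatching

namespace PointMatching

variable {n : ℕ} {τ : PointMatching n}

theorem Cross.under_partner_right {p q : Fin (2 * n)} (h : τ.Cross p q) :
    τ.Under p (τ.partner q) ↔ ¬ τ.Under p q := by
  have := h.2.2
  by_cases h1 : τ.Under p q <;> by_cases h2 : τ.Under p (τ.partner q) <;> simp_all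

/-- With `ti`, `tj`, `tk` the sides on which the triangle lies, `h1` and `h2` say that on the chords
`i` and `j` exactly one of the two corners is the nearer one to the given end. Replacing an end by
its partner negates both `Under` terms of the hypothesis for that chord, which keeps it true, so all
ends may be taken to be left ends. -/
theorem not_boundary_pattern {i j k : Fin (2 * n)} (m : Fin (2 * n)) {ti tj tk : Prop}
    (hij : τ.Cross i j) (hjk : τ.Cross j k) (hik : τ.Cross i k)
    (h1 : (tj ↔ τ.Under j i) ↔ ¬ (tk ↔ τ.Under k i))
    (h2 : (ti ↔ τ.Under i j) ↔ ¬ (tk ↔ τ.Under k j)) :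
    ¬ ((τ.Under i m ↔ ti) ∧ (τ.Under j m ↔ tj) ∧ (τ.Under k m ↔ tk)) := by
  have g1 : ∀ a b c d : Prop, ((a ↔ b) ↔ ¬ (c ↔ d)) → ((a ↔ ¬ b) ↔ ¬ (c ↔ ¬ d)) := by
    intro a b c d; by_cases a <;> by_cases b <;> by_cases c <;> by_cases d <;> simp_all
  obtain ⟨i', rfl | rfl, hi⟩ := τ.exists_left i <;>
  obtain ⟨j', rfl | rfl, hj⟩ := τ.exists_left j <;>
  obtain ⟨k', rfl | rfl, hk⟩ := τ.exists_left k <;>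
  (have key := not_boundary_pattern_of_left (m := m) (ti := ti) (tj := tj) (tk := tk) hi hj hk
   try simp only [cross_partner_left, cross_partner_right, under_partner,
     hij.under_partner_right, hij.symm.under_partner_right, hjk.symm.under_partner_right,
     hik.symm.under_partner_right] at key
   refine key hij hjk hik ?_ ?_ <;> first | assumption | (apply g1; assumption))

end PointMatching

namespace StrandDiagram.IsDiagramOf

open BoundedMap DiskDrawing

variable {n : ℕ} {S : StrandDiagram n} {τ : PointMatching n} {h : S.IsDiagramOf τ}

variable (h) in
/-- The left face of a dart is on the same sides of three crossing strands as the triangle between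
them. -/
def InTriangle (i j k : Fin (2 * n)) (x : S.Dart) : Prop :=
  (h.side i x ↔ h.crossSide i j k) ∧ (h.side j x ↔ h.crossSide j i k) ∧
    (h.side k x ↔ h.crossSide k i j)

variable (h) in
/-- The strand at `m` crosses the strand at `i` between the strands at `j` and `k`. -/
def Between (i j k m : Fin (2 * n)) : Prop :=
  τ.Cross i m ∧ ((h.pos i j < h.pos i m ∧ h.pos i m < h.pos i k) ∨
    (h.pos i k < h.pos i m ∧ h.pos i m < h.pos i j))

theorem Between.symm {i j k m : Fin (2 * n)} (hb : h.Between i j k m) : h.Between i k j m :=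
  ⟨hb.1, hb.2.symm⟩

/-- By `crossSide_iff_pos` both sides compare positions along `i`. In terms of sides, betweenness
can be tested at any face next to the crossing. -/
theorem between_iff {i j k m : Fin (2 * n)} (hij : τ.Cross i j) (hik : τ.Cross i k)
    (hjk : τ.Cross j k) (him : τ.Cross i m) (hmj : ¬ (m = j ∨ m = τ.partner j))
    (hmk : ¬ (m = k ∨ m = τ.partner k)) : h.Between i j k m ↔
      (h.crossSide j i m ↔ h.crossSide j i k) ∧ (h.crossSide k i m ↔ h.crossSide k i j) := by
  have h1 := crossSide_iff_pos (h := h) him hij hmj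
  have h2 := crossSide_iff_pos (h := h) him hik hmk
  have h3 := crossSide_iff_pos (h := h) hik hij hjk.not_or'
  have h4 := crossSide_iff_pos (h := h) hij hik hjk.not_or
  have h5 := pos_ne (h := h) him hij hmj
  have h6 := pos_ne (h := h) him hik hmk
  have h7 := pos_ne (h := h) hij hik hjk.not_or
  have g : ∀ a b u : Prop, ((a ↔ u) ↔ (b ↔ u)) ↔ (a ↔ b) := by
    intro a b u; by_cases a <;> by_cases b <;> by_cases u <;> simp_all
  have e1 : (h.crossSide j i m ↔ h.crossSide j i k) ↔
      (h.pos i m < h.pos i j ↔ h.pos i k < h.pos i j) := by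
    rw [← h1, ← h3]; exact (g _ _ _).symm
  have e2 : (h.crossSide k i m ↔ h.crossSide k i j) ↔
      (h.pos i m < h.pos i k ↔ h.pos i j < h.pos i k) := by
    rw [← h2, ← h4]; exact (g _ _ _).symm
  rw [e1, e2, Between]
  simp only [him, true_and]
  omega

/-- Three pairwise crossing chords leave one region that is away from the boundary, the triangle.
The positions of the corners on the strands `i` and `j` supply the hypotheses of
`not_boundary_pattern`. -/
theorem InTriangle.not_boundary {i j k : Fin (2 * n)} (hij : τ.Cross i j) (hjk : τ.Cross j k)
    (hik : τ.Cross i k) {x : S.Dart} (hx : h.InTriangle i j k x) (m : Fin (2 * n)) :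
    ¬ ((τ.Under i m ↔ h.side i x) ∧ (τ.Under j m ↔ h.side j x) ∧
      (τ.Under k m ↔ h.side k x)) := by
  rw [hx.1, hx.2.1, hx.2.2]
  have h1 := crossSide_iff_pos (h := h) hik hij hjk.not_or'
  have h2 := crossSide_iff_pos (h := h) hij hik hjk.not_or
  have h3 := crossSide_iff_pos (h := h) hjk hij.symm hik.not_or'
  have h4 := crossSide_iff_pos (h := h) hij.symm hjk hik.not_or
  have h5 := pos_ne (h := h) hij hik hjk.not_or
  have h6 := pos_ne (h := h) hij.symm hjk hik.not_or
  have h7 := crossSide_comm (h := h) (r := k) hij hik.not_or hjk.not_or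
  refine PointMatching.not_boundary_pattern m hij hjk hik ?_ ?_
  · rw [h1, h2]; omega
  · rw [h7, h3, h4]; omega

theorem InTriangle.congr {i j k : Fin (2 * n)} {x y : S.Dart} (hx : h.InTriangle i j k x)
    (hi : h.side i y ↔ h.side i x) (hj : h.side j y ↔ h.side j x)
    (hk : h.side k y ↔ h.side k x) : h.InTriangle i j k y :=
  ⟨hi.trans hx.1, hj.trans hx.2.1, hk.trans hx.2.2⟩

theorem InTriangle.rotate {i j k : Fin (2 * n)} (hij : τ.Cross i j) (hjk : τ.Cross j k)
    (hik : τ.Cross i k) {x : S.Dart} (hx : h.InTriangle i j k x) : h.InTriangle k i j x := by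
  refine ⟨hx.2.2, hx.1.trans (crossSide_comm hjk hij.symm.not_or hik.symm.not_or),
    hx.2.1.trans (crossSide_comm hik hij.not_or hjk.symm.not_or)⟩

/-- If the dart ran into a boundary point, the next dart on its walk would be a reversed boundary
arc, with its inner side in the triangle. -/
theorem InTriangle.isInner_flip {i j k : Fin (2 * n)} (hij : τ.Cross i j) (hjk : τ.Cross j k)
    (hik : τ.Cross i k) {x : S.Dart} (hx : h.InTriangle i j k x) (ha : ¬ S.IsArc x) :
    S.IsInner (S.map.flip x) := by
  by_contra hi
  obtain ⟨m, hm⟩ := S.exists_eq_strandStart (isArc_flip_iff.not.2 ha) hi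
  have h1 : S.map.faceNext x = S.map.flip (S.arc ((finRotate (2 * n)).symm m)) := by
    apply S.map.rot.injective
    rw [DartMap.rot_faceNext, hm, ← S.rot_arc, rot_rot_arc]
  refine hx.not_boundary hij hjk hik ((finRotate (2 * n)).symm m) ?_
  simp only [← h.side_flip_arc, ← h1, side_faceNext, iff_self, and_self]

/-- A strand that runs inside a triangle leaves it through one of the sides. -/
theorem InTriangle.exists_exit {i j k m : Fin (2 * n)} (hij : τ.Cross i j) (hjk : τ.Cross j k)
    (hik : τ.Cross i k) {x : S.Dart} {l : ℕ} (hx : h.InTriangle i j k x) (hm : S.Ahead x m l) :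
    ∃ z l', l' < l ∧ S.Ahead z m l' ∧ S.IsInner z ∧
      ((h.On i (S.map.rot z) ∧
        (h.side j z ↔ h.crossSide j i k) ∧ (h.side k z ↔ h.crossSide k i j)) ∨
      (h.On j (S.map.rot z) ∧
        (h.side i z ↔ h.crossSide i j k) ∧ (h.side k z ↔ h.crossSide k i j)) ∨
      (h.On k (S.map.rot z) ∧
        (h.side i z ↔ h.crossSide i j k) ∧ (h.side j z ↔ h.crossSide j i k))) := by
  induction hm with
  | @finish x m h1 =>
    have := hx.isInner_flip hij hjk hik (Ahead.finish h1).not_isArc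
    rw [h1] at this
    exact absurd this (S.not_isInner_strandStart _)
  | @step x m l h1 h2 ih =>
    have hi1 := isInner_rot_iff.2 h1
    have hi2 := isInner_rot_iff.2 hi1
    obtain ⟨b, hb⟩ := h.exists_toward hi1.not_isArc
    have hx0 : S.Toward x m := ⟨_, .step h1 h2⟩
    -- At the next crossing either the strand at `p` is the one that is crossed, or the side of `p`
    -- remains the same.
    have key : ∀ p, h.On p (S.map.rot (S.map.rot (S.map.rot (S.map.flip x)))) ∨
        (h.side p (S.map.rot (S.map.rot (S.map.flip x))) ↔ h.side p x) := fun p => by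
      by_cases hp : b = p ∨ b = τ.partner p
      · exact Or.inl ((on_of_toward hb hp).rot_rot hi1)
      · exact Or.inr (h.side_next hx0 h1 hb hp)
    have excl : ∀ p q, τ.Cross p q → h.On p (S.map.rot (S.map.rot (S.map.rot (S.map.flip x)))) →
        (h.side q (S.map.rot (S.map.rot (S.map.flip x))) ↔ h.side q x) := fun p q hpq hp =>
      (key q).resolve_left fun hq => hpq.not_or (hp.on_iff.1 hq)
    rcases key i with k1 | k1
    · exact ⟨_, l, Nat.lt_succ_self _, h2, hi2, Or.inl ⟨k1, (excl _ _ hij k1).trans hx.2.1,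
        (excl _ _ hik k1).trans hx.2.2⟩⟩
    rcases key j with k2 | k2
    · exact ⟨_, l, Nat.lt_succ_self _, h2, hi2, Or.inr (Or.inl ⟨k2,
        (excl _ _ hij.symm k2).trans hx.1, (excl _ _ hjk k2).trans hx.2.2⟩)⟩
    rcases key k with k3 | k3
    · exact ⟨_, l, Nat.lt_succ_self _, h2, hi2, Or.inr (Or.inr ⟨k3,
        (excl _ _ hik.symm k3).trans hx.1, (excl _ _ hjk.symm k3).trans hx.2.1⟩)⟩
    obtain ⟨z, l', hl, hz⟩ := ih (hx.congr k1 k2 k3)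
    exact ⟨z, l', Nat.lt_succ_of_lt hl, hz⟩

/-- A strand that crosses one side of a triangle crosses another one. -/
theorem Between.exists_other {i j k m : Fin (2 * n)} (hij : τ.Cross i j) (hjk : τ.Cross j k)
    (hik : τ.Cross i k) (hb : h.Between i j k m) : h.Between j i k m ∨ h.Between k i j m := by
  have hmi := hb.1.not_or'
  obtain ⟨w, -, hwi, hwm⟩ := h.exists_pos hb.1
  have hwj : ¬ (m = j ∨ m = τ.partner j) := by
    intro hmj
    obtain ⟨y, hy, hyi, hyj⟩ := h.exists_pos hij
    have : h.pos i m = h.pos i j := pos_eq hy hyi (hyj.on_iff.2 (by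
      rcases hmj with rfl | rfl <;> simp [τ.partner_partner]))
    have := hb.2; omega
  have hwk : ¬ (m = k ∨ m = τ.partner k) := by
    intro hmk
    obtain ⟨y, hy, hyi, hyk⟩ := h.exists_pos hik
    have : h.pos i m = h.pos i k := pos_eq hy hyi (hyk.on_iff.2 (by
      rcases hmk with rfl | rfl <;> simp [τ.partner_partner]))
    have := hb.2; omega
  have hc := (between_iff hij hik hjk hb.1 hwj hwk).1 hb
  obtain ⟨y, hyi, hym, hyo⟩ := h.exists_cross hb.1.symm
  have hym : h.On m y := Or.inl hym
  rw [crossSide_comm hb.1 hij.not_or hwj, crossSide_comm hb.1 hik.not_or hwk,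
    crossSide_iff hyi hym hyo hwj hij.not_or, crossSide_iff hyi hym hyo hwk hik.not_or] at hc
  -- Of the two directions in which `m` leaves its crossing with `i`, one leads into the triangle,
  -- because only the side of `i` differs between them.
  obtain ⟨x, hxi, hxm, hxo, hx⟩ : ∃ x, S.IsInner x ∧ h.On m x ∧ h.On i (S.map.rot x) ∧
      h.InTriangle i j k x := by
    by_cases hs : h.side i y ↔ h.crossSide i j k
    · exact ⟨y, hyi, hym, hyo, hs, hc.1, hc.2⟩
    · have hi1 := isInner_rot_iff.2 hyi
      have hm2 := hym.rot_rot hyi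
      refine ⟨S.map.rot (S.map.rot y), isInner_rot_iff.2 hi1, hm2, hyo.rot_rot hi1, ?_, ?_, ?_⟩
      · rw [hm2.side_rot hmi, hyo.side_rot_self]
        by_cases h1 : h.side i y <;> by_cases h2 : h.crossSide i j k <;> simp_all
      · rw [hm2.side_rot hwj, hyo.side_rot hij.not_or]; exact hc.1
      · rw [hm2.side_rot hwk, hyo.side_rot hik.not_or]; exact hc.2
  obtain ⟨e, ⟨l, he⟩, hem⟩ := hxm.exists_toward
  obtain ⟨z, l', hl, hz, hzi, hzc⟩ := hx.exists_exit hij hjk hik he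
  have hzm : h.On m z := on_of_toward ⟨_, hz⟩ hem
  have cross : ∀ {p}, h.On p (S.map.rot z) → τ.Cross p m := fun hp => (hzm.cross hzi hp).symm
  rcases hzc with ⟨h1, h2, h3⟩ | ⟨h1, h2, h3⟩ | ⟨h1, h2, h3⟩
  -- Leaving through `i` would be a second crossing of `m` with `i`.
  · exfalso
    rcases on_unique hxi hzi hxm hzm hxo h1 with rfl | rfl
    · exact hl.ne (hz.unique he).2
    · exact τ.partner_ne e ((h.toward_rot_rot ⟨_, he⟩ hxi).unique ⟨_, hz⟩)
  · left
    rw [between_iff hij.symm hjk hik (cross h1) hmi hwk, crossSide_comm (cross h1) hij.symm.not_or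
      hmi, crossSide_comm (cross h1) hjk.not_or hwk, crossSide_iff hzi hzm h1 hmi hij.symm.not_or,
      crossSide_iff hzi hzm h1 hwk hjk.not_or, crossSide_comm hij.symm hjk.not_or hik.not_or]
    exact ⟨h2, h3⟩
  · right
    rw [between_iff hik.symm hjk.symm hij (cross h1) hmi hwj, crossSide_comm (cross h1)
      hik.symm.not_or hmi, crossSide_comm (cross h1) hjk.symm.not_or hwj,
      crossSide_iff hzi hzm h1 hmi hik.symm.not_or,
      crossSide_iff hzi hzm h1 hwj hjk.symm.not_or, crossSide_comm hjk.symm hik.symm.not_or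
      hij.symm.not_or, crossSide_comm hik.symm hjk.symm.not_or hij.not_or]
    exact ⟨h2, h3⟩

/-- Around a triangle that no strand crosses, the boundary walk goes from corner to corner. -/
theorem InTriangle.faceNext {i j k : Fin (2 * n)} (hij : τ.Cross i j) (hjk : τ.Cross j k)
    (hik : τ.Cross i k) (hb : ∀ m, ¬ h.Between i j k m) {x : S.Dart} (hx : h.InTriangle i j k x)
    (hxi : S.IsInner x) (hi : h.On i x) (hj : h.On j (S.map.rot x)) :
    h.InTriangle k i j (S.map.faceNext x) ∧ S.IsInner (S.map.faceNext x) ∧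
      h.On k (S.map.faceNext x) ∧ h.On i (S.map.rot (S.map.faceNext x)) := by
  have h1 := hx.isInner_flip hij hjk hik hxi.not_isArc
  have hr := S.map.rot_faceNext x
  have hn : S.map.rot (S.map.rot (S.map.rot (S.map.flip x))) = S.map.faceNext x := by
    apply S.map.rot.injective
    rw [rot_four h1, hr]
  have hi1 := isInner_rot_iff.2 h1
  have hi2 := isInner_rot_iff.2 hi1
  refine ⟨(hx.congr (h.side_faceNext _ _) (h.side_faceNext _ _) (h.side_faceNext _ _)).rotate
    hij hjk hik, by rwa [← isInner_rot_iff, hr], ?_, by rw [hr]; exact hi.flip⟩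
  obtain ⟨b, hb'⟩ := h.exists_toward hi1.not_isArc
  have hbo : h.On b (S.map.rot (S.map.rot (S.map.rot (S.map.flip x)))) :=
    (on_of_toward hb' (Or.inl rfl)).rot_rot hi1
  rw [← hn]
  -- Otherwise the strand `b` met next on `i` is not `k`. It is not `j` either, which `i` crosses
  -- only once, so `b` crosses `i` between `j` and `k`.
  by_contra hk
  obtain ⟨a, ha, hai⟩ := hi.exists_toward
  have ha2 := ahead_next ha h1
  have hi2' : h.On i (S.map.rot (S.map.rot (S.map.flip x))) := on_of_toward ha2 hai
  have hbk : ¬ (b = k ∨ b = τ.partner k) := fun e => hk (hbo.on_iff.2 e)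
  have hbj : ¬ (b = j ∨ b = τ.partner j) := by
    intro e
    obtain ⟨l, hl⟩ := ha
    cases hl with
    | finish h2 => rw [h2] at h1; exact S.not_isInner_strandStart _ h1
    | @step _ _ l _ h2 =>
      rcases on_unique hxi hi2 hi hi2' hj (hbo.on_iff.2 e) with h3 | h3
      · have h4 := (Ahead.step h1 h2)
        rw [h3] at h2
        have := (h4.unique h2).2
        omega
      · rw [h3] at h2
        exact τ.partner_ne a ((h.toward_rot_rot ⟨_, .step h1 (by rw [h3]; exact h2)⟩ hxi).unique
          ⟨_, h2⟩)
  have hib : τ.Cross i b := hi2'.cross hi2 hbo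
  refine hb b ((between_iff hij hik hjk hib hbj hbk).2 ?_)
  rw [crossSide_iff hi2 hi2' hbo hij.not_or hbj, crossSide_iff hi2 hi2' hbo hik.not_or hbk,
    h.side_next ha h1 hb' hbj, h.side_next ha h1 hb' hbk]
  exact ⟨hx.2.1, hx.2.2⟩

/-- Each step of `InTriangle.faceNext` leads from one corner to the next, so that three of them
close the walk. -/
theorem exists_small_face {i j k : Fin (2 * n)} (hij : τ.Cross i j) (hjk : τ.Cross j k)
    (hik : τ.Cross i k) (hbi : ∀ m, ¬ h.Between i j k m) (hbj : ∀ m, ¬ h.Between j i k m)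
    (hbk : ∀ m, ¬ h.Between k i j m) {x : S.Dart} (hx : h.InTriangle i j k x)
    (hxi : S.IsInner x) (hi : h.On i x) (hj : h.On j (S.map.rot x)) :
    ¬ S.InteriorRegionsHaveFourSides := by
  intro hS
  obtain ⟨hx1, hxi1, o1, o2⟩ := hx.faceNext hij hjk hik hbi hxi hi hj
  obtain ⟨hx2, hxi2, o3, o4⟩ := hx1.faceNext hik.symm hij hjk.symm hbk hxi1 o1 o2
  obtain ⟨hx3, hxi3, o5, o6⟩ := hx2.faceNext hjk hik.symm hij.symm
    (fun m hm => hbj m hm.symm) hxi2 o3 o4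
  -- The walk is back at the crossing of `i` and `j`. The opposite dart there is on the other side
  -- of `i`, outside the triangle.
  have h3 : S.map.faceNext (S.map.faceNext (S.map.faceNext x)) = x := by
    rcases on_unique hxi hxi3 hi o5 hj o6 with h4 | h4
    · exact h4
    · exfalso
      have h5 := hx3.1.trans hx.1.symm
      rw [h4, (hi.rot_rot hxi).side_rot_self, hj.side_rot hij.symm.not_or] at h5
      exact not_iff_self h5
  have hw : ∀ y, S.map.walkRel x y →
      y = x ∨ y = S.map.faceNext x ∨ y = S.map.faceNext (S.map.faceNext x) := by
    intro y hy
    have := Equiv.Perm.SameCycle.apply_eq_of_invariant (f := S.map.faceNext)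
      (g := fun y => y = x ∨ y = S.map.faceNext x ∨ y = S.map.faceNext (S.map.faceNext x))
      (fun z => by
        have e1 : S.map.faceNext z = x ↔ z = S.map.faceNext (S.map.faceNext x) := by
          rw [← S.map.faceNext.apply_eq_iff_eq (x := z), h3]
        simp only [e1, S.map.faceNext.apply_eq_iff_eq, eq_iff_iff]
        tauto) hy
    exact this.mp (Or.inl rfl)
  have := S.finite
  have h4 := hS x fun y hy => by
    rcases hw y hy with rfl | rfl | rfl
    · exact hxi.not_isArc
    · exact hxi1.not_isArc
    · exact hxi2.not_isArc
  have h5 : {y | S.map.walkRel x y}.ncard ≤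
      ({x, S.map.faceNext x, S.map.faceNext (S.map.faceNext x)} : Set S.Dart).ncard :=
    Set.ncard_le_ncard (fun y hy => hw y hy) (Set.toFinite _)
  have h6 : ({x, S.map.faceNext x, S.map.faceNext (S.map.faceNext x)} : Set S.Dart).ncard ≤ 3 := by
    refine (Set.ncard_insert_le _ _).trans ?_
    refine Nat.succ_le_succ ((Set.ncard_insert_le _ _).trans ?_)
    rw [Set.ncard_singleton]
  omega

include h in
/-- Three strands that cross pairwise enclose an interior region with three sides. -/
theorem not_fourSides_of_cross {i j k : Fin (2 * n)} (hij : τ.Cross i j) (hjk : τ.Cross j k)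
    (hik : τ.Cross i k) : ¬ S.InteriorRegionsHaveFourSides := by
  classical
  -- The ends of the strands that cross a side of the triangle; the induction is on their number.
  let T : Fin (2 * n) → Fin (2 * n) → Fin (2 * n) → Finset (Fin (2 * n)) := fun i j k =>
    Finset.univ.filter fun m => h.Between i j k m ∨ h.Between j i k m ∨ h.Between k i j m
  suffices H : ∀ (N : ℕ) (i j k : Fin (2 * n)), τ.Cross i j → τ.Cross j k → τ.Cross i k →
      (T i j k).card = N → ¬ S.InteriorRegionsHaveFourSides from H _ i j k hij hjk hik rfl
  intro N
  induction N using Nat.strong_induction_on with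
  | _ N IH =>
    have descend : ∀ i j k m, τ.Cross i j → τ.Cross j k → τ.Cross i k → (T i j k).card = N →
        h.Between i j k m → h.Between j i k m → ¬ S.InteriorRegionsHaveFourSides := by
      intro i j k m hij hjk hik hN hb1 hb2
      -- A strand `m` across the sides on `i` and `j` cuts off the triangle of `i`, `j`, `m`. By
      -- `exists_other` a strand through its new side also crosses one of the shortened old sides,
      -- so it was counted before, while `m` is no longer counted.
      refine IH _ ?_ i j m hij hb2.1 hb1.1 rfl
      rw [← hN]
      refine Finset.card_lt_card (Finset.ssubset_iff_of_subset ?_ |>.2 ⟨m, ?_, ?_⟩)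
      · intro m' hm'
        simp only [T, Finset.mem_filter, Finset.mem_univ, true_and] at hm' ⊢
        have h1 : h.Between i j m m' ∨ h.Between j i m m' := by
          rcases hm' with h2 | h2 | h2
          · exact Or.inl h2
          · exact Or.inr h2
          · rcases h2.exists_other hb1.1.symm hij hb2.1.symm with h3 | h3
            · exact Or.inl h3.symm
            · exact Or.inr h3.symm
        have h3 := hb1.2
        have h4 := hb2.2
        rcases h1 with ⟨h5, h6⟩ | ⟨h5, h6⟩
        · exact Or.inl ⟨h5, by omega⟩
        · exact Or.inr (Or.inl ⟨h5, by omega⟩)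
      · simp only [T, Finset.mem_filter, Finset.mem_univ, true_and]
        exact Or.inl hb1
      · simp only [T, Finset.mem_filter, Finset.mem_univ, true_and]
        rintro (⟨-, h5⟩ | ⟨-, h5⟩ | ⟨h5, -⟩)
        · omega
        · omega
        · exact h5.1 rfl
    intro i j k hij hjk hik hN
    have symT1 : T j i k = T i j k := by
      ext m
      have e : h.Between k j i m ↔ h.Between k i j m := ⟨Between.symm, Between.symm⟩
      simp only [T, Finset.mem_filter, Finset.mem_univ, true_and, e]
      tauto
    have symT2 : T i k j = T i j k := by
      ext m
      have e : h.Between i k j m ↔ h.Between i j k m := ⟨Between.symm, Between.symm⟩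
      simp only [T, Finset.mem_filter, Finset.mem_univ, true_and, e]
      tauto
    have symT3 : T j k i = T i j k := by
      ext m
      have e1 : h.Between j k i m ↔ h.Between j i k m := ⟨Between.symm, Between.symm⟩
      have e2 : h.Between k j i m ↔ h.Between k i j m := ⟨Between.symm, Between.symm⟩
      simp only [T, Finset.mem_filter, Finset.mem_univ, true_and, e1, e2]
      tauto
    by_cases hbi : ∃ m, h.Between i j k m
    · obtain ⟨m, hm⟩ := hbi
      rcases hm.exists_other hij hjk hik with h1 | h1
      · exact descend i j k m hij hjk hik hN hm h1
      · exact descend i k j m hik hjk.symm hij (by rw [symT2]; exact hN) hm.symm h1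
    by_cases hbj : ∃ m, h.Between j i k m
    · obtain ⟨m, hm⟩ := hbj
      rcases hm.exists_other hij.symm hik hjk with h1 | h1
      · exact descend j i k m hij.symm hik hjk (by rw [symT1]; exact hN) hm h1
      · exact descend j k i m hjk hik.symm hij.symm (by rw [symT3]; exact hN) hm.symm h1
    by_cases hbk : ∃ m, h.Between k i j m
    · obtain ⟨m, hm⟩ := hbk
      rcases hm.exists_other hik.symm hij hjk.symm with h1 | h1
      · exact absurd ⟨m, h1.symm⟩ hbi
      · exact absurd ⟨m, h1.symm⟩ hbj
    push Not at hbi hbj hbk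
    -- No strand crosses the triangle any more. The four faces at the crossing of `i` and `j`
    -- realize all combinations of the sides of `i` and `j`, so one of them is the corner of the
    -- triangle.
    obtain ⟨y, hyi, hy, hyo⟩ := h.exists_cross hij
    have hy : h.On i y := Or.inl hy
    have hi1 := isInner_rot_iff.2 hyi
    have hi2 := isInner_rot_iff.2 hi1
    have hi3 := isInner_rot_iff.2 hi2
    have o2 := hy.rot_rot hyi
    have o3 := hyo.rot_rot hi1
    have o4 : h.On i (S.map.rot (S.map.rot (S.map.rot (S.map.rot y)))) := by rwa [rot_four hyi]
    have k0 : h.side k y ↔ h.crossSide k i j :=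
      (crossSide_iff hyi hy hyo hik.not_or hjk.not_or).symm
    have k1 := hyo.side_rot hjk.not_or
    have k2 := o2.side_rot hik.not_or
    have k3 := o3.side_rot hjk.not_or
    have j1 := hyo.side_rot_self
    have j2 := o2.side_rot hij.not_or
    have j3 := o3.side_rot_self
    have i1 := hyo.side_rot hij.symm.not_or
    have i2 := o2.side_rot_self
    have i3 := o3.side_rot hij.symm.not_or
    rw [k2, k1, k0] at k3
    rw [k1, k0] at k2
    rw [k0] at k1
    rw [j2, j1] at j3
    rw [j1] at j2
    rw [i2, i1] at i3
    rw [i1] at i2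
    have sym : ∀ {x}, h.InTriangle i j k x → h.InTriangle j i k x := fun {x} hx =>
      ⟨hx.2.1, hx.1, hx.2.2.trans (crossSide_comm hij hik.not_or hjk.not_or)⟩
    by_cases s1 : h.side i y ↔ h.crossSide i j k <;> by_cases s2 : h.side j y ↔ h.crossSide j i k
    · exact exists_small_face hij hjk hik hbi hbj hbk ⟨s1, s2, k0⟩ hyi hy hyo
    · exact exists_small_face hij.symm hik hjk hbj hbi (fun m hm => hbk m hm.symm)
        (sym ⟨i1.trans s1, j1.trans (not_iff.1 s2), k1⟩) hi1 hyo o2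
    · exact exists_small_face hij.symm hik hjk hbj hbi (fun m hm => hbk m hm.symm)
        (sym ⟨i3.trans (not_iff.1 s1), (j3.trans not_not).trans s2, k3⟩) hi3 o3 o4
    · exact exists_small_face hij hjk hik hbi hbj hbk
        ⟨i2.trans (not_iff.1 s1), j2.trans (not_iff.1 s2), k2⟩ hi2 o2 o3

end StrandDiagram.IsDiagramOf

/-! ### Uniqueness of the diagram of a 3-noncrossing matching. -/

namespace DiskDrawing

open BoundedMap

variable {n : ℕ} {S : DiskDrawing n}

theorem Ahead.exists_of_le {y : S.Dart} {a : Fin (2 * n)} {k l : ℕ} (hy : S.Ahead y a k)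
    (hl : l ≤ k) : ∃ z, S.Ahead z a l ∧ ((z = y ∧ l = k) ∨ S.IsInner z) := by
  induction hy with
  | @finish x a h1 =>
    obtain rfl : l = 0 := by omega
    exact ⟨x, .finish h1, Or.inl ⟨rfl, rfl⟩⟩
  | @step x a m h1 h2 ih =>
    rcases hl.eq_or_lt with rfl | hl
    · exact ⟨x, .step h1 h2, Or.inl ⟨rfl, rfl⟩⟩
    · obtain ⟨z, hz, ⟨rfl, -⟩ | hi⟩ := ih (by omega)
      · exact ⟨_, hz, Or.inr (isInner_rot_iff.2 (isInner_rot_iff.2 h1))⟩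
      · exact ⟨z, hz, Or.inr hi⟩

end DiskDrawing

namespace StrandDiagram

open BoundedMap DiskDrawing

variable {n : ℕ} {S T : StrandDiagram n} {τ : PointMatching n}

namespace IsDiagramOf

variable {h : S.IsDiagramOf τ} {h' : T.IsDiagramOf τ}

theorem pos_injOn {a b c : Fin (2 * n)} (hb : τ.Cr a b) (hc : τ.Cr a c)
    (hp : h.pos a b = h.pos a c) : b = c := by
  by_contra hne
  refine pos_ne hb.cross hc.cross ?_ hp
  rintro (rfl | rfl)
  · exact hne rfl
  · exact hc.not_partner hb

open scoped Classical in
-- The crossings ahead of the dart have the positions `0, …, m - 1`, each exactly once.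
theorem ahead_eq_card {x : S.Dart} {a : Fin (2 * n)} {m : ℕ} (hx : S.Ahead x a m) :
    (Finset.univ.filter fun b => τ.Cr a b ∧ h.pos a b < m).card = m := by
  have : (Finset.univ.filter fun b => τ.Cr a b ∧ h.pos a b < m).image (h.pos a) =
      Finset.range m := by
    ext k
    simp only [Finset.mem_image, Finset.mem_filter, Finset.mem_univ, true_and, Finset.mem_range]
    constructor
    · rintro ⟨b, ⟨-, hb⟩, rfl⟩
      exact hb
    · intro hk
      obtain ⟨z, hz, ⟨-, e⟩ | hi⟩ := hx.exists_of_le hk.le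
      · omega
      obtain ⟨b, hb⟩ := h.exists_toward (isInner_rot_iff.2 hi).not_isArc
      have : h.pos a b = k := pos_eq hz hi (Or.inl hb)
      exact ⟨b, ⟨h.cr_of_isInner hi ⟨_, hz⟩ hb, by omega⟩, this⟩
  conv_rhs => rw [← Finset.card_range m, ← this]
  refine (Finset.card_image_of_injOn fun b hb c hc hbc => ?_).symm
  simp only [Finset.coe_filter, Finset.mem_univ, true_and, Set.mem_ofPred_eq] at hb hc
  exact pos_injOn hb.1 hc.1 hbc

/-- The chords of `b` and `c` both cross that of `a`, so they do not cross each other. The strand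
towards `b` therefore stays on one side of `c`, and the side of its crossing with `a` can be read
off at `b`. -/
theorem pos_lt_iff (hτ : τ.IsNoncrossing 3) {a b c : Fin (2 * n)} (hb : τ.Cr a b)
    (hc : τ.Cr a c) : h.pos a b < h.pos a c ↔ b ≠ c ∧ (τ.Under c b ↔ τ.Under c a) := by
  by_cases hbc : b = c
  · simp [hbc]
  have hne : ¬ (b = c ∨ b = τ.partner c) := by
    rintro (rfl | rfl)
    · exact hbc rfl
    · exact hc.not_partner hb
  have hnc : ¬ τ.Cross b c := fun hbc' =>
    PointMatching.not_isNoncrossing_three_iff.2 ⟨a, b, c, hb.cross, hbc', hc.cross⟩ hτ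
  obtain ⟨y, hi, hya, hyb⟩ := h.exists_isInner hb
  obtain ⟨m, hm⟩ := hyb
  have h1 := (h.side_iff_of_ahead hm hne).2 (by
    rintro ⟨z, k, d, -, hz, hzi, hd, hdc⟩
    exact hnc (On.cross (h := h) hzi (Or.inl ⟨_, hz⟩) (on_of_toward hd hdc)))
  have hac := hc.cross.not_or
  rw [← crossSide_iff_pos hb.cross hc.cross hne,
    crossSide_iff hi (Or.inl hya) (Or.inl ⟨m, hm⟩) hac hne, ← h1,
    On.side_rot (h := h) (Or.inl ⟨m, hm⟩) hne]
  simp [hbc]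

/-- A position is the number of smaller positions, and by `pos_lt_iff` the order of the positions
depends on the matching only. -/
theorem pos_eq_pos (hτ : τ.IsNoncrossing 3) {a b : Fin (2 * n)} (hb : τ.Cr a b) :
    h.pos a b = h'.pos a b := by
  classical
  obtain ⟨y, hy, -⟩ := h.exists_pos hb.cross
  obtain ⟨z, hz, -⟩ := h'.exists_pos hb.cross
  rw [← ahead_eq_card (h := h) hy, ← ahead_eq_card (h := h') hz]
  congr 1
  refine Finset.filter_congr fun c _ => and_congr_right fun hc => ?_
  rw [pos_lt_iff hτ hc hb, pos_lt_iff hτ hc hb]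

open scoped Classical in
include h in
theorem ahead_strandStart_eq_card {a : Fin (2 * n)} {m : ℕ}
    (hx : S.Ahead (S.strandStart (τ.partner a)) a m) :
    (Finset.univ.filter fun b => τ.Cr a b).card = m := by
  rw [← ahead_eq_card (h := h) hx]
  congr 1
  refine Finset.filter_congr fun b _ => ⟨fun hb => ⟨hb, ?_⟩, fun hb => hb.1⟩
  by_contra hlt
  obtain ⟨y, hy, hyi, -⟩ := h.exists_pos hb.cross
  obtain ⟨z, hz, hz'⟩ := hy.exists_of_le (not_lt.1 hlt)
  have := hz.injective hx
  rw [this] at hz'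
  apply S.not_isInner_strandStart (τ.partner a)
  rcases hz' with ⟨e, -⟩ | hi
  · rwa [e]
  · exact hi

end IsDiagramOf

/-- Darts of two diagrams that play the same role with respect to the boundary points. -/
inductive Corr (S T : StrandDiagram n) : S.Dart → T.Dart → Prop
  | arc (j : Fin (2 * n)) : Corr S T (S.arc j) (T.arc j)
  | flipArc (j : Fin (2 * n)) : Corr S T (S.map.flip (S.arc j)) (T.map.flip (T.arc j))
  | start (j : Fin (2 * n)) : Corr S T (S.strandStart j) (T.strandStart j)
  | inner {x : S.Dart} {y : T.Dart} {a b : Fin (2 * n)} : S.IsInner x → T.IsInner y →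
      S.Toward x a → T.Toward y a → S.Toward (S.map.rot x) b → T.Toward (T.map.rot y) b →
      Corr S T x y

theorem Corr.symm {x : S.Dart} {y : T.Dart} (hxy : Corr S T x y) : Corr T S y x := by
  cases hxy with
  | arc j => exact .arc j
  | flipArc j => exact .flipArc j
  | start j => exact .start j
  | inner h1 h2 h3 h4 h5 h6 => exact .inner h2 h1 h4 h3 h6 h5

theorem Corr.exists (h : S.IsDiagramOf τ) (h' : T.IsDiagramOf τ) (x : S.Dart) :
    ∃ y, Corr S T x y := by
  by_cases hx : S.IsArc x
  · obtain ⟨j, rfl | rfl⟩ := hx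
    · exact ⟨_, .arc j⟩
    · exact ⟨_, .flipArc j⟩
  by_cases hi : S.IsInner x
  · obtain ⟨a, ha⟩ := h.exists_toward hx
    obtain ⟨b, hb⟩ := h.exists_toward (isInner_rot_iff.2 hi).not_isArc
    obtain ⟨y, hy, hya, hyb⟩ := h'.exists_isInner (h.cr_of_isInner hi ha hb)
    exact ⟨y, .inner hi hy ha hya hb hyb⟩
  · obtain ⟨j, rfl⟩ := S.exists_eq_strandStart hx hi
    exact ⟨_, .start j⟩

theorem Corr.unique (h' : T.IsDiagramOf τ) {x : S.Dart} {y z : T.Dart}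
    (hy : Corr S T x y) (hz : Corr S T x z) : y = z := by
  have hsa : ∀ i j, S.arc i ≠ S.strandStart j := fun i j e =>
    S.not_isArc_strandStart j (e ▸ isArc_arc i)
  have hsf : ∀ i j, S.map.flip (S.arc i) ≠ S.strandStart j := fun i j e =>
    S.not_isArc_strandStart j (e ▸ isArc_flip_arc i)
  have key : ∀ (x' : S.Dart) (z : T.Dart), Corr S T x' z → x' = x → y = z := by
    intro x' z hz e
    cases hz with
    | arc j =>
      cases hy with
      | arc i => rw [S.arc_injective e]
      | flipArc i => exact absurd e.symm (S.flip_arc_ne _ _)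
      | start i => exact absurd e (hsa _ _)
      | inner h1 => rw [← e] at h1; exact absurd h1 (not_isInner_arc j)
    | flipArc j =>
      cases hy with
      | arc i => exact absurd e (S.flip_arc_ne _ _)
      | flipArc i => rw [S.arc_injective (S.map.flip.injective e)]
      | start i => exact absurd e (hsf _ _)
      | inner h1 => rw [← e] at h1; exact absurd (isArc_flip_arc j) h1.not_isArc
    | start j =>
      cases hy with
      | arc i => exact absurd e.symm (hsa _ _)
      | flipArc i => exact absurd e.symm (hsf _ _)
      | start i => rw [S.strandStart_injective e]
      | inner h1 => rw [← e] at h1; exact absurd h1 (S.not_isInner_strandStart j)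
    | inner h1 h2 h3 h4 h5 h6 =>
      subst e
      cases hy with
      | arc i => exact absurd h1 (not_isInner_arc i)
      | flipArc i => exact absurd (isArc_flip_arc i) h1.not_isArc
      | start i => exact absurd h1 (S.not_isInner_strandStart i)
      | inner g1 g2 g3 g4 g5 g6 =>
        rw [g3.unique h3] at g4
        rw [g5.unique h5] at g6
        exact h'.isInner_unique g2 g4 g6 h2 h4 h6
  exact key x z hz rfl

theorem Corr.rot (h : S.IsDiagramOf τ) (h' : T.IsDiagramOf τ) {x : S.Dart} {y : T.Dart}
    (hxy : Corr S T x y) : Corr S T (S.map.rot x) (T.map.rot y) := by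
  cases hxy with
  | arc j => rw [S.rot_arc, T.rot_arc]; exact .flipArc _
  | flipArc j => rw [rot_flip_arc, rot_flip_arc]; exact .start _
  | start j => rw [rot_strandStart, rot_strandStart]; exact .arc _
  | inner h1 h2 h3 h4 h5 h6 =>
    exact .inner (isInner_rot_iff.2 h1) (isInner_rot_iff.2 h2) h5 h6
      (h.toward_rot_rot h3 h1) (h'.toward_rot_rot h4 h2)

/-- The correspondence is defined by the ends of strands and says nothing about neighbouring
crossings. Equal numbers of crossings ahead identify darts by `Ahead.injective`, and so make it
compatible with `flip`; here the assumption on `τ` is used. -/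
theorem Corr.ahead (h : S.IsDiagramOf τ) (h' : T.IsDiagramOf τ) (hτ : τ.IsNoncrossing 3)
    {x : S.Dart} {y : T.Dart} (hxy : Corr S T x y) {a : Fin (2 * n)} {m : ℕ}
    (hx : S.Ahead x a m) : T.Ahead y a m := by
  classical
  cases hxy with
  | arc j => exact absurd (isArc_arc j) hx.not_isArc
  | flipArc j => exact absurd (isArc_flip_arc j) hx.not_isArc
  | start j =>
    obtain rfl : τ.partner j = a := (h.toward_strandStart j).unique ⟨m, hx⟩
    obtain ⟨k, hk⟩ := h'.toward_strandStart j
    have e1 := IsDiagramOf.ahead_strandStart_eq_card (h := h) (a := τ.partner j) (m := m)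
      (by rwa [τ.partner_partner])
    have e2 := IsDiagramOf.ahead_strandStart_eq_card (h := h') (a := τ.partner j) (m := k)
      (by rwa [τ.partner_partner])
    rw [← e1, e2]
    exact hk
  | @inner _ _ c b h1 h2 h3 h4 h5 h6 =>
    obtain rfl := h3.unique ⟨m, hx⟩
    obtain ⟨k, hk⟩ := h4
    have e1 : h.pos c b = m := IsDiagramOf.pos_eq hx h1 (Or.inl h5)
    have e2 : h'.pos c b = k := IsDiagramOf.pos_eq hk h2 (Or.inl h6)
    rw [← e1, IsDiagramOf.pos_eq_pos (h' := h') hτ (h.cr_of_isInner h1 h3 h5), e2]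
    exact hk

theorem Corr.flip (h : S.IsDiagramOf τ) (h' : T.IsDiagramOf τ) (hτ : τ.IsNoncrossing 3)
    {x : S.Dart} {y : T.Dart} (hxy : Corr S T x y) :
    Corr S T (S.map.flip x) (T.map.flip y) := by
  by_cases hx : S.IsArc x
  · cases hxy with
    | arc j => exact .flipArc j
    | flipArc j => rw [S.map.flip_flip, T.map.flip_flip]; exact .arc j
    | start j => exact absurd hx (S.not_isArc_strandStart j)
    | inner h1 => exact absurd hx h1.not_isArc
  · obtain ⟨a, m, hm⟩ := h.exists_toward hx
    have hk := hxy.ahead h h' hτ hm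
    cases hm with
    | finish e =>
      cases hk with
      | finish e' => rw [e, e']; exact .start a
    | @step _ _ m h1 h2 =>
      cases hk with
      | step h3 h4 =>
        obtain ⟨z, hz⟩ := Corr.exists h h' (S.map.rot (S.map.rot (S.map.flip x)))
        have e := (hz.ahead h h' hτ h2).injective h4
        have := (hz.rot h h').rot h h'
        rwa [rot_four h1, e, rot_four h3] at this

theorem IsDiagramOf.nonempty_iso (h : S.IsDiagramOf τ) (h' : T.IsDiagramOf τ)
    (hτ : τ.IsNoncrossing 3) : Nonempty (S.Iso T) := by
  choose f hf using fun x => Corr.exists h h' x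
  choose g hg using fun y => Corr.exists h' h y
  exact ⟨{
    toEquiv := ⟨f, g, fun x => Corr.unique h (hg (f x)) (hf x).symm,
      fun y => Corr.unique h' (hf (g y)) (hg y).symm⟩
    map_rot := fun x => Corr.unique h' (hf _) ((hf x).rot h h')
    map_flip := fun x => Corr.unique h' (hf _) ((hf x).flip h h' hτ)
    map_arc := fun j => Corr.unique h' (hf _) (.arc j) }⟩

end StrandDiagram

/-! ### Vertex degrees and a face count that implies planarity. -/

theorem Equiv.Perm.setOf_sameCycle_three {α : Type*} {f : Equiv.Perm α} {x : α}
    (h : f (f (f x)) = x) : {y | f.SameCycle x y} = {x, f x, f (f x)} := by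
  ext y
  simp only [Set.mem_ofPred_eq, Set.mem_insert_iff, Set.mem_singleton_iff]
  constructor
  · intro hy
    have := Equiv.Perm.SameCycle.apply_eq_of_invariant (f := f)
      (g := fun y => y = x ∨ y = f x ∨ y = f (f x)) (fun z => by
        have e1 : f z = x ↔ z = f (f x) := by rw [← f.apply_eq_iff_eq (x := z), h]
        simp only [e1, f.apply_eq_iff_eq, eq_iff_iff]
        tauto) hy
    exact this.mp (Or.inl rfl)
  · rintro (rfl | rfl | rfl)
    · exact Equiv.Perm.SameCycle.refl _ _
    · exact ⟨1, rfl⟩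
    · exact ⟨2, rfl⟩

theorem Equiv.Perm.setOf_sameCycle_four {α : Type*} {f : Equiv.Perm α} {x : α}
    (h : f (f (f (f x))) = x) : {y | f.SameCycle x y} = {x, f x, f (f x), f (f (f x))} := by
  ext y
  simp only [Set.mem_ofPred_eq, Set.mem_insert_iff, Set.mem_singleton_iff]
  constructor
  · intro hy
    have := Equiv.Perm.SameCycle.apply_eq_of_invariant (f := f)
      (g := fun y => y = x ∨ y = f x ∨ y = f (f x) ∨ y = f (f (f x))) (fun z => by
        have e1 : f z = x ↔ z = f (f (f x)) := by rw [← f.apply_eq_iff_eq (x := z), h]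
        simp only [e1, f.apply_eq_iff_eq, eq_iff_iff]
        tauto) hy
    exact this.mp (Or.inl rfl)
  · rintro (rfl | rfl | rfl | rfl)
    · exact Equiv.Perm.SameCycle.refl _ _
    · exact ⟨1, rfl⟩
    · exact ⟨2, rfl⟩
    · exact ⟨3, rfl⟩

theorem Equiv.Perm.ncard_sameCycle_three {α : Type*} {f : Equiv.Perm α} {x : α}
    (h : f (f (f x)) = x) (h1 : f x ≠ x) : {y | f.SameCycle x y}.ncard = 3 := by
  rw [Equiv.Perm.setOf_sameCycle_three h, Set.ncard_eq_three]
  refine ⟨x, f x, f (f x), h1.symm, fun h2 => h1 ?_, fun h2 => h1 (f.injective h2).symm, rfl⟩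
  rw [← h2] at h; exact h

theorem Equiv.Perm.ncard_sameCycle_four {α : Type*} {f : Equiv.Perm α} {x : α}
    (h : f (f (f (f x))) = x) (h2 : f (f x) ≠ x) : {y | f.SameCycle x y}.ncard = 4 := by
  have h1 : f x ≠ x := fun h1 => h2 (by rw [h1, h1])
  have h3 : f (f (f x)) ≠ x := fun h3 => h1 (by rwa [h3] at h)
  rw [Equiv.Perm.setOf_sameCycle_four h, Set.ncard_insert_of_notMem, Set.ncard_eq_three.2]
  · refine ⟨_, _, _, ?_, ?_, ?_, rfl⟩
    · exact fun e => h1 (f.injective e).symm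
    · exact fun e => h2 (f.injective e).symm
    · exact fun e => h1 (f.injective (f.injective e)).symm
  · simp only [Set.mem_insert_iff, Set.mem_singleton_iff, not_or]
    exact ⟨h1.symm, h2.symm, h3.symm⟩

namespace DartMap

variable {D : Type} [Finite D] {M : DartMap D}

theorem card_eq_two_mul_card_edge (M : DartMap D) :
    Nat.card D = 2 * Nat.card (Quotient M.edgeRel) := by
  classical
  have := Fintype.ofFinite D
  rw [Nat.card_eq_fintype_card, Nat.card_eq_fintype_card, ← Finset.card_univ,
    Finset.card_eq_sum_card_fiberwise (f := Quotient.mk M.edgeRel) (t := Finset.univ) (by simp)]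
  rw [Finset.sum_const_nat (m := 2), Finset.card_univ, mul_comm]
  intro q _
  induction q using Quotient.inductionOn with
  | h d =>
    have : Finset.univ.filter (fun x => Quotient.mk M.edgeRel x = Quotient.mk _ d) =
        {d, M.flip d} := by
      ext x
      simp only [Finset.mem_filter, Finset.mem_univ, true_and, Finset.mem_insert,
        Finset.mem_singleton]
      rw [eq_comm, Quotient.eq]
      exact M.edgeRel_iff
    rw [this, Finset.card_pair (M.flip_ne d).symm]

/-- One extra dart at each boundary vertex would make every degree four. -/
theorem four_mul_card_vertex {m : ℕ} (arc : Fin m → D)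
    (hi : ∀ i j, M.vertexRel (arc i) (arc j) → i = j)
    (h3 : ∀ i, {x | M.vertexRel (arc i) x}.ncard = 3)
    (h4 : ∀ d, (∀ i, ¬ M.vertexRel (arc i) d) → {x | M.vertexRel d x}.ncard = 4) :
    4 * Nat.card (Quotient M.vertexRel) = m + Nat.card D := by
  classical
  have := Fintype.ofFinite D
  have hc : ∀ d, (Finset.univ.filter fun x => Quotient.mk M.vertexRel x = Quotient.mk _ d).card =
      {x | M.vertexRel d x}.ncard := fun d => by
    rw [← Set.ncard_coe_finset]
    congr 1
    ext x
    simp only [Finset.coe_filter, Finset.mem_univ, true_and, Set.mem_ofPred_eq]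
    rw [eq_comm, Quotient.eq]
  have hf : ∀ q : Quotient M.vertexRel, (Finset.univ.filter fun x => Quotient.mk M.vertexRel x = q).card +
      (if q ∈ Finset.univ.image (fun i => Quotient.mk M.vertexRel (arc i)) then 1 else 0) = 4 := by
    intro q
    induction q using Quotient.inductionOn with
    | h d =>
      rw [hc]
      split_ifs with h
      · simp only [Finset.mem_image, Finset.mem_univ, true_and] at h
        obtain ⟨i, hi⟩ := h
        have : M.vertexRel (arc i) d := Quotient.exact hi
        have e : {x | M.vertexRel d x} = {x | M.vertexRel (arc i) x} := by
          ext x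
          exact ⟨M.vertexRel.trans' this, M.vertexRel.trans' (M.vertexRel.symm' this)⟩
        rw [e, h3]
      · refine h4 d fun i hi => h ?_
        simp only [Finset.mem_image, Finset.mem_univ, true_and]
        exact ⟨i, Quotient.sound hi⟩
  have h5 := Finset.sum_congr rfl fun q (_ : q ∈ (Finset.univ : Finset (Quotient M.vertexRel))) => hf q
  rw [Finset.sum_add_distrib, ← Finset.card_eq_sum_card_fiberwise (by simp), Finset.sum_const,
    Finset.sum_boole, Finset.filter_mem_eq_inter, Finset.univ_inter,
    Finset.card_image_of_injective _ (fun i j hij => hi i j (Quotient.exact hij)),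
    Finset.card_univ, Finset.card_univ, Finset.card_univ, Fintype.card_fin] at h5
  rw [Nat.card_eq_fintype_card, Nat.card_eq_fintype_card]
  simp only [smul_eq_mul, Nat.cast_id] at h5
  omega

/-- A connected map with the vertex degrees of a drawing by arcs is planar if it has enough
faces. -/
theorem isPlanar_of_degrees {m : ℕ} (arc : Fin m → D) (hc : ∀ x y, M.componentRel x y)
    (hi : ∀ i j, M.vertexRel (arc i) (arc j) → i = j)
    (h3 : ∀ i, {x | M.vertexRel (arc i) x}.ncard = 3)
    (h4 : ∀ d, (∀ i, ¬ M.vertexRel (arc i) d) → {x | M.vertexRel d x}.ncard = 4)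
    (hw : Nat.card D + 8 ≤ 4 * Nat.card (Quotient M.walkRel) + m) : M.IsPlanar := by
  have := Fintype.ofFinite D
  refine isPlanar_of_connected hc ?_
  -- As `4 V = m + D` and `D = 2 E`, the hypothesis `hw` is the inequality `E + 2 ≤ V + F`.
  have h5 := four_mul_card_vertex arc hi h3 h4
  have h6 := M.card_eq_two_mul_card_edge
  omega

end DartMap

/-! ### The grid diagram: every matching has a strand diagram. -/

namespace PointMatching

variable {n : ℕ} (τ : PointMatching n)

/-- On a grid diagram a chord goes up from its left endpoint and then to the right: it meets the
chords that end under it first, and then the chords that start under it. -/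
def key (e : Fin (2 * n)) : ℤ := if e < τ.partner e then e.val + 2 * n else e.val

/-- The order in which the strand to `a` meets the strands to the points on its left. -/
def rank (a e : Fin (2 * n)) : ℤ :=
  -- A strand that runs to its left end is traversed backwards, which reverses the order; the points
  -- on the left of the reversed strand are the partners.
  if τ.partner a < a then τ.key e else -τ.key (τ.partner e)

/-- On the strand to `a`, the crossing with the strand to `e` comes after the one with `b`; the
strand starts at `b = τ a`. -/
def After (a b e : Fin (2 * n)) : Prop := b = τ.partner a ∨ τ.rank a b < τ.rank a e

/-- On the strand to `a`, the crossing with the strand to `e` comes right after the one with `b`;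
the end of the strand is written `e = τ a`. -/
def Next (a b e : Fin (2 * n)) : Prop :=
  (τ.Cr a e ∧ τ.After a b e ∧ ∀ f, τ.Cr a f → τ.After a b f → τ.rank a e ≤ τ.rank a f) ∨
    (e = τ.partner a ∧ ∀ f, τ.Cr a f → ¬ τ.After a b f)

variable {τ}

theorem key_injective : Function.Injective τ.key := fun a b h => by
  have h1 := a.isLt
  have h2 := b.isLt
  simp only [key] at h
  ext
  split_ifs at h <;> omega

theorem rank_injective (a : Fin (2 * n)) : Function.Injective (τ.rank a) := fun b c h => by
  simp only [rank] at h
  split_ifs at h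
  · exact key_injective h
  · exact partner_injective (key_injective (neg_injective h))

theorem rank_partner (a e : Fin (2 * n)) :
    τ.rank (τ.partner a) (τ.partner e) = -τ.rank a e := by
  have := τ.partner_ne a
  simp only [rank, τ.partner_partner]
  by_cases h : τ.partner a < a
  · rw [if_neg h.not_gt, if_pos h]
  · rw [if_neg h, if_pos (lt_of_le_of_ne (not_lt.1 h) this.symm), neg_neg]

theorem cr_partner_iff {a b : Fin (2 * n)} :
    τ.Cr (τ.partner a) (τ.partner b) ↔ τ.Cr a b :=
  ⟨fun h => by simpa [τ.partner_partner] using h.rot.rot, fun h => h.rot.rot⟩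

theorem Cr.ne_partner {a b : Fin (2 * n)} (h : τ.Cr a b) : b ≠ τ.partner a := h.2.1

theorem exists_next (a b : Fin (2 * n)) : ∃ e, τ.Next a b e := by
  classical
  by_cases h : (Finset.univ.filter fun f => τ.Cr a f ∧ τ.After a b f).Nonempty
  · obtain ⟨e, he, hm⟩ := Finset.exists_min_image _ (τ.rank a) h
    simp only [Finset.mem_filter, Finset.mem_univ, true_and] at he hm
    exact ⟨e, Or.inl ⟨he.1, he.2, fun f h1 h2 => hm f ⟨h1, h2⟩⟩⟩
  · refine ⟨τ.partner a, Or.inr ⟨rfl, fun f h1 h2 => h ⟨f, ?_⟩⟩⟩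
    simp [h1, h2]

theorem Next.unique {a b e e' : Fin (2 * n)} (h : τ.Next a b e) (h' : τ.Next a b e') :
    e = e' := by
  rcases h with ⟨h1, h2, h3⟩ | ⟨h1, h2⟩ <;> rcases h' with ⟨g1, g2, g3⟩ | ⟨g1, g2⟩
  · exact rank_injective a (le_antisymm (h3 _ g1 g2) (g3 _ h1 h2))
  · exact absurd h2 (g2 _ h1)
  · exact absurd g2 (h2 _ g1)
  · rw [h1, g1]

/-- Reversal negates ranks, so it turns the next crossing into the previous one. The ends of the
strand, written as `partner a` in either role, exchange as well. This makes the reversal of darts an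
involution. -/
theorem Next.reverse {a b e : Fin (2 * n)} (hb : b = τ.partner a ∨ τ.Cr a b)
    (h : τ.Next a b e) : τ.Next (τ.partner a) (τ.partner e) (τ.partner b) := by
  have hr : ∀ c f, τ.rank (τ.partner a) (τ.partner c) < τ.rank (τ.partner a) f ↔
      τ.rank a (τ.partner f) < τ.rank a c := fun c f => by
    rw [← τ.partner_partner f, rank_partner, rank_partner, τ.partner_partner, neg_lt_neg_iff]
  have hc : ∀ f, τ.Cr (τ.partner a) f ↔ τ.Cr a (τ.partner f) := fun f => by
    rw [← cr_partner_iff, τ.partner_partner]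
  have hle : ∀ c f, τ.rank (τ.partner a) (τ.partner c) ≤ τ.rank (τ.partner a) f ↔
      τ.rank a (τ.partner f) ≤ τ.rank a c := fun c f => by
    rw [← τ.partner_partner f, rank_partner, rank_partner, τ.partner_partner, neg_le_neg_iff]
  simp only [Next, After, τ.partner_partner, hr, hc, hle] at h ⊢
  rcases h with ⟨h1, h2, h3⟩ | ⟨rfl, h2⟩
  · have hea : τ.partner e ≠ a := fun h => h1.2.1 (partner_eq_iff.1 h)
    rcases hb with rfl | hb
    · right
      refine ⟨τ.partner_partner a, fun f hf => ?_⟩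
      have := h3 _ hf (Or.inl rfl)
      simp only [hea, false_or]
      omega
    · left
      have hba := hb.ne_partner
      refine ⟨hb, Or.inr (h2.resolve_left hba), fun f hf hlt => ?_⟩
      have h4 := hlt.resolve_left hea
      by_contra h5
      have := h3 _ hf (Or.inr (not_le.1 h5))
      omega
  · rw [τ.partner_partner]
    rcases hb with rfl | hb
    · right
      exact ⟨τ.partner_partner a, fun f hf _ => h2 _ hf (Or.inl rfl)⟩
    · left
      refine ⟨hb, Or.inl rfl, fun f hf _ => ?_⟩
      by_contra h5
      exact h2 _ hf (Or.inr (not_le.1 h5))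

variable (τ)

/-- The darts on the strands of the grid diagram: `(a, b)` runs to the boundary point `a` from the
crossing with the strand to the point `b` on its left, or from the boundary if `b = τ a`. -/
abbrev GridDart : Type := {p : Fin (2 * n) × Fin (2 * n) // p.2 = τ.partner p.1 ∨ τ.Cr p.1 p.2}

variable {τ}

namespace GridDart

/-- The next crossing on the strand, or `τ a` at its end. -/
noncomputable def next (x : τ.GridDart) : Fin (2 * n) :=
  (exists_next (τ := τ) x.1.1 x.1.2).choose

theorem next_spec (x : τ.GridDart) : τ.Next x.1.1 x.1.2 x.next :=
  (exists_next (τ := τ) x.1.1 x.1.2).choose_spec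

/-- The reversed dart. -/
noncomputable def flip (x : τ.GridDart) : τ.GridDart :=
  ⟨(τ.partner x.1.1, τ.partner x.next), by
    rcases x.next_spec with ⟨h, -⟩ | ⟨h, -⟩
    · exact Or.inr h.rot.rot
    · left
      rw [h]⟩

theorem flip_flip (x : τ.GridDart) : x.flip.flip = x := by
  have h1 := x.next_spec.reverse x.2
  have h2 := x.flip.next_spec.unique h1
  apply Subtype.ext
  apply Prod.ext
  · exact τ.partner_partner _
  · change τ.partner x.flip.next = _
    rw [h2, τ.partner_partner]

/-- The dart of the strand that starts at the boundary point `j`. -/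
def start (τ : PointMatching n) (j : Fin (2 * n)) : τ.GridDart :=
  ⟨(τ.partner j, j), Or.inl (τ.partner_partner j).symm⟩

/-- The next dart around a crossing. -/
def rot (x : τ.GridDart) (h : τ.Cr x.1.1 x.1.2) : τ.GridDart :=
  ⟨(x.1.2, τ.partner x.1.1), Or.inr h.rot⟩

/-- Induction towards the end of the strand, on the number of crossings ahead. -/
theorem induction {P : τ.GridDart → Prop}
    (last : ∀ x : τ.GridDart, x.next = τ.partner x.1.1 → P x)
    (step : ∀ x : τ.GridDart, ∀ h : τ.Cr x.1.1 x.next, P ⟨(x.1.1, x.next), Or.inr h⟩ → P x)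
    (x : τ.GridDart) : P x := by
  classical
  generalize hN : (Finset.univ.filter fun f => τ.Cr x.1.1 f ∧ τ.After x.1.1 x.1.2 f).card = N
  induction N using Nat.strong_induction_on generalizing x with
  | _ N IH =>
    rcases x.next_spec with ⟨h1, h2, h3⟩ | ⟨h1, -⟩
    · refine step x h1 (IH _ ?_ _ rfl)
      rw [← hN]
      refine Finset.card_lt_card (Finset.ssubset_iff_of_subset ?_ |>.2 ⟨x.next, ?_, ?_⟩)
      · intro f hf
        simp only [Finset.mem_filter, Finset.mem_univ, true_and] at hf ⊢
        refine ⟨hf.1, ?_⟩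
        rcases hf.2 with h4 | h4
        · exact absurd h4 h1.ne_partner
        · exact h2.imp id fun h5 => h5.trans h4
      · simp [h1, h2]
      · simp only [Finset.mem_filter, Finset.mem_univ, true_and, not_and]
        rintro - (h4 | h4)
        · exact h1.ne_partner h4
        · exact lt_irrefl _ h4
    · exact last x h1

end GridDart

variable (τ) in
/-- The rotation system of the grid diagram. `Sum.inl (j, true)` is the `j`-th boundary arc. -/
noncomputable def gridRot : (Fin (2 * n) × Bool) ⊕ τ.GridDart → (Fin (2 * n) × Bool) ⊕ τ.GridDart
  | Sum.inl (j, true) => Sum.inl ((finRotate _).symm j, false)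
  | Sum.inl (j, false) => Sum.inr (GridDart.start τ (finRotate _ j))
  | Sum.inr x => open scoped Classical in
    if h : τ.Cr x.1.1 x.1.2 then Sum.inr (x.rot h) else Sum.inl (x.1.2, true)

theorem GridDart.eq_start {x : τ.GridDart} (h : ¬ τ.Cr x.1.1 x.1.2) :
    x = GridDart.start τ x.1.2 := by
  have h1 := x.2.resolve_right h
  apply Subtype.ext
  apply Prod.ext
  · change _ = τ.partner x.1.2
    rw [h1, τ.partner_partner]
  · rfl

theorem not_cr_start (j : Fin (2 * n)) : ¬ τ.Cr (GridDart.start τ j).1.1 (GridDart.start τ j).1.2 :=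
  fun h => h.ne_partner (τ.partner_partner j).symm

theorem gridRot_of_cr {x : τ.GridDart} (h : τ.Cr x.1.1 x.1.2) :
    τ.gridRot (Sum.inr x) = Sum.inr (x.rot h) := dif_pos h

theorem gridRot_start (j : Fin (2 * n)) :
    τ.gridRot (Sum.inr (GridDart.start τ j)) = Sum.inl (j, true) := dif_neg (not_cr_start j)

theorem gridRot_injective : Function.Injective τ.gridRot := by
  have h1 : ∀ (x : τ.GridDart) j, τ.gridRot (Sum.inr x) = Sum.inl (j, true) →
      x = GridDart.start τ j := fun x j h => by
    by_cases hx : τ.Cr x.1.1 x.1.2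
    · rw [gridRot_of_cr hx] at h; cases h
    · rw [GridDart.eq_start hx, gridRot_start] at h
      rw [GridDart.eq_start hx]
      cases h; rfl
  have h2 : ∀ (x : τ.GridDart) j, τ.gridRot (Sum.inr x) ≠ Sum.inl (j, false) := fun x j h => by
    by_cases hx : τ.Cr x.1.1 x.1.2
    · rw [gridRot_of_cr hx] at h; cases h
    · rw [GridDart.eq_start hx, gridRot_start] at h
      cases h
  have h3 : ∀ (x y : τ.GridDart), τ.gridRot (Sum.inr x) = Sum.inr y →
      ∃ h : τ.Cr x.1.1 x.1.2, y = x.rot h := fun x y h => by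
    by_cases hx : τ.Cr x.1.1 x.1.2
    · rw [gridRot_of_cr hx] at h; cases h; exact ⟨hx, rfl⟩
    · rw [GridDart.eq_start hx, gridRot_start] at h
      cases h
  rintro (⟨i, _ | _⟩ | x) (⟨j, _ | _⟩ | y) hxy
  · have := congrArg (fun x : τ.GridDart => x.1.2) (Sum.inr.inj hxy)
    rw [(finRotate _).injective this]
  · cases hxy
  · obtain ⟨h, e⟩ := h3 y _ hxy.symm
    have e1 := congrArg (fun x : τ.GridDart => x.1.2) e
    have e2 := congrArg (fun x : τ.GridDart => x.1.1) e
    simp only [GridDart.start, GridDart.rot] at e1 e2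
    exact absurd (by rw [← e2, e1, τ.partner_partner]) h.rot.ne_partner
  · cases hxy
  · have := congrArg Prod.fst (Sum.inl.inj hxy)
    rw [(finRotate _).symm.injective this]
  · exact absurd hxy.symm (h2 _ _)
  · obtain ⟨h, e⟩ := h3 x _ hxy
    have e1 := congrArg (fun x : τ.GridDart => x.1.2) e
    have e2 := congrArg (fun x : τ.GridDart => x.1.1) e
    simp only [GridDart.start, GridDart.rot] at e1 e2
    exact absurd (by rw [← e2, e1, τ.partner_partner]) h.rot.ne_partner
  · exact absurd hxy (h2 _ _)
  · by_cases hx : τ.Cr x.1.1 x.1.2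
    · rw [gridRot_of_cr hx] at hxy
      obtain ⟨hy, e⟩ := h3 y _ hxy.symm
      have e1 := congrArg (fun x : τ.GridDart => x.1.2) e
      have e2 := congrArg (fun x : τ.GridDart => x.1.1) e
      congr 1
      exact Subtype.ext (Prod.ext (partner_injective e1) e2)
    · rw [GridDart.eq_start hx, gridRot_start] at hxy
      rw [GridDart.eq_start hx, h1 _ _ hxy.symm]

variable (τ) in
/-- The reversal of the darts of the grid diagram. -/
noncomputable def gridFlip : (Fin (2 * n) × Bool) ⊕ τ.GridDart → (Fin (2 * n) × Bool) ⊕ τ.GridDart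
  | Sum.inl (j, b) => Sum.inl (j, !b)
  | Sum.inr x => Sum.inr (GridDart.flip x)

theorem gridFlip_involutive : Function.Involutive τ.gridFlip
  | Sum.inl (j, b) => congrArg Sum.inl (congrArg (Prod.mk j) (Bool.not_not b))
  | Sum.inr x => congrArg Sum.inr (GridDart.flip_flip x)

variable (τ) in
/-- The grid diagram as a combinatorial map. -/
noncomputable def gridMap : DartMap ((Fin (2 * n) × Bool) ⊕ τ.GridDart) where
  rot := Equiv.ofBijective τ.gridRot (Finite.injective_iff_bijective.1 gridRot_injective)
  flip := gridFlip_involutive.toPerm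
  flip_flip := gridFlip_involutive
  flip_ne := by
    rintro (⟨j, b⟩ | x) h
    · exact Bool.not_ne_self b (congrArg Prod.snd (Sum.inl.inj h))
    · exact τ.partner_ne _ (congrArg (fun x : τ.GridDart => x.1.1) (Sum.inr.inj h))

theorem gridMap_rot_arc (j : Fin (2 * n)) :
    τ.gridMap.rot (Sum.inl (j, true)) = Sum.inl ((finRotate _).symm j, false) := rfl

theorem gridMap_rot_flip_arc (j : Fin (2 * n)) :
    τ.gridMap.rot (Sum.inl (j, false)) = Sum.inr (GridDart.start τ (finRotate _ j)) := rfl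

theorem gridMap_rot_start (j : Fin (2 * n)) :
    τ.gridMap.rot (Sum.inr (GridDart.start τ j)) = Sum.inl (j, true) := gridRot_start j

theorem gridMap_rot_of_cr {x : τ.GridDart} (h : τ.Cr x.1.1 x.1.2) :
    τ.gridMap.rot (Sum.inr x) = Sum.inr (x.rot h) := gridRot_of_cr h

theorem gridMap_flip_inl (j : Fin (2 * n)) (b : Bool) :
    τ.gridMap.flip (Sum.inl (j, b)) = Sum.inl (j, !b) := rfl

theorem gridMap_flip_inr (x : τ.GridDart) :
    τ.gridMap.flip (Sum.inr x) = Sum.inr x.flip := rfl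

theorem gridMap_faceNext_arc (j : Fin (2 * n)) :
    τ.gridMap.faceNext (Sum.inl (j, true)) = Sum.inl (finRotate _ j, true) := by
  apply τ.gridMap.rot.injective
  rw [DartMap.rot_faceNext, gridMap_flip_inl, gridMap_rot_arc, Equiv.symm_apply_apply]
  rfl

theorem gridMap_faceNext_flip_arc (j : Fin (2 * n)) :
    τ.gridMap.faceNext (Sum.inl (j, false)) = Sum.inr (GridDart.start τ j) := by
  apply τ.gridMap.rot.injective
  rw [DartMap.rot_faceNext, gridMap_flip_inl, gridMap_rot_start]
  rfl

theorem gridMap_faceNext_last {x : τ.GridDart} (h : x.next = τ.partner x.1.1) :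
    τ.gridMap.faceNext (Sum.inr x) = Sum.inl ((finRotate _).symm x.1.1, false) := by
  apply τ.gridMap.rot.injective
  rw [DartMap.rot_faceNext, gridMap_flip_inr, gridMap_rot_flip_arc, Equiv.apply_symm_apply]
  congr 1
  refine Subtype.ext (Prod.ext rfl ?_)
  change τ.partner x.next = _
  rw [h, τ.partner_partner]
  rfl

theorem gridMap_faceNext_of_cr {x : τ.GridDart} (h : τ.Cr x.1.1 x.next) :
    τ.gridMap.faceNext (Sum.inr x) =
      Sum.inr ⟨(x.next, τ.partner x.1.1), Or.inr h.rot⟩ := by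
  apply τ.gridMap.rot.injective
  rw [DartMap.rot_faceNext, gridMap_flip_inr, gridMap_rot_of_cr h.rot]
  rfl

end PointMatching

namespace PointMatching

variable {n : ℕ} {τ : PointMatching n}

theorem cr_iff_of_lt {a f : Fin (2 * n)} (h : τ.partner a < a) : τ.Cr a f ↔
    τ.partner a < f ∧ f < a ∧ (τ.partner f < τ.partner a ∨ a < τ.partner f) := by
  have h1 : (τ.partner f).val ≠ a.val ∨ f.val = (τ.partner a).val := by
    by_cases h2 : τ.partner f = a
    · right
      rw [← h2, τ.partner_partner]
    · exact Or.inl fun h3 => h2 (Fin.ext h3)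
  have h2 : (τ.partner f).val ≠ (τ.partner a).val ∨ f.val = a.val := by
    by_cases h2 : τ.partner f = τ.partner a
    · exact Or.inr (by rw [partner_injective h2])
    · exact Or.inl fun h3 => h2 (Fin.ext h3)
  simp only [Cr, Under, Fin.le_def, Fin.lt_def, ne_eq, Fin.ext_iff] at h ⊢
  omega

theorem cr_iff_of_gt {a f : Fin (2 * n)} (h : a < τ.partner a) : τ.Cr a f ↔
    a < τ.partner f ∧ τ.partner f < τ.partner a ∧ (f < a ∨ τ.partner a < f) := by
  have h1 : τ.partner (τ.partner a) < τ.partner a := by rwa [τ.partner_partner]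
  rw [← cr_partner_iff, cr_iff_of_lt h1, τ.partner_partner, τ.partner_partner]

variable (τ) in
/-- The chords that the grid diagram draws above the cell in column `u` and row `v`. -/
def cell (u v : ℕ) : Set (Fin (2 * n)) :=
  -- With the point `i` at `(i, i)`, the chord of `P` turns at `(P, partner P)`. Column `u` lies
  -- between the abscissas `u - 1` and `u`, and rows likewise, so these are the chords that turn to
  -- the upper left of the cell.
  {P | P < τ.partner P ∧ P.val < u ∧ v ≤ (τ.partner P).val}

variable (τ) in
/-- The cell of the grid diagram on the left of the dart `(a, b)`. -/
def corner (a b : Fin (2 * n)) : ℕ × ℕ :=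
  -- The cell is taken at the tail of the dart. In the plane the picture is a mirror image: the left
  -- of a strand that runs to its right end is the side below and to the right of it.
  if τ.partner a < a then
    if b = τ.partner a then ((τ.partner a).val + 1, (τ.partner a).val + 1)
    else if τ.partner b < b then ((τ.partner a).val + 1, b.val + 1) else (b.val + 1, a.val)
  else
    if b = τ.partner a then ((τ.partner a).val, (τ.partner a).val + 1)
    else if τ.partner b < b then ((τ.partner b).val, (τ.partner a).val + 1)
    else (a.val, (τ.partner b).val)

variable (τ) in
/-- The chords above the cell on the left of a dart. -/
def gridLabel : (Fin (2 * n) × Bool) ⊕ τ.GridDart → Option (Set (Fin (2 * n)))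
  | Sum.inl (_, true) => none
  | Sum.inl (j, false) => some (τ.cell (finRotate _ j).val (finRotate _ j).val)
  | Sum.inr x => some (τ.cell (τ.corner x.1.1 x.1.2).1 (τ.corner x.1.1 x.1.2).2)

/-- At the boundary both are cells next to the diagonal. At the last point the successor wraps
around to `0`, where the label is empty, as it is in row `2n`. -/
theorem cell_corner_partner (j : Fin (2 * n)) :
    τ.cell (τ.corner (τ.partner j) j).1 (τ.corner (τ.partner j) j).2 =
      τ.cell (finRotate _ j).val (finRotate _ j).val := by
  have h1 := val_finRotate j
  ext P
  have h2 : P = j ∨ P.val ≠ j.val := by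
    by_cases h : P = j
    · exact Or.inl h
    · exact Or.inr fun h3 => h (Fin.ext h3)
  have h3 := P.isLt
  have h4 := (τ.partner P).isLt
  have h5 : (τ.partner j).val ≠ j.val := fun h => τ.partner_ne j (Fin.ext h)
  have h6 := j.isLt
  simp only [cell, corner, τ.partner_partner, if_true, Set.mem_ofPred_eq, Fin.lt_def]
  rcases h2 with rfl | h2
  · split_ifs at h1 ⊢ <;> simp only <;> omega
  · split_ifs at h1 ⊢ <;> simp only <;> omega

theorem eq_or_val_ne (a P : Fin (2 * n)) : P = a ∨ P = τ.partner a ∨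
    (P.val ≠ a.val ∧ P.val ≠ (τ.partner a).val ∧ (τ.partner P).val ≠ a.val ∧
      (τ.partner P).val ≠ (τ.partner a).val) := by
  by_cases h1 : P = a
  · exact Or.inl h1
  by_cases h2 : P = τ.partner a
  · exact Or.inr (Or.inl h2)
  refine Or.inr (Or.inr ⟨fun h => h1 (Fin.ext h), fun h => h2 (Fin.ext h), fun h => h2 ?_,
    fun h => h1 (partner_injective (Fin.ext h))⟩)
  rw [← Fin.ext h, τ.partner_partner]

/-- A chord in only one of the two labels would meet the strand beyond `b`, where no crossing is
left. -/
theorem cell_corner_last {a b : Fin (2 * n)} (hb : b = τ.partner a ∨ τ.Cr a b)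
    (h : ∀ f, τ.Cr a f → ¬ τ.After a b f) :
    τ.cell (τ.corner a b).1 (τ.corner a b).2 = τ.cell a.val a.val := by
  ext P
  have hP := h P
  have hQ := h (τ.partner P)
  have e1 := τ.eq_or_val_ne a P
  have e3 : (τ.partner b).val ≠ b.val := fun h => τ.partner_ne b (Fin.ext h)
  have h5 : (τ.partner a).val ≠ a.val := fun h => τ.partner_ne a (Fin.ext h)
  by_cases hP' : P < τ.partner P
  swap
  · simp [cell, hP']
  rcases lt_or_gt_of_ne (τ.partner_ne a) with ha | ha
  · simp only [cell, corner, if_pos ha, hP', Set.mem_ofPred_eq, true_and]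
    simp only [cr_iff_of_lt ha, After, rank, if_pos ha, key, τ.partner_partner, if_pos hP',
      if_neg hP'.not_gt] at hP hQ hb
    rcases e1 with rfl | rfl | e1
    · exact absurd hP' ha.not_gt
    · simp only [τ.partner_partner] at *
      split_ifs <;> simp only [Fin.lt_def, Fin.ext_iff] at * <;> omega
    · split_ifs at * <;> simp only [Fin.lt_def, Fin.ext_iff] at * <;> omega
  · simp only [cell, corner, if_neg ha.not_gt, hP', Set.mem_ofPred_eq, true_and]
    simp only [cr_iff_of_gt ha, After, rank, if_neg ha.not_gt, key, τ.partner_partner, if_pos hP',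
      if_neg hP'.not_gt] at hP hQ hb
    rcases e1 with rfl | rfl | e1
    · split_ifs at * <;> simp only [Fin.lt_def, Fin.ext_iff] at * <;> omega
    · simp only [τ.partner_partner] at *
      exact absurd ha hP'.not_gt
    · split_ifs at * <;> simp only [Fin.lt_def, Fin.ext_iff] at * <;> omega

/-- A chord in only one of the two labels would meet the strand strictly between `b` and `e`, which
`h` excludes. The four cases are the directions of the two strands. -/
theorem cell_corner_step {a b e : Fin (2 * n)} (hb : b = τ.partner a ∨ τ.Cr a b)
    (he : τ.Cr a e) (hbe : τ.After a b e)
    (h : ∀ f, τ.Cr a f → τ.After a b f → τ.rank a e ≤ τ.rank a f) :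
    τ.cell (τ.corner a b).1 (τ.corner a b).2 =
      τ.cell (τ.corner e (τ.partner a)).1 (τ.corner e (τ.partner a)).2 := by
  ext P
  have hP := h P
  have hQ := h (τ.partner P)
  have e1 := τ.eq_or_val_ne a P
  have e2 := τ.eq_or_val_ne e P
  have e3 : (τ.partner b).val ≠ b.val := fun h => τ.partner_ne b (Fin.ext h)
  have e4 : τ.partner a ≠ τ.partner e := fun h => he.1 (partner_injective h).symm
  have e5 := τ.eq_or_val_ne e b
  by_cases hP' : P < τ.partner P
  swap
  · simp [cell, hP']
  rcases lt_or_gt_of_ne (τ.partner_ne a) with ha | ha <;>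
  rcases lt_or_gt_of_ne (τ.partner_ne e) with he' | he'
  · simp only [cell, corner, if_pos ha, if_pos he', if_neg e4, τ.partner_partner,
      if_neg ha.not_gt, hP', Set.mem_ofPred_eq, true_and]
    simp only [cr_iff_of_lt ha, After, rank, if_pos ha, key, τ.partner_partner, if_pos hP',
      if_neg hP'.not_gt, if_neg he'.not_gt] at hP hQ hb he hbe
    rcases e1 with rfl | rfl | e1
    · exact absurd hP' ha.not_gt
    · simp only [τ.partner_partner] at *
      split_ifs at * <;> simp only [Fin.lt_def, Fin.ext_iff] at * <;> omega
    rcases e2 with rfl | rfl | e2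
    · exact absurd hP' he'.not_gt
    · simp only [τ.partner_partner] at *
      split_ifs at * <;> simp only [Fin.lt_def, Fin.ext_iff] at * <;> omega
    · split_ifs at * <;> simp only [Fin.lt_def, Fin.ext_iff] at * <;> omega
  · simp only [cell, corner, if_pos ha, if_neg he'.not_gt, if_neg e4, τ.partner_partner,
      if_neg ha.not_gt, hP', Set.mem_ofPred_eq, true_and]
    simp only [cr_iff_of_lt ha, After, rank, if_pos ha, key, τ.partner_partner, if_pos hP',
      if_neg hP'.not_gt, if_pos he'] at hP hQ hb he hbe
    rcases e1 with rfl | rfl | e1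
    · exact absurd hP' ha.not_gt
    · simp only [τ.partner_partner] at *
      split_ifs at * <;> simp only [Fin.lt_def, Fin.ext_iff] at * <;> omega
    rcases e2 with rfl | rfl | e2
    · split_ifs at * <;> simp only [Fin.lt_def, Fin.ext_iff] at * <;> omega
    · simp only [τ.partner_partner] at hP'
      exact absurd hP' he'.not_gt
    · split_ifs at * <;> simp only [Fin.lt_def, Fin.ext_iff] at * <;> omega
  · simp only [cell, corner, if_neg ha.not_gt, if_pos he', if_neg e4, τ.partner_partner,
      if_pos ha, hP', Set.mem_ofPred_eq, true_and]
    simp only [cr_iff_of_gt ha, After, rank, if_neg ha.not_gt, key, τ.partner_partner, if_pos hP',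
      if_neg hP'.not_gt, if_pos he'] at hP hQ hb he hbe
    rcases e1 with rfl | rfl | e1
    · split_ifs at * <;> simp only [Fin.lt_def, Fin.ext_iff] at * <;> omega
    · simp only [τ.partner_partner] at hP'
      exact absurd hP' ha.not_gt
    rcases e2 with rfl | rfl | e2
    · exact absurd hP' he'.not_gt
    · simp only [τ.partner_partner] at *
      split_ifs at * <;> simp only [Fin.lt_def, Fin.ext_iff] at * <;> omega
    · split_ifs at * <;> simp only [Fin.lt_def, Fin.ext_iff] at * <;> omega
  · simp only [cell, corner, if_neg ha.not_gt, if_neg he'.not_gt, if_neg e4, τ.partner_partner,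
      if_pos ha, hP', Set.mem_ofPred_eq, true_and]
    simp only [cr_iff_of_gt ha, After, rank, if_neg ha.not_gt, key, τ.partner_partner, if_pos hP',
      if_neg hP'.not_gt, if_neg he'.not_gt] at hP hQ hb he hbe
    rcases e1 with rfl | rfl | e1
    · split_ifs at * <;> simp only [Fin.lt_def, Fin.ext_iff] at * <;> omega
    · simp only [τ.partner_partner] at hP'
      exact absurd hP' ha.not_gt
    rcases e2 with rfl | rfl | e2
    · split_ifs at * <;> simp only [Fin.lt_def, Fin.ext_iff] at * <;> omega
    · simp only [τ.partner_partner] at hP'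
      exact absurd hP' he'.not_gt
    · split_ifs at * <;> simp only [Fin.lt_def, Fin.ext_iff] at * <;> omega

theorem gridLabel_faceNext (x : (Fin (2 * n) × Bool) ⊕ τ.GridDart) :
    τ.gridLabel (τ.gridMap.faceNext x) = τ.gridLabel x := by
  rcases x with ⟨j, _ | _⟩ | x
  · rw [gridMap_faceNext_flip_arc]
    exact congrArg some (cell_corner_partner j)
  · rw [gridMap_faceNext_arc]
    rfl
  · rcases x.next_spec with ⟨h1, h2, h3⟩ | ⟨h1, h2⟩
    · rw [gridMap_faceNext_of_cr h1]
      exact congrArg some (cell_corner_step x.2 h1 h2 h3).symm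
    · rw [gridMap_faceNext_last h1]
      refine Eq.trans ?_ (congrArg some (cell_corner_last x.2 h2).symm)
      simp only [gridLabel, Equiv.apply_symm_apply]

variable (τ) in
open scoped Classical in
/-- The pairs of a closing point `b` and an opening point `c` such that the chords of `b` and `c`
are equal or cross, with `c` between the ends of the chord of `b`. -/
noncomputable def closeOpen : Finset (Fin (2 * n) × Fin (2 * n)) :=
  Finset.univ.filter fun p => τ.partner p.1 ≤ p.2 ∧ p.2 < p.1 ∧ p.1 ≤ τ.partner p.2

open scoped Classical in
/-- The pairs of points on equal or crossing chords, with the second point on the left of the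
first. -/
theorem card_le_four_mul_card_closeOpen :
    (Finset.univ.filter fun p : Fin (2 * n) × Fin (2 * n) =>
      p.2 = p.1 ∨ p.2 = τ.partner p.1 ∨ τ.Cr p.1 p.2).card ≤ 4 * τ.closeOpen.card := by
  set Y := Finset.univ.filter fun p : Fin (2 * n) × Fin (2 * n) =>
      p.2 = p.1 ∨ p.2 = τ.partner p.1 ∨ τ.Cr p.1 p.2 with hY
  let r : Fin (2 * n) × Fin (2 * n) → Fin (2 * n) × Fin (2 * n) := fun p => (p.2, τ.partner p.1)
  have hr : Function.Injective r := fun p q h =>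
    Prod.ext (partner_injective (congrArg Prod.snd h)) (congrArg Prod.fst h)
  have hrY : ∀ p ∈ Y, r p ∈ Y := by
    intro p hp
    simp only [hY, Finset.mem_filter, Finset.mem_univ, true_and, r] at hp ⊢
    rcases hp with h | h | h
    · exact Or.inr (Or.inl (by rw [h]))
    · exact Or.inl h.symm
    · exact Or.inr (Or.inr h.rot)
  -- The pairs are sorted by whether each point closes its chord. The quarter turn `r` maps the four
  -- kinds injectively to one another in a cycle, so none is larger than the kind with closing first
  -- and opening second point.
  let Z : Bool → Bool → Finset (Fin (2 * n) × Fin (2 * n)) := fun s t =>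
    Y.filter fun p => (decide (τ.partner p.1 < p.1) = s) ∧ (decide (τ.partner p.2 < p.2) = t)
  have hZ : ∀ s t, (Z s t).card ≤ (Z t (!s)).card := fun s t => by
    refine Finset.card_le_card_of_injOn r (fun p hp => ?_) hr.injOn
    have hp := Finset.mem_coe.1 hp
    simp only [Z, Finset.mem_filter] at hp
    refine Finset.mem_coe.2 (Finset.mem_filter.2 ⟨hrY p hp.1, hp.2.2, ?_⟩)
    have := τ.partner_ne p.1
    simp only [r, τ.partner_partner, ← hp.2.1]
    rcases lt_or_gt_of_ne this with h | h <;> simp [h, h.not_gt]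
  have hC : Z true false ⊆ τ.closeOpen := by
    intro p hp
    simp only [Z, hY, closeOpen, Finset.mem_filter, Finset.mem_univ, true_and, decide_eq_true_eq,
      decide_eq_false_iff_not] at hp ⊢
    obtain ⟨hp, h1, h2⟩ := hp
    have h3 := lt_of_le_of_ne (not_lt.1 h2) (τ.partner_ne p.2).symm
    rcases hp with h | h | h
    · rw [h] at h2; exact absurd h1 h2
    · rw [h, τ.partner_partner]
      exact ⟨le_rfl, h1, le_rfl⟩
    · obtain ⟨h4, h5, h6⟩ := (cr_iff_of_lt h1).1 h
      refine ⟨h4.le, h5, ?_⟩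
      rcases h6 with h6 | h6
      · exact absurd (h6.trans h4) h3.not_gt
      · exact h6.le
  have hsum : Y.card = ((Z true true).card + (Z true false).card) +
      ((Z false true).card + (Z false false).card) := by
    have h2 : ∀ s, (Y.filter fun p => decide (τ.partner p.1 < p.1) = s).card =
        (Z s true).card + (Z s false).card := fun s => by
      simp only [Z, ← Finset.filter_filter]
      rw [← Finset.card_filter_add_card_filter_not (p := fun p : Fin (2 * n) × Fin (2 * n) =>
        decide (τ.partner p.2 < p.2) = true)]
      simp only [Bool.not_eq_true]
    rw [← h2, ← h2, ← Finset.card_filter_add_card_filter_not (p := fun p : Fin (2 * n) ×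
      Fin (2 * n) => decide (τ.partner p.1 < p.1) = true)]
    simp only [Bool.not_eq_true]
  have h1 := hZ false false
  have h2 := hZ false true
  have h3 := hZ true true
  have h4 := Finset.card_le_card hC
  simp only [Bool.not_false, Bool.not_true] at h1 h2 h3
  omega

theorem card_gridDart_add_le : Nat.card τ.GridDart + 2 * n ≤ 4 * τ.closeOpen.card := by
  classical
  refine le_trans ?_ card_le_four_mul_card_closeOpen
  have h1 : Nat.card τ.GridDart = (Finset.univ.filter fun p : Fin (2 * n) × Fin (2 * n) =>
      p.2 = τ.partner p.1 ∨ τ.Cr p.1 p.2).card := by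
    rw [Nat.card_eq_fintype_card, Fintype.card_subtype]
  have h2 : (Finset.univ.image fun a : Fin (2 * n) => (a, a)).card = 2 * n := by
    rw [Finset.card_image_of_injective _ fun a b h => congrArg Prod.fst h, Finset.card_univ,
      Fintype.card_fin]
  rw [h1]
  refine (Nat.add_le_add_left h2.ge _).trans ?_
  rw [← Finset.card_union_of_disjoint]
  · refine Finset.card_le_card fun p hp => ?_
    simp only [Finset.mem_union, Finset.mem_filter, Finset.mem_image, Finset.mem_univ,
      true_and] at hp ⊢
    rcases hp with hp | ⟨a, rfl⟩
    · exact Or.inr hp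
    · exact Or.inl rfl
  · rw [Finset.disjoint_left]
    intro p hp hq
    simp only [Finset.mem_filter, Finset.mem_image, Finset.mem_univ, true_and] at hp hq
    obtain ⟨a, rfl⟩ := hq
    rcases hp with h | h
    · exact τ.partner_ne a h.symm
    · exact h.1 rfl

/-- The region in the angle at the turn of the chord is seen from the last dart on its vertical
part. This dart leaves the highest crossing there, or the left endpoint if there is none. -/
theorem exists_corner_eq {a : Fin (2 * n)} (ha : τ.partner a < a) :
    ∃ e, (e = τ.partner a ∨ τ.Cr a e) ∧ τ.cell (τ.corner a e).1 (τ.corner a e).2 =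
      τ.cell ((τ.partner a).val + 1) a.val := by
  classical
  have key : ∀ e : Fin (2 * n), τ.partner a ≤ e → e < a → (∀ f, τ.Cr a f → τ.partner f < f → f ≤ e) →
      τ.cell ((τ.partner a).val + 1) (e.val + 1) = τ.cell ((τ.partner a).val + 1) a.val := by
    intro e h1 h2 h
    ext P
    have h3 := τ.eq_or_val_ne a P
    have h4 := h (τ.partner P)
    rw [cr_iff_of_lt ha, τ.partner_partner] at h4
    simp only [cell, Set.mem_ofPred_eq]
    rcases h3 with rfl | rfl | h3
    · simp only [Fin.lt_def, Fin.le_def] at *; omega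
    · simp only [τ.partner_partner, Fin.lt_def, Fin.le_def] at *; omega
    · simp only [Fin.lt_def, Fin.le_def] at *; omega
  by_cases h : (Finset.univ.filter fun f => τ.Cr a f ∧ τ.partner f < f).Nonempty
  · obtain ⟨e, he, hm⟩ := Finset.exists_max_image _ id h
    simp only [Finset.mem_filter, Finset.mem_univ, true_and, id] at he hm
    obtain ⟨h1, h2, -⟩ := (cr_iff_of_lt ha).1 he.1
    refine ⟨e, Or.inr he.1, ?_⟩
    simp only [corner, if_pos ha, if_neg he.1.ne_partner, if_pos he.2]
    exact key e h1.le h2 fun f hf hf' => hm f ⟨hf, hf'⟩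
  · refine ⟨_, Or.inl rfl, ?_⟩
    simp only [corner, if_pos ha, if_true]
    refine key _ le_rfl ha fun f hf hf' => (h ⟨f, ?_⟩).elim
    simp [hf, hf']

/-- Regions are counted by distinct labels: that of the outside, the empty one, and for each turn or
crossing the cell to its lower right. The label of such a cell determines `c` as its largest element
and `b` as the smallest right end of its chords. -/
theorem closeOpen_card_add_two_le (hn : n ≠ 0) :
    τ.closeOpen.card + 2 ≤ Nat.card (Quotient τ.gridMap.walkRel) := by
  classical
  let lab : Quotient τ.gridMap.walkRel → Option (Set (Fin (2 * n))) :=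
    Quotient.lift τ.gridLabel fun x y h => h.apply_eq_of_invariant gridLabel_faceNext
  have h0 : 0 < 2 * n := by omega
  let K : Finset (Option (Set (Fin (2 * n)))) := insert none (insert (some ∅)
    (τ.closeOpen.image fun p => some (τ.cell (p.2.val + 1) p.1.val)))
  have hmem : ∀ p ∈ τ.closeOpen, p.2 ∈ τ.cell (p.2.val + 1) p.1.val := by
    intro p hp
    simp only [closeOpen, Finset.mem_filter, Finset.mem_univ, true_and] at hp
    exact ⟨hp.2.1.trans_le hp.2.2, Nat.lt_succ_self _, hp.2.2⟩
  have hmem' : ∀ p ∈ τ.closeOpen, τ.partner p.1 ∈ τ.cell (p.2.val + 1) p.1.val := by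
    intro p hp
    simp only [closeOpen, Finset.mem_filter, Finset.mem_univ, true_and] at hp
    refine ⟨?_, Nat.lt_succ_of_le hp.1, ?_⟩
    · rw [τ.partner_partner]; exact hp.1.trans_lt hp.2.1
    · rw [τ.partner_partner]
  have hK : K.card = τ.closeOpen.card + 2 := by
    rw [Finset.card_insert_of_notMem, Finset.card_insert_of_notMem, Finset.card_image_of_injOn]
    · intro p hp q hq h
      have h := Option.some.inj h
      have h1 := hmem p hp
      have h2 := hmem q hq
      have h3 := hmem' p hp
      have h4 := hmem' q hq
      rw [h] at h1 h3
      rw [← h] at h2 h4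
      have h5 := h1.2.1
      have h6 := h2.2.1
      have h7 := h3.2.2
      have h8 := h4.2.2
      rw [τ.partner_partner] at h7 h8
      exact Prod.ext (Fin.ext (by omega)) (Fin.ext (by omega))
    · simp only [Finset.mem_image, not_exists, not_and]
      intro p hp h
      have := hmem p hp
      rw [Option.some.inj h] at this
      exact this
    · simp
  rw [← hK, ← Set.ncard_coe_finset]
  refine (Set.ncard_le_ncard (t := Set.range lab) ?_ (Set.finite_range lab)).trans ?_
  · intro l hl
    simp only [K, Finset.coe_insert, Finset.coe_image, Set.mem_insert_iff, Set.mem_image,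
      Finset.mem_coe] at hl
    rcases hl with rfl | rfl | ⟨⟨b, c⟩, hp, rfl⟩
    · exact ⟨Quotient.mk _ (Sum.inl (⟨0, h0⟩, true)), rfl⟩
    · refine ⟨Quotient.mk _ (Sum.inl ((finRotate _).symm ⟨0, h0⟩, false)), congrArg some ?_⟩
      rw [Equiv.apply_symm_apply]
      ext P
      simp [cell]
    · simp only [closeOpen, Finset.mem_filter, Finset.mem_univ, true_and] at hp
      obtain ⟨h1, h2, h3⟩ := hp
      have h4 := h1.trans_lt h2
      have h5 := h2.trans_le h3
      rcases h1.eq_or_lt with rfl | h1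
      · obtain ⟨e, he, h⟩ := exists_corner_eq h4
        exact ⟨Quotient.mk _ (Sum.inr ⟨(b, e), he⟩), congrArg some h⟩
      · refine ⟨Quotient.mk _ (Sum.inr ⟨(b, c), Or.inr ((cr_iff_of_lt h4).2 ⟨h1, h2, Or.inr ?_⟩)⟩),
          congrArg some ?_⟩
        · refine lt_of_le_of_ne h3 fun h => h1.ne ?_
          rw [h, τ.partner_partner]
        · simp only [corner, if_pos h4, if_neg h1.ne', if_neg h5.not_gt]
  · rw [← Set.image_univ, ← Nat.card_univ (α := Quotient τ.gridMap.walkRel)]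
    exact Set.ncard_image_le

end PointMatching

namespace PointMatching

open BoundedMap DiskDrawing

variable {n : ℕ} {τ : PointMatching n}

theorem gridMap_flip_of_next {x : τ.GridDart} (h : τ.Cr x.1.1 x.next) :
    τ.gridMap.flip (Sum.inr x) =
      τ.gridMap.rot (τ.gridMap.rot (Sum.inr ⟨(x.1.1, x.next), Or.inr h⟩)) := by
  rw [gridMap_rot_of_cr h]
  exact (gridMap_rot_of_cr (x := GridDart.rot ⟨(x.1.1, x.next), Or.inr h⟩ h) h.rot).symm

theorem gridMap_flip_last {x : τ.GridDart} (h : x.next = τ.partner x.1.1) :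
    τ.gridMap.flip (Sum.inr x) = Sum.inr (GridDart.start τ x.1.1) := by
  refine congrArg Sum.inr (Subtype.ext (Prod.ext rfl ?_))
  change τ.partner x.next = _
  rw [h, τ.partner_partner]
  rfl

theorem gridMap_componentRel (x y : (Fin (2 * n) × Bool) ⊕ τ.GridDart) :
    τ.gridMap.componentRel x y := by
  have hs : ∀ x, (Quotient.mk τ.gridMap.componentRel (τ.gridMap.flip x)) = Quotient.mk _ x :=
    fun x => Quotient.sound (Setoid.symm' _ (τ.gridMap.componentRel_flip x))
  have hr : ∀ x, (Quotient.mk τ.gridMap.componentRel (τ.gridMap.rot x)) = Quotient.mk _ x :=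
    fun x => Quotient.sound (Setoid.symm' _ (τ.gridMap.componentRel_rot x))
  have h1 : ∀ i j, Quotient.mk τ.gridMap.componentRel (Sum.inl (i, true)) =
      Quotient.mk _ (Sum.inl (j, true)) :=
    eq_of_finRotate_invariant fun i => by
      rw [← gridMap_faceNext_arc]
      exact Quotient.sound (τ.gridMap.componentRel_faceNext _)
  have h2 : ∀ x : τ.GridDart, ∃ i, Quotient.mk τ.gridMap.componentRel (Sum.inr x) =
      Quotient.mk _ (Sum.inl (i, true)) := by
    intro x
    induction x using GridDart.induction with
    | last x hx =>
      refine ⟨x.1.1, ?_⟩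
      rw [← hs, gridMap_flip_last hx, ← gridMap_rot_start, hr]
    | step x h ih =>
      obtain ⟨i, hi⟩ := ih
      refine ⟨i, ?_⟩
      rw [← hs, gridMap_flip_of_next h, hr, hr, hi]
  have h3 : ∀ x, ∃ i, Quotient.mk τ.gridMap.componentRel x =
      Quotient.mk _ (Sum.inl (i, true)) := by
    rintro (⟨i, _ | _⟩ | x)
    · exact ⟨i, (hs (Sum.inl (i, false))).symm⟩
    · exact ⟨i, rfl⟩
    · exact h2 x
  obtain ⟨i, hi⟩ := h3 x
  obtain ⟨j, hj⟩ := h3 y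
  exact Quotient.exact (hi.trans ((h1 i j).trans hj.symm))

theorem eq_of_gridMap_vertexRel {i j : Fin (2 * n)}
    (h : τ.gridMap.vertexRel (Sum.inl (i, true)) (Sum.inl (j, true))) : i = j := by
  classical
  let v : (Fin (2 * n) × Bool) ⊕ τ.GridDart → Option (Fin (2 * n)) := fun x => match x with
    | Sum.inl (j, true) => some j
    | Sum.inl (j, false) => some (finRotate _ j)
    | Sum.inr x => if τ.Cr x.1.1 x.1.2 then none else some x.1.2
  have hv : ∀ x, v (τ.gridMap.rot x) = v x := by
    rintro (⟨j, _ | _⟩ | x)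
    · rw [gridMap_rot_flip_arc]
      exact if_neg (not_cr_start _)
    · rw [gridMap_rot_arc]
      exact congrArg some (Equiv.apply_symm_apply _ _)
    · by_cases hx : τ.Cr x.1.1 x.1.2
      · rw [gridMap_rot_of_cr hx]
        exact (if_pos hx.rot).trans (if_pos hx).symm
      · rw [GridDart.eq_start hx, gridMap_rot_start]
        exact (if_neg (not_cr_start _)).symm
  exact Option.some.inj (h.apply_eq_of_invariant hv)

theorem gridMap_vertexRel_start (j : Fin (2 * n)) :
    τ.gridMap.vertexRel (Sum.inl (j, true)) (Sum.inr (GridDart.start τ j)) := by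
  rw [← gridMap_rot_start]
  exact (τ.gridMap.vertexRel_rot _).symm

theorem exists_of_forall_not_vertexRel {d : (Fin (2 * n) × Bool) ⊕ τ.GridDart}
    (h : ∀ i, ¬ τ.gridMap.vertexRel (Sum.inl (i, true)) d) :
    ∃ x : τ.GridDart, τ.Cr x.1.1 x.1.2 ∧ d = Sum.inr x := by
  rcases d with ⟨j, _ | _⟩ | x
  · refine absurd ?_ (h (finRotate _ j))
    have := τ.gridMap.vertexRel_rot (Sum.inl (finRotate _ j, true))
    rwa [gridMap_rot_arc, Equiv.symm_apply_apply] at this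
  · exact absurd (Setoid.refl' _ _) (h j)
  · by_contra hx
    push Not at hx
    have h1 : ¬ τ.Cr x.1.1 x.1.2 := fun h1 => hx x h1 rfl
    refine h x.1.2 ?_
    rw [GridDart.eq_start h1]
    exact gridMap_vertexRel_start _

theorem gridMap_rot_three (j : Fin (2 * n)) :
    τ.gridMap.rot (τ.gridMap.rot (τ.gridMap.rot (Sum.inl (j, true)))) = Sum.inl (j, true) := by
  rw [gridMap_rot_arc, gridMap_rot_flip_arc, Equiv.apply_symm_apply, gridMap_rot_start]

theorem gridMap_rot_rot_of_cr {x : τ.GridDart} (h : τ.Cr x.1.1 x.1.2) :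
    τ.gridMap.rot (τ.gridMap.rot (Sum.inr x)) =
      Sum.inr ⟨(τ.partner x.1.1, τ.partner x.1.2), Or.inr h.rot.rot⟩ := by
  rw [gridMap_rot_of_cr h]
  exact gridMap_rot_of_cr h.rot

theorem gridMap_rot_four {x : τ.GridDart} (h : τ.Cr x.1.1 x.1.2) :
    τ.gridMap.rot (τ.gridMap.rot (τ.gridMap.rot (τ.gridMap.rot (Sum.inr x)))) = Sum.inr x := by
  rw [gridMap_rot_rot_of_cr h]
  refine (gridMap_rot_rot_of_cr h.rot.rot).trans (congrArg Sum.inr (Subtype.ext (Prod.ext ?_ ?_)))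
  · exact τ.partner_partner _
  · exact τ.partner_partner _

theorem gridMap_isPlanar (hn : n ≠ 0) : τ.gridMap.IsPlanar := by
  refine DartMap.isPlanar_of_degrees (fun j : Fin (2 * n) => Sum.inl (j, true))
    gridMap_componentRel (fun i j => eq_of_gridMap_vertexRel) (fun j => ?_) (fun d hd => ?_) ?_
  · refine Equiv.Perm.ncard_sameCycle_three (gridMap_rot_three j) fun h => ?_
    exact Bool.false_ne_true (congrArg Prod.snd (Sum.inl.inj h))
  · obtain ⟨x, hx, rfl⟩ := exists_of_forall_not_vertexRel hd
    refine Equiv.Perm.ncard_sameCycle_four (gridMap_rot_four hx) fun h => ?_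
    rw [gridMap_rot_rot_of_cr hx] at h
    exact τ.partner_ne _ (congrArg (fun x : τ.GridDart => x.1.1) (Sum.inr.inj h))
  -- There are `4 n` darts on the circle; the two counts together give exactly the number of faces
  -- that is required.
  · have h1 := closeOpen_card_add_two_le (τ := τ) hn
    have h2 := card_gridDart_add_le (τ := τ)
    rw [Nat.card_sum, Nat.card_prod, Nat.card_fin, Nat.card_eq_two_iff.2 ⟨true, false, by simp, by
      ext b; cases b <;> simp⟩]
    omega

variable (τ) in
/-- The grid diagram as a drawing in a disk. -/
noncomputable def gridDrawing : DiskDrawing n where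
  Dart := (Fin (2 * n) × Bool) ⊕ τ.GridDart
  finite := inferInstance
  map := τ.gridMap
  planar := by
    rcases eq_or_ne n 0 with rfl | hn
    · rintro (⟨j, -⟩ | x)
      · exact j.elim0
      · exact x.1.1.elim0
    · exact gridMap_isPlanar hn
  arc j := Sum.inl (j, true)
  arc_injective i j h := congrArg Prod.fst (Sum.inl.inj h)
  flip_arc_ne i j h := by cases h
  faceNext_arc := gridMap_faceNext_arc
  boundary_degree j := Equiv.Perm.ncard_sameCycle_three (gridMap_rot_three j) fun h =>
    Bool.false_ne_true (congrArg Prod.snd (Sum.inl.inj h))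
  crossing_degree d hd := by
    obtain ⟨x, hx, rfl⟩ := exists_of_forall_not_vertexRel hd
    refine Equiv.Perm.ncard_sameCycle_four (gridMap_rot_four hx) fun h => ?_
    rw [gridMap_rot_rot_of_cr hx] at h
    exact τ.partner_ne _ (congrArg (fun x : τ.GridDart => x.1.1) (Sum.inr.inj h))

theorem gridDrawing_strandStart (j : Fin (2 * n)) :
    τ.gridDrawing.strandStart j = Sum.inr (GridDart.start τ j) :=
  τ.gridMap.rot.injective ((τ.gridDrawing.rot_strandStart j).trans (gridMap_rot_start j).symm)

theorem gridDrawing_isInner_iff {x : τ.GridDart} :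
    τ.gridDrawing.IsInner (Sum.inr x) ↔ τ.Cr x.1.1 x.1.2 := by
  constructor
  · intro h
    obtain ⟨y, hy, e⟩ := exists_of_forall_not_vertexRel h
    cases e
    exact hy
  · intro h i hi
    rcases (vertexRel_arc_iff (S := τ.gridDrawing)).1 hi with h1 | h1 | h1
    · cases h1
    · cases h1
    · rw [gridDrawing_strandStart] at h1
      cases h1
      exact not_cr_start _ h

theorem gridDrawing_toward (x : τ.GridDart) :
    τ.gridDrawing.Toward (Sum.inr x) x.1.1 := by
  induction x using GridDart.induction with
  | last x hx =>
    refine ⟨0, .finish ?_⟩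
    rw [gridDrawing_strandStart]
    exact gridMap_flip_last hx
  | step x h ih =>
    obtain ⟨m, hm⟩ := ih
    refine ⟨m + 1, .step ?_ ?_⟩
    · exact gridDrawing_isInner_iff.2 h.rot.rot
    · have : τ.gridMap.rot (τ.gridMap.rot (τ.gridMap.flip (Sum.inr x))) =
          Sum.inr ⟨(x.1.1, x.next), Or.inr h⟩ := by
        rw [gridMap_flip_of_next h]
        exact gridMap_rot_four h
      exact this ▸ hm

/-- The unordered pair of ends is preserved along strands, since every move on a strand only
exchanges its members. -/
theorem gridDrawing_strandRel {x y : τ.GridDart}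
    (h : τ.gridDrawing.strandRel (Sum.inr x) (Sum.inr y)) :
    y.1.1 = x.1.1 ∨ y.1.1 = τ.partner x.1.1 := by
  let c : τ.gridDrawing.Dart → Option (Sym2 (Fin (2 * n))) :=
    Sum.elim (fun _ => none) fun x => some s(x.1.1, τ.partner x.1.1)
  have hc : ∀ x y, τ.gridDrawing.strandRel x y → c x = c y := by
    intro x y h
    induction h with
    | refl x => rfl
    | symm x y _ ih => exact ih.symm
    | trans x y z _ _ h1 h2 => exact h1.trans h2
    | rel x y h =>
      rcases h with ⟨h, rfl⟩ | ⟨h, rfl⟩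
      · rcases x with ⟨j, _ | _⟩ | x
        · rfl
        · rfl
        · exact congrArg some (Sym2.eq_swap.trans
            (congrArg (fun z => s(τ.partner x.1.1, z)) (τ.partner_partner x.1.1).symm))
      · obtain ⟨x, hx, rfl⟩ := exists_of_forall_not_vertexRel h
        have h1 : τ.gridDrawing.map.rot (τ.gridDrawing.map.rot (Sum.inr x)) = _ :=
          gridMap_rot_rot_of_cr hx
        rw [h1]
        refine congrArg some (Sym2.eq_swap.trans ?_)
        change s(_, _) = s(τ.partner x.1.1, _)
        rw [τ.partner_partner]
  have h1 := Option.some.inj (hc _ _ h)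
  rcases Sym2.eq_iff.1 h1 with ⟨h2, -⟩ | ⟨h2, h3⟩
  · exact Or.inl h2.symm
  · exact Or.inr h3.symm

theorem gridDrawing_strandRel_start (x : τ.GridDart) :
    τ.gridDrawing.strandRel (τ.gridDrawing.strandStart x.1.1) (Sum.inr x) := by
  obtain ⟨m, hm⟩ := gridDrawing_toward x
  exact (hm.strandRel).symm

variable (τ) in
/-- The grid diagram of a matching. -/
noncomputable def gridDiagram : StrandDiagram n where
  toDiskDrawing := τ.gridDrawing
  no_closed_strand := by
    rintro (⟨j, b⟩ | x) h
    · refine absurd ⟨j, ?_⟩ h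
      cases b
      · exact Or.inr rfl
      · exact Or.inl rfl
    · exact ⟨x.1.1, gridDrawing_strandRel_start x⟩
  no_self_crossing d hd h := by
    obtain ⟨x, hx, rfl⟩ := exists_of_forall_not_vertexRel hd
    have h1 : τ.gridDrawing.map.rot (Sum.inr x) = _ := gridMap_rot_of_cr hx
    rw [h1] at h
    rcases gridDrawing_strandRel h with h2 | h2
    · exact hx.1 h2
    · exact hx.2.1 h2
  no_double_crossing d e hd he h h' := by
    obtain ⟨x, hx, rfl⟩ := exists_of_forall_not_vertexRel hd
    obtain ⟨y, hy, rfl⟩ := exists_of_forall_not_vertexRel he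
    have h1 : τ.gridDrawing.map.rot (Sum.inr x) = _ := gridMap_rot_of_cr hx
    have h2 : τ.gridDrawing.map.rot (Sum.inr y) = _ := gridMap_rot_of_cr hy
    rw [h1, h2] at h'
    have h3 := gridDrawing_strandRel h
    have h4 : y.1.2 = x.1.2 ∨ y.1.2 = τ.partner x.1.2 := gridDrawing_strandRel h'
    rcases h3 with h3 | h3 <;> rcases h4 with h4 | h4
    · rw [show y = x from Subtype.ext (Prod.ext h3 h4)]
      exact Setoid.refl' _ _
    · rw [h3, h4] at hy
      exact absurd hy hx.not_partner
    · rw [h3, h4] at hy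
      exact absurd (by rwa [τ.partner_partner]) hx.rot.rot.not_partner
    · have h5 : Sum.inr y = τ.gridDrawing.map.rot (τ.gridDrawing.map.rot (Sum.inr x)) := by
        refine Eq.trans ?_ (gridMap_rot_rot_of_cr hx).symm
        exact congrArg Sum.inr (Subtype.ext (Prod.ext h3 h4))
      rw [h5]
      exact Setoid.trans' _ (τ.gridMap.vertexRel_rot _) (τ.gridMap.vertexRel_rot _)

theorem gridDiagram_isDiagramOf : τ.gridDiagram.IsDiagramOf τ := by
  intro j k
  change τ.gridDrawing.strandRel (τ.gridDrawing.strandStart j) (τ.gridDrawing.strandStart k) ↔ _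
  rw [gridDrawing_strandStart, gridDrawing_strandStart]
  constructor
  · intro h
    rcases gridDrawing_strandRel h with h | h
    · exact Or.inl (partner_injective h)
    · right
      exact partner_injective h
  · rintro (rfl | rfl)
    · exact Setoid.refl' _ _
    · have := gridDrawing_strandRel_start (GridDart.start τ (τ.partner j))
      have h1 : (GridDart.start τ (τ.partner j)).1.1 = j := τ.partner_partner j
      rwa [h1, gridDrawing_strandStart] at this

end PointMatching

/-! ### Three pairwise crossing chords: rotating the numbering gives another diagram. -/

namespace DiskDrawing

open BoundedMap

variable {n : ℕ}

/-- The same drawing with another choice of the boundary point from which the numbering starts. -/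
def relabel (S : DiskDrawing n) (P : Equiv.Perm (Fin (2 * n)))
    (hP : ∀ i, P (finRotate _ i) = finRotate _ (P i)) : DiskDrawing n where
  Dart := S.Dart
  finite := S.finite
  map := S.map
  planar := S.planar
  arc j := S.arc (P j)
  arc_injective := S.arc_injective.comp P.injective
  flip_arc_ne i j := S.flip_arc_ne _ _
  faceNext_arc i := by rw [S.faceNext_arc, hP]
  boundary_degree j := S.boundary_degree (P j)
  crossing_degree d hd := S.crossing_degree d fun i => by
    have : ¬ S.map.vertexRel (S.arc (P (P.symm i))) d := hd (P.symm i)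
    rwa [P.apply_symm_apply] at this

variable {S : DiskDrawing n} {P : Equiv.Perm (Fin (2 * n))}
  {hP : ∀ i, P (finRotate _ i) = finRotate _ (P i)}

theorem relabel_isInner {d : S.Dart} : (S.relabel P hP).IsInner d ↔ S.IsInner d :=
  P.forall_congr_left.trans (forall_congr' fun i => by
    change ¬ S.map.vertexRel (S.arc (P (P.symm i))) d ↔ _
    rw [P.apply_symm_apply])

theorem relabel_isArc {d : S.Dart} : (S.relabel P hP).IsArc d ↔ S.IsArc d :=
  P.exists_congr_left.trans (exists_congr fun i => by
    change d = S.arc (P (P.symm i)) ∨ d = S.map.flip (S.arc (P (P.symm i))) ↔ _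
    rw [P.apply_symm_apply])

theorem relabel_strandRel {x y : S.Dart} :
    (S.relabel P hP).strandRel x y ↔ S.strandRel x y := by
  have h : ∀ x y : S.Dart, ((¬ (S.relabel P hP).IsArc x ∧ y = S.map.flip x) ∨
      ((S.relabel P hP).IsInner x ∧ y = S.map.rot (S.map.rot x))) ↔
      ((¬ S.IsArc x ∧ y = S.map.flip x) ∨ (S.IsInner x ∧ y = S.map.rot (S.map.rot x))) :=
    fun x y => or_congr (and_congr_left' (not_congr relabel_isArc))
      (and_congr_left' relabel_isInner)
  constructor
  · exact Relation.EqvGen.mono (fun x y => (h x y).1) x y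
  · exact Relation.EqvGen.mono (fun x y => (h x y).2) x y

theorem relabel_ahead {x : (S.relabel P hP).Dart} {a : Fin (2 * n)} {m : ℕ}
    (h : (S.relabel P hP).Ahead x a m) : S.Ahead (x : S.Dart) (P a) m := by
  induction h with
  | finish h => exact .finish h
  | step h _ ih => exact .step (relabel_isInner.1 h) ih

end DiskDrawing

namespace StrandDiagram

open BoundedMap DiskDrawing

variable {n : ℕ}

/-- The same strand diagram with another choice of the boundary point from which the numbering
starts. -/
def relabel (S : StrandDiagram n) (P : Equiv.Perm (Fin (2 * n)))
    (hP : ∀ i, P (finRotate _ i) = finRotate _ (P i)) : StrandDiagram n where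
  toDiskDrawing := S.toDiskDrawing.relabel P hP
  no_closed_strand d hd := by
    obtain ⟨j, hj⟩ := S.no_closed_strand d fun h => hd (relabel_isArc.2 h)
    refine ⟨P.symm j, relabel_strandRel.2 ?_⟩
    change S.strandRel (S.strandStart (P (P.symm j))) d
    rwa [P.apply_symm_apply]
  no_self_crossing d hd h := S.no_self_crossing d (relabel_isInner.1 hd) (relabel_strandRel.1 h)
  no_double_crossing d e hd he h h' := S.no_double_crossing d e (relabel_isInner.1 hd)
    (relabel_isInner.1 he) (relabel_strandRel.1 h) (relabel_strandRel.1 h')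

variable {S T U : StrandDiagram n}

/-- The inverse isomorphism. -/
def Iso.symm (f : S.Iso T) : T.Iso S where
  toEquiv := f.toEquiv.symm
  map_rot d := f.toEquiv.symm_apply_eq.2 (by rw [f.map_rot, f.toEquiv.apply_symm_apply])
  map_flip d := f.toEquiv.symm_apply_eq.2 (by rw [f.map_flip, f.toEquiv.apply_symm_apply])
  map_arc j := f.toEquiv.symm_apply_eq.2 (f.map_arc j).symm

/-- The composition of isomorphisms. -/
def Iso.trans (f : S.Iso T) (g : T.Iso U) : S.Iso U where
  toEquiv := f.toEquiv.trans g.toEquiv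
  map_rot d := by simp only [Equiv.trans_apply, f.map_rot, g.map_rot]
  map_flip d := by simp only [Equiv.trans_apply, f.map_flip, g.map_flip]
  map_arc d := by simp only [Equiv.trans_apply, f.map_arc, g.map_arc]

theorem Iso.map_strandStart (f : S.Iso T) (j : Fin (2 * n)) :
    f.toEquiv (S.strandStart j) = T.strandStart j := by
  rw [← S.rot_rot_arc, f.map_rot, f.map_rot, f.map_arc, T.rot_rot_arc]

theorem Iso.isInner (f : S.Iso T) {d : S.Dart} (h : S.IsInner d) : T.IsInner (f.toEquiv d) := by
  intro j hj
  have h1 := h j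
  rcases (vertexRel_arc_iff _).1 hj with hj | hj | hj
  · rw [← f.map_arc] at hj
    exact h1 ((vertexRel_arc_iff _).2 (Or.inl (f.toEquiv.injective hj)))
  · rw [← f.map_arc, ← f.map_rot] at hj
    exact h1 ((vertexRel_arc_iff _).2 (Or.inr (Or.inl (f.toEquiv.injective hj))))
  · rw [← f.map_strandStart] at hj
    exact h1 ((vertexRel_arc_iff _).2 (Or.inr (Or.inr (f.toEquiv.injective hj))))

theorem Iso.ahead (f : S.Iso T) {x : S.Dart} {a : Fin (2 * n)} {m : ℕ} (h : S.Ahead x a m) :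
    T.Ahead (f.toEquiv x) a m := by
  induction h with
  | finish h => exact .finish (by rw [← f.map_flip, h, f.map_strandStart])
  | step h _ ih =>
    rw [f.map_rot, f.map_rot, f.map_flip] at ih
    have := f.isInner h
    rw [f.map_flip] at this
    exact .step this ih

end StrandDiagram

theorem val_finRotate_pow {m : ℕ} (k : ℕ) (i : Fin m) :
    ((finRotate m ^ k) i).val = (i.val + k) % m := by
  induction k with
  | zero => simp [Nat.mod_eq_of_lt i.isLt]
  | succ k ih =>
    rw [pow_succ', Equiv.Perm.mul_apply, val_finRotate, ih, ← add_assoc, ← Nat.mod_add_mod (i.val + k)]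
    have := Nat.mod_lt (i.val + k) i.pos
    split_ifs with h
    · rw [h, Nat.mod_self]
    · exact (Nat.mod_eq_of_lt (by omega)).symm

namespace PointMatching

open BoundedMap DiskDrawing

variable {n : ℕ}

/-- The matching with relabelled points. -/
def relabel (τ : PointMatching n) (P : Equiv.Perm (Fin (2 * n))) : PointMatching n where
  partner i := P (τ.partner (P.symm i))
  partner_partner i := by rw [P.symm_apply_apply, τ.partner_partner, P.apply_symm_apply]
  partner_ne i h := τ.partner_ne (P.symm i) (P.symm_apply_eq.2 h.symm).symm

variable {τ : PointMatching n}

theorem relabel_partner (P : Equiv.Perm (Fin (2 * n))) (i : Fin (2 * n)) :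
    (τ.relabel P).partner (P i) = P (τ.partner i) :=
  congrArg (fun j => P (τ.partner j)) (P.symm_apply_apply i)

theorem relabel_isDiagramOf {P : Equiv.Perm (Fin (2 * n))}
    {hP : ∀ i, P (finRotate _ i) = finRotate _ (P i)} {S : StrandDiagram n}
    (h : S.IsDiagramOf (τ.relabel P)) : (S.relabel P hP).IsDiagramOf τ := fun j k => by
  refine (relabel_strandRel (hP := hP)).trans ((h (P j) (P k)).trans ?_)
  rw [relabel_partner, P.injective.eq_iff, P.injective.eq_iff]

theorem gridDrawing_ahead_lt {x : τ.GridDart} {e : Fin (2 * n)} (he : τ.Cr x.1.1 e)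
    (h : τ.rank x.1.1 x.1.2 < τ.rank x.1.1 e) {m l : ℕ}
    (hm : τ.gridDrawing.Ahead (Sum.inr x) x.1.1 m)
    (hl : τ.gridDrawing.Ahead (Sum.inr ⟨(x.1.1, e), Or.inr he⟩) x.1.1 l) : l < m := by
  induction x using GridDart.induction generalizing m with
  | last x hx =>
    rcases x.next_spec with ⟨h1, -⟩ | ⟨-, h1⟩
    · exact absurd hx h1.ne_partner
    · exact absurd (Or.inr h) (h1 e he)
  | step x hx ih =>
    obtain ⟨m', hm'⟩ := gridDrawing_toward (τ := τ) ⟨(x.1.1, x.next), Or.inr hx⟩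
    have hs : τ.gridDrawing.Ahead (Sum.inr x) x.1.1 (m' + 1) := by
      refine .step (gridDrawing_isInner_iff.2 hx.rot.rot) ?_
      have : τ.gridMap.rot (τ.gridMap.rot (τ.gridMap.flip (Sum.inr x))) =
          Sum.inr ⟨(x.1.1, x.next), Or.inr hx⟩ := by
        rw [gridMap_flip_of_next hx]
        exact gridMap_rot_four hx
      exact this ▸ hm'
    rw [(hm.unique hs).2]
    by_cases hne : x.next = e
    · subst hne
      rw [(hl.unique hm').2]
      exact Nat.lt_succ_self _
    · refine (ih he ?_ hm' hl).trans (Nat.lt_succ_self _)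
      rcases x.next_spec with ⟨-, -, h1⟩ | ⟨h1, -⟩
      · exact lt_of_le_of_ne (h1 e he (Or.inr h)) fun h2 => hne (rank_injective _ h2)
      · exact absurd h1 hx.ne_partner

theorem isNoncrossing_of_unique {S : StrandDiagram n}
    (h : ∀ T : StrandDiagram n, T.IsDiagramOf τ → Nonempty (S.Iso T)) : τ.IsNoncrossing 3 := by
  rintro ⟨L, hL, h1, h2⟩
  obtain ⟨i, j, k, hi, hj, hk, hij, hjk⟩ : ∃ i j k, i ∈ L ∧ j ∈ L ∧ k ∈ L ∧ i < j ∧ j < k :=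
    ⟨_, _, _, L.orderEmbOfFin_mem hL 0, L.orderEmbOfFin_mem hL 1, L.orderEmbOfFin_mem hL 2,
      (L.orderEmbOfFin hL).strictMono (by decide), (L.orderEmbOfFin hL).strictMono (by decide)⟩
  have hi1 := h1 i hi
  have hj1 := h1 j hj
  have hk1 := h1 k hk
  obtain ⟨hij1, hij2⟩ := h2 i hi j hj hij
  obtain ⟨hik1, hik2⟩ := h2 i hi k hk (hij.trans hjk)
  obtain ⟨-, hjk2⟩ := h2 j hj k hk hjk
  -- The numbering is rotated so that `i` becomes the last point. The chords of `j` and `k` then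
  -- start before the chord of `i` and end under it, instead of starting under it.
  let P : Equiv.Perm (Fin (2 * n)) := finRotate _ ^ (2 * n - 1 - i.val)
  have hP : ∀ i, P (finRotate _ i) = finRotate _ (P i) := fun i => by
    simp only [P, ← Equiv.Perm.mul_apply]
    rw [← pow_succ, ← pow_succ']
  have hPi : (P i).val = 2 * n - 1 := by
    have := i.isLt
    rw [val_finRotate_pow, Nat.mod_eq_of_lt (by omega)]
    omega
  have hPx : ∀ x, i < x → (P x).val = x.val - i.val - 1 := fun x hx => by
    have := x.isLt
    have hx : i.val < x.val := hx
    rw [val_finRotate_pow, show x.val + (2 * n - 1 - i.val) = x.val - i.val - 1 + 2 * n by omega,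
      Nat.add_mod_right, Nat.mod_eq_of_lt (by omega)]
  have hPj := hPx j hij
  have hPk := hPx k (hij.trans hjk)
  have hPi' := hPx _ hi1
  have hPj' := hPx _ (hij.trans hj1)
  have hPk' := hPx _ ((hij.trans hjk).trans hk1)
  obtain ⟨f⟩ := h _ gridDiagram_isDiagramOf
  obtain ⟨g⟩ := h _ (relabel_isDiagramOf (hP := hP) (gridDiagram_isDiagramOf (τ := τ.relabel P)))
  let φ := f.symm.trans g
  have hlt : τ.partner (τ.partner i) < τ.partner i := by rwa [τ.partner_partner]
  have hlt' : P (τ.partner i) < (τ.relabel P).partner (P (τ.partner i)) := by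
    rw [relabel_partner, τ.partner_partner, Fin.lt_def, hPi']
    have := (τ.partner i).isLt
    omega
  have hCj : τ.Cr (τ.partner i) j := by
    rw [cr_iff_of_lt hlt, τ.partner_partner]
    exact ⟨hij, hij1, Or.inr hij2⟩
  have hCk : τ.Cr (τ.partner i) k := by
    rw [cr_iff_of_lt hlt, τ.partner_partner]
    exact ⟨hij.trans hjk, hik1, Or.inr hik2⟩
  -- Both chords start under the chord of `i`, so its horizontal part meets them from left to right,
  -- `j` before `k`.
  have hr : τ.rank (τ.partner i) j < τ.rank (τ.partner i) k := by
    simp only [rank, if_pos hlt, key, if_pos hj1, if_pos hk1]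
    -- Both keys carry the same shift by `2 n`.
    have : j.val < k.val := hjk
    omega
  -- Now both chords end under the chord of `i`. The strand runs down its vertical part and meets
  -- the higher right end first, so `k` comes before `j`.
  have hr' : (τ.relabel P).rank (P (τ.partner i)) (P k) <
      (τ.relabel P).rank (P (τ.partner i)) (P j) := by
    have h3 : ¬ P (τ.partner j) < P j := by
      have : j.val < (τ.partner j).val := hj1
      rw [Fin.lt_def, hPj, hPj']
      omega
    have h4 : ¬ P (τ.partner k) < P k := by
      have : k.val < (τ.partner k).val := hk1
      rw [Fin.lt_def, hPk, hPk']
      omega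
    simp only [rank, key, relabel_partner, τ.partner_partner, if_neg h3,
      if_neg h4, hPj', hPk']
    have h5 : (τ.partner j).val < (τ.partner k).val := hjk2
    have h6 : i.val < (τ.partner j).val := hij.trans hj1
    omega
  -- An isomorphism preserves the ends of both strands at a crossing, which identifies the crossing,
  -- and the number of crossings ahead.
  have hφ : ∀ c, ∀ hc : τ.Cr (τ.partner i) c, ∀ m,
      τ.gridDrawing.Ahead (Sum.inr ⟨(τ.partner i, c), Or.inr hc⟩) (τ.partner i) m →
      ∃ hc' : (τ.relabel P).Cr (P (τ.partner i)) (P c), (τ.relabel P).gridDrawing.Ahead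
        (Sum.inr ⟨(P (τ.partner i), P c), Or.inr hc'⟩) (P (τ.partner i)) m := by
    intro c hc m hm
    have h3 := relabel_ahead (hP := hP) (φ.ahead hm)
    have h4 := relabel_isInner (hP := hP) |>.1 (φ.isInner (gridDrawing_isInner_iff (x := ⟨(_, c), Or.inr hc⟩).2 hc))
    obtain ⟨y, hy, e⟩ := exists_of_forall_not_vertexRel h4
    rw [e] at h3
    have h5 := gridDrawing_toward (τ := τ.relabel P) y
    obtain ⟨m1, hm1⟩ := gridDrawing_toward (τ := τ) ⟨(c, _), Or.inr hc.rot⟩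
    have h6 := relabel_ahead (hP := hP) (φ.ahead hm1)
    obtain ⟨m2, hm2⟩ := gridDrawing_toward (τ := τ.relabel P) (y.rot hy)
    have h7 : φ.toEquiv (Sum.inr ⟨(c, _), Or.inr hc.rot⟩) = Sum.inr (y.rot hy) := by
      have h8 := φ.map_rot (Sum.inr ⟨(τ.partner i, c), Or.inr hc⟩)
      rw [e] at h8
      refine (congrArg φ.toEquiv ?_).trans (h8.trans (gridMap_rot_of_cr hy))
      exact (gridMap_rot_of_cr (x := ⟨(τ.partner i, c), Or.inr hc⟩) hc).symm
    rw [h7] at h6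
    obtain ⟨m3, hm3⟩ := h5
    have e1 : y.1.1 = P (τ.partner i) := (hm3.unique h3).1
    have e2 : y.1.2 = P c := (hm2.unique h6).1
    have hc' := hy
    rw [e1, e2] at hc'
    refine ⟨hc', ?_⟩
    have e3 : y = ⟨(P (τ.partner i), P c), Or.inr hc'⟩ := Subtype.ext (Prod.ext e1 e2)
    rwa [e3] at h3
  obtain ⟨mj, hmj⟩ := gridDrawing_toward (τ := τ) ⟨(_, j), Or.inr hCj⟩
  obtain ⟨mk, hmk⟩ := gridDrawing_toward (τ := τ) ⟨(_, k), Or.inr hCk⟩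
  have h3 := gridDrawing_ahead_lt hCk hr hmj hmk
  obtain ⟨hCj', hmj'⟩ := hφ j hCj mj hmj
  obtain ⟨hCk', hmk'⟩ := hφ k hCk mk hmk
  have h4 := gridDrawing_ahead_lt hCj' hr' hmk' hmj'
  omega

end PointMatching

/-! ### A reduced network has no closed wires and is connected. -/

namespace CactusNetwork

open BoundedMap

variable {n : ℕ} {N : CactusNetwork n}

theorem wireRel_flip (d : N.Dart) (s : Bool) : N.wireRel (d, s) (N.map.flip d, s) :=
  Relation.EqvGen.rel _ _ (Or.inl ⟨d, s, rfl, rfl⟩)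

theorem wireRel_rot {d : N.Dart} (h : ∀ i, d ≠ N.arc i) :
    N.wireRel (d, true) (N.map.rot d, false) :=
  Relation.EqvGen.rel _ _ (Or.inr ⟨d, h, rfl, rfl⟩)

theorem exists_wireEnd_true (i : Fin n) : ∃ j, N.wireEnd j = (N.arc i, true) := by
  refine ⟨⟨2 * (finRotate n i).val, by have := (finRotate n i).isLt; omega⟩, ?_⟩
  have h : (⟨2 * (finRotate n i).val / 2, by have := (finRotate n i).isLt; omega⟩ : Fin n) =
      finRotate n i := Fin.ext (by simp)
  simp only [wireEnd, h, Equiv.symm_apply_apply]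
  simp

theorem exists_wireEnd_false (i : Fin n) : ∃ j, N.wireEnd j = (N.arc i, false) := by
  refine ⟨⟨2 * i.val + 1, by have := i.isLt; omega⟩, ?_⟩
  have h : (⟨(2 * i.val + 1) / 2, by have := i.isLt; omega⟩ : Fin n) = i := Fin.ext (by simp; omega)
  simp only [wireEnd, h]
  rw [if_neg (by omega)]

theorem exists_arc_wireEnd (j : Fin (2 * n)) : ∃ i s, N.wireEnd j = (N.arc i, s) := by
  simp only [wireEnd]
  split_ifs
  · exact ⟨_, _, rfl⟩
  · exact ⟨_, _, rfl⟩

open scoped Classical in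
/-- A closed wire separates the faces, so that it meets any other wire an even number of times. -/
theorem exists_potential_of_wire {B : N.Dart × Bool → Prop}
    (hB : ∀ x y, N.wireRel x y → (B x ↔ B y)) (h0 : ∀ i s, ¬ B (N.arc i, s)) :
    ∃ g : N.Dart → ZMod 2, (∀ d, g (N.map.faceNext d) = g d) ∧ (∀ i, g (N.arc i) = 0) ∧
      ∀ d, g d + g (N.map.flip d) =
        (if B (d, true) then 1 else 0) + if B (d, false) then 1 else 0 := by
  have := N.finite
  have := Fintype.ofFinite N.Dart
  obtain ⟨g, h1, h2⟩ := N.planar.exists_face_potential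
    (fun d => (if B (d, true) then 1 else 0) + if B (d, false) then 1 else 0)
    (fun d => by
      congr 1
      · exact if_congr (hB _ _ (wireRel_flip d _)).symm rfl rfl
      · exact if_congr (hB _ _ (wireRel_flip d _)).symm rfl rfl)
    (fun d => by
      -- The edges crossed by the wire are counted with multiplicity. At a vertex they pair up,
      -- since through the angle between `x` and `rot x` the wire goes from one edge to the other;
      -- the wire does not meet the arcs.
      rw [Finset.sum_add_distrib]
      have h3 : ∑ x ∈ Finset.univ.filter (fun x => N.map.vertexRel d x),
            (if B (x, false) then (1 : ZMod 2) else 0) =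
          ∑ x ∈ Finset.univ.filter (fun x => N.map.vertexRel d x),
            if B (N.map.rot x, false) then (1 : ZMod 2) else 0 := by
        refine (Finset.sum_bijective _ N.map.rot.bijective (fun x => ?_) fun x _ => rfl).symm
        simp only [Finset.mem_filter, Finset.mem_univ, true_and]
        exact ⟨fun h => Setoid.trans' _ h (N.map.vertexRel_rot x),
          fun h => Setoid.trans' _ h (Setoid.symm' _ (N.map.vertexRel_rot x))⟩
      rw [h3, ← Finset.sum_add_distrib]
      refine Finset.sum_eq_zero fun x _ => ?_
      by_cases hx : ∃ i, x = N.arc i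
      · obtain ⟨i, rfl⟩ := hx
        rw [if_neg (h0 i true), if_neg, add_zero]
        rw [N.rot_arc, ← hB _ _ (wireRel_flip _ _)]
        exact h0 _ _
      · push Not at hx
        rw [if_congr (hB _ _ (wireRel_rot hx)) rfl rfl]
        exact CharTwo.add_self_eq_zero _)
  have h3 : ∀ i j, g (N.arc i) = g (N.arc j) :=
    eq_of_finRotate_invariant fun i => by rw [← N.faceNext_arc, h1]
  by_cases hn : Nonempty (Fin n)
  · obtain ⟨i0⟩ := hn
    refine ⟨fun d => g d + g (N.arc i0), fun d => by beta_reduce; rw [h1], fun i => ?_,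
      fun d => ?_⟩
    · beta_reduce
      rw [h3 i i0]
      exact CharTwo.add_self_eq_zero _
    · beta_reduce
      rw [← h2, add_add_add_comm, CharTwo.add_self_eq_zero, add_zero]
  · exact ⟨g, h1, fun i => (hn ⟨i⟩).elim, h2⟩

/-- In a reduced network every wire ends on the boundary. -/
theorem IsReduced.exists_wireEnd (hN : N.IsReduced) (x : N.Dart × Bool) :
    ∃ j, N.wireRel (N.wireEnd j) x := by
  classical
  have := N.finite
  have := Fintype.ofFinite N.Dart
  by_contra hx
  push Not at hx
  obtain ⟨d, s⟩ := x
  have h0 : ∀ i t, ¬ N.wireRel (d, s) (N.arc i, t) := by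
    intro i t h
    cases t
    · obtain ⟨j, hj⟩ := exists_wireEnd_false (N := N) i
      exact hx j (hj ▸ Setoid.symm' _ h)
    · obtain ⟨j, hj⟩ := exists_wireEnd_true (N := N) i
      exact hx j (hj ▸ Setoid.symm' _ h)
  have h0' : ∀ e t, N.IsArc e → ¬ N.wireRel (d, s) (e, t) := by
    rintro e t ⟨i, rfl | rfl⟩ h
    · exact h0 i t h
    · exact h0 i t (Setoid.trans' _ h (Setoid.symm' _ (wireRel_flip _ _)))
  have hd : ¬ N.IsArc d := fun h => h0' d s h (Setoid.refl' _ _)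
  have hself : ∀ e t, N.wireRel (d, s) (e, t) → ¬ N.wireRel (d, s) (e, !t) := by
    intro e t h h'
    have he : ¬ N.IsArc e := fun he => h0' e t he h
    have h3 := Setoid.trans' _ (Setoid.symm' _ h) h'
    cases t
    · exact hN.1 e he (Setoid.symm' _ h3)
    · exact hN.1 e he h3
  let A : N.Dart × Bool → Prop := fun y => N.wireRel (d, !s) y
  have hA : ∀ x y, N.wireRel x y → (A x ↔ A y) := fun x y h =>
    ⟨fun h' => Setoid.trans' _ h' h, fun h' => Setoid.trans' _ h' (Setoid.symm' _ h)⟩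
  have hAB : ∀ y, A y → ¬ N.wireRel (d, s) y := fun y h h' =>
    hself d s (Setoid.refl' _ _) (Setoid.trans' _ h' (Setoid.symm' _ h))
  obtain ⟨g, h1, h2, h3⟩ := exists_potential_of_wire (B := fun y => N.wireRel (d, s) y)
    (fun x y h => ⟨fun h' => Setoid.trans' _ h' h,
      fun h' => Setoid.trans' _ h' (Setoid.symm' _ h)⟩) h0
  -- The parity with which an edge is crossed by the wire `A`, the other wire at the edge of `d`.
  let a : N.Dart → ZMod 2 := fun e => (if A (e, true) then 1 else 0) + if A (e, false) then 1 else 0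
  have haf : ∀ e, a (N.map.flip e) = a e := fun e => by
    simp only [a, ← if_congr (hA _ _ (wireRel_flip e _)) rfl rfl]
  -- Along `A` each angle contributes the potential of its face twice; if `A` ends on the boundary,
  -- the missing contributions are zero, because the potential vanishes outside.
  have hsum : ∑ e, a e * g e = 0 := by
    simp only [a, add_mul, Finset.sum_add_distrib]
    have h4 : ∑ e, (if A (e, false) then (1 : ZMod 2) else 0) * g e =
        ∑ e, (if A (N.map.rot e, false) then (1 : ZMod 2) else 0) * g e := by
      rw [← Equiv.sum_comp N.map.flip, ← Equiv.sum_comp N.map.rot]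
      refine Finset.sum_congr rfl fun e _ => ?_
      congr 1
      · exact if_congr (hA _ _ (wireRel_flip _ _)).symm rfl rfl
      · rw [← h1, DartMap.faceNext_flip_rot]
    rw [h4, ← Finset.sum_add_distrib]
    refine Finset.sum_eq_zero fun e _ => ?_
    by_cases he : ∃ i, e = N.arc i
    · obtain ⟨i, rfl⟩ := he
      rw [h2, mul_zero, mul_zero, add_zero]
    · push Not at he
      rw [if_congr (hA _ _ (wireRel_rot he)) rfl rfl]
      exact CharTwo.add_self_eq_zero _
  -- By reducedness the two wires meet only at the edge of `d`, so across any other edge that counts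
  -- for `A` the potential is unchanged.
  have hcross : ∀ e, e ≠ d → e ≠ N.map.flip d → a e * (g e + g (N.map.flip e)) = 0 := by
    intro e he1 he2
    by_contra hne
    rw [h3] at hne
    have h4 : ∀ t, A (e, t) → ¬ N.wireRel (d, s) (e, !t) := by
      intro t ht hB
      have he : ¬ N.IsArc e := fun he => h0' e _ he hB
      have h5 : e = d ∨ e = N.map.flip d := by
        cases s
        · refine hN.2 d e t hd he ht hB
        · exact hN.2 d e (!t) hd he hB (by simpa [A] using ht)
      rcases h5 with h5 | h5
      · exact he1 h5
      · exact he2 h5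
    simp only [a] at hne
    have h5 := h4 true
    have h6 := h4 false
    have h7 := hAB (e, true)
    have h8 := hAB (e, false)
    simp only [Bool.not_true, Bool.not_false] at h5 h6
    by_cases b1 : A (e, true) <;> by_cases b2 : A (e, false) <;> simp_all
  have hne : N.map.flip d ≠ d := N.map.flip_ne d
  have hrest : ∑ e ∈ (Finset.univ.erase d).erase (N.map.flip d), a e * g e = 0 := by
    refine Finset.sum_involution (fun e _ => N.map.flip e) (fun e he => ?_) (fun e _ _ => N.map.flip_ne e)
      (fun e he => ?_) (fun e _ => N.map.flip_flip e)
    · simp only [Finset.mem_erase, Finset.mem_univ, and_true] at he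
      rw [haf, ← mul_add]
      exact hcross e he.2 he.1
    · simp only [Finset.mem_erase, Finset.mem_univ, and_true] at he ⊢
      refine ⟨fun h => he.2 (N.map.flip.injective h), fun h => he.1 ?_⟩
      rw [← h, N.map.flip_flip]
  -- All edges but that of `d` cancel. The single crossing there would change the potential an odd
  -- number of times, but the total change is even.
  rw [← Finset.add_sum_erase _ _ (Finset.mem_univ d), ← Finset.add_sum_erase _ _
    (Finset.mem_erase.2 ⟨hne, Finset.mem_univ _⟩), hrest, add_zero, haf, ← mul_add, h3] at hsum
  have h4 : A (d, !s) := Setoid.refl' _ _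
  have h5 := hself d s (Setoid.refl' _ _)
  have h6 : ¬ A (d, s) := fun h => hAB _ h (Setoid.refl' _ _)
  have h7 : N.wireRel (d, s) (d, s) := Setoid.refl' _ _
  cases s <;> simp_all [a]

end CactusNetwork

namespace CactusNetwork

open BoundedMap

variable {n : ℕ} {N : CactusNetwork n}

theorem componentRel_of_wireRel {x y : N.Dart × Bool} (h : N.wireRel x y) :
    N.map.componentRel x.1 y.1 := by
  induction h with
  | refl x => exact Setoid.refl' _ _
  | symm x y _ ih => exact Setoid.symm' _ ih
  | trans x y z _ _ h1 h2 => exact Setoid.trans' _ h1 h2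
  | rel x y h =>
    rcases h with ⟨d, s, rfl, rfl⟩ | ⟨d, -, rfl, rfl⟩
    · exact N.map.componentRel_flip _
    · exact N.map.componentRel_rot _

/-- A wire stays in one component and, not being closed, reaches an arc; the arcs form a single
walk. -/
theorem IsReduced.componentRel (hN : N.IsReduced) (d e : N.Dart) : N.map.componentRel d e := by
  have h1 : ∀ i j, Quotient.mk N.map.componentRel (N.arc i) = Quotient.mk _ (N.arc j) :=
    eq_of_finRotate_invariant fun i => by
      rw [← N.faceNext_arc]
      exact Quotient.sound (N.map.componentRel_faceNext _)
  have h2 : ∀ d, ∃ i, N.map.componentRel (N.arc i) d := fun d => by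
    obtain ⟨j, hj⟩ := hN.exists_wireEnd (d, true)
    obtain ⟨i, s, hi⟩ := exists_arc_wireEnd (N := N) j
    rw [hi] at hj
    exact ⟨i, componentRel_of_wireRel hj⟩
  obtain ⟨i, hi⟩ := h2 d
  obtain ⟨j, hj⟩ := h2 e
  exact Setoid.trans' _ (Setoid.symm' _ hi) (Setoid.trans' _ (Quotient.exact (h1 i j)) hj)

/-- The faces of a connected network are its boundary walks. -/
theorem face_eq_iff (hc : ∀ d e, N.map.componentRel d e) (d e : N.Dart) :
    N.face d = N.face e ↔ N.map.walkRel d e := by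
  have := N.finite
  have := N.finite_face
  let F : Quotient N.map.walkRel → N.Face :=
    Quotient.lift N.face fun x y h => h.apply_eq_of_invariant N.face_faceNext
  -- A face without a boundary walk would be isolated in the incidence graph of faces and
  -- components, which is connected.
  have hsurj : Function.Surjective F := by
    intro f
    have key : ∀ x y : N.Dart ⊕ N.Face, Relation.EqvGen
        (fun x y => (∃ d e, N.map.componentRel d e ∧ x = Sum.inl d ∧ y = Sum.inl e) ∨
        ∃ d, x = Sum.inl d ∧ y = Sum.inr (N.face d)) x y →
        (∀ d, N.face d ≠ f) → (x = Sum.inr f ↔ y = Sum.inr f) := by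
      intro x y h hf
      induction h with
      | refl x => rfl
      | symm x y _ ih => exact ih.symm
      | trans x y z _ _ h1 h2 => exact h1.trans h2
      | rel x y h =>
        rcases h with ⟨d, e, -, rfl, rfl⟩ | ⟨d, rfl, rfl⟩
        · simp
        · simp [hf d]
    by_contra hf
    have := (key (Sum.inr f) (Sum.inl d) (N.faces_connected _ _) fun x hx =>
      hf ⟨Quotient.mk _ x, hx⟩).1 rfl
    cases this
  -- For a single component the tree condition says that there are as many walks as faces.
  have hcard : Nat.card (Quotient N.map.walkRel) = Nat.card N.Face := by
    have h1 := N.faces_tree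
    have h2 : Nat.card (Quotient N.map.componentRel) = 1 := by
      rw [Nat.card_eq_one_iff_unique]
      refine ⟨⟨fun a b => ?_⟩, ⟨Quotient.mk _ d⟩⟩
      induction a using Quotient.inductionOn
      induction b using Quotient.inductionOn
      exact Quotient.sound (hc _ _)
    omega
  have hinj : Function.Injective F :=
    ((Nat.bijective_iff_surjective_and_card F).2 ⟨hsurj, hcard⟩).1
  exact ⟨fun h => Quotient.exact (hinj (a₁ := Quotient.mk _ d) (a₂ := Quotient.mk _ e) h),
    fun h => h.apply_eq_of_invariant N.face_faceNext⟩

end CactusNetwork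

/-! ### The medial graph of a reduced network is a strand diagram. -/

theorem Equiv.Perm.setOf_sameCycle_of_semiconj {α β : Type*} [Finite α] {f : Equiv.Perm α}
    {g : Equiv.Perm β} [Finite β] {φ : α → β} {x : α}
    (h : ∀ y, g.SameCycle (φ x) (φ y) → g (φ y) = φ (f y)) :
    {z | g.SameCycle (φ x) z} = φ '' {y | f.SameCycle x y} := by
  have key : ∀ k : ℕ, (g ^ k) (φ x) = φ ((f ^ k) x) := by
    intro k
    induction k with
    | zero => rfl
    | succ k ih =>
      rw [pow_succ', pow_succ', Equiv.Perm.mul_apply, Equiv.Perm.mul_apply, ih]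
      refine h _ ?_
      rw [← ih]
      exact ⟨k, by simp⟩
  ext z
  simp only [Set.mem_ofPred_eq, Set.mem_image]
  constructor
  · intro hz
    obtain ⟨k, -, hk⟩ := hz.exists_pow_eq'
    exact ⟨(f ^ k) x, ⟨k, by simp⟩, by rw [← hk, key]⟩
  · rintro ⟨y, hy, rfl⟩
    obtain ⟨k, -, hk⟩ := hy.exists_pow_eq'
    exact ⟨k, by rw [zpow_natCast, key, hk]⟩

namespace CactusNetwork

open BoundedMap

variable {n : ℕ} (N : CactusNetwork n)

/-- The darts of the medial graph, which include those of the boundary circle. The four darts at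
the medial vertex on an edge with a dart `d` are `(d, true)`, which runs along the angle on the
left of `d`, `(d, false)` along the angle on its right, and the same for `flip d`. An arc has two
medial vertices, the one on the side of the dart `d` having an additional dart `Sum.inr d` towards
the other one. -/
abbrev MedialDart : Type := (N.Dart × Bool) ⊕ {d : N.Dart // N.IsArc d}

open scoped Classical in
/-- The rotation system of the medial graph. -/
noncomputable def medialMap : DartMap N.MedialDart where
  rot :=
    { toFun := fun x => match x with
        | Sum.inl (d, true) => Sum.inl (d, false)
        | Sum.inl (d, false) =>
          if h : N.IsArc d then Sum.inr ⟨d, h⟩ else Sum.inl (N.map.flip d, true)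
        | Sum.inr d => Sum.inl (d.1, true)
      invFun := fun x => match x with
        | Sum.inl (d, false) => Sum.inl (d, true)
        | Sum.inl (d, true) =>
          if h : N.IsArc d then Sum.inr ⟨d, h⟩ else Sum.inl (N.map.flip d, false)
        | Sum.inr d => Sum.inl (d.1, false)
      left_inv := by
        rintro (⟨d, _ | _⟩ | d)
        · by_cases h : N.IsArc d
          · simp [h]
          · simp [h, isArc_flip_iff, N.map.flip_flip]
        · rfl
        · simp [d.2]
      right_inv := by
        rintro (⟨d, _ | _⟩ | d)
        · rfl
        · by_cases h : N.IsArc d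
          · simp [h]
          · simp [h, isArc_flip_iff, N.map.flip_flip]
        · simp [d.2] }
  flip := Function.Involutive.toPerm (fun x => match x with
      | Sum.inl (d, true) => Sum.inl (N.map.rot d, false)
      | Sum.inl (d, false) => Sum.inl (N.map.rot⁻¹ d, true)
      | Sum.inr d => Sum.inr ⟨N.map.flip d.1, d.2.flip⟩) (by
    rintro (⟨d, _ | _⟩ | d)
    · simp
    · simp
    · simp [N.map.flip_flip])
  flip_flip := by
    rintro (⟨d, _ | _⟩ | d)
    · simp
    · simp
    · simp [N.map.flip_flip]
  flip_ne := by
    rintro (⟨d, _ | _⟩ | d) h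
    · cases Bool.false_ne_true (congrArg Prod.snd (Sum.inl.inj h)).symm
    · cases Bool.false_ne_true (congrArg Prod.snd (Sum.inl.inj h))
    · exact N.map.flip_ne _ (congrArg Subtype.val (Sum.inr.inj h))

variable {N}

theorem medialMap_rot_true (d : N.Dart) :
    N.medialMap.rot (Sum.inl (d, true)) = Sum.inl (d, false) := rfl

theorem medialMap_rot_false {d : N.Dart} (h : ¬ N.IsArc d) :
    N.medialMap.rot (Sum.inl (d, false)) = Sum.inl (N.map.flip d, true) := dif_neg h

theorem medialMap_rot_false_of_isArc {d : N.Dart} (h : N.IsArc d) :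
    N.medialMap.rot (Sum.inl (d, false)) = Sum.inr ⟨d, h⟩ := dif_pos h

theorem medialMap_rot_inr (d : {d : N.Dart // N.IsArc d}) :
    N.medialMap.rot (Sum.inr d) = Sum.inl (d.1, true) := rfl

theorem medialMap_flip_true (d : N.Dart) :
    N.medialMap.flip (Sum.inl (d, true)) = Sum.inl (N.map.rot d, false) := rfl

theorem medialMap_flip_rot (d : N.Dart) :
    N.medialMap.flip (Sum.inl (N.map.rot d, false)) = Sum.inl (d, true) := by
  rw [← medialMap_flip_true, DartMap.flip_flip]

theorem medialMap_flip_inr (d : {d : N.Dart // N.IsArc d}) :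
    N.medialMap.flip (Sum.inr d) = Sum.inr ⟨N.map.flip d.1, d.2.flip⟩ := rfl

theorem medialMap_faceNext_true (d : N.Dart) :
    N.medialMap.faceNext (Sum.inl (d, true)) = Sum.inl (N.map.rot d, true) := by
  apply N.medialMap.rot.injective
  rw [DartMap.rot_faceNext, medialMap_flip_true, medialMap_rot_true]

theorem medialMap_faceNext_false {d : N.Dart} (h : ¬ N.IsArc (N.map.faceNext d)) :
    N.medialMap.faceNext (Sum.inl (N.map.flip d, false)) =
      Sum.inl (N.map.flip (N.map.faceNext d), false) := by
  apply N.medialMap.rot.injective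
  rw [DartMap.rot_faceNext, medialMap_rot_false (by rwa [isArc_flip_iff]), N.map.flip_flip,
    ← N.map.rot_faceNext, medialMap_flip_rot]

theorem medialMap_faceNext_false_of_isArc {d : N.Dart} (h : N.IsArc (N.map.faceNext d)) :
    N.medialMap.faceNext (Sum.inl (N.map.flip d, false)) = Sum.inr ⟨N.map.faceNext d, h⟩ := by
  apply N.medialMap.rot.injective
  rw [DartMap.rot_faceNext, medialMap_rot_inr, ← N.map.rot_faceNext, medialMap_flip_rot]

theorem medialMap_faceNext_inr (d : {d : N.Dart // N.IsArc d}) :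
    N.medialMap.faceNext (Sum.inr d) = Sum.inl (N.map.flip d.1, false) := by
  apply N.medialMap.rot.injective
  rw [DartMap.rot_faceNext, medialMap_flip_inr, medialMap_rot_false_of_isArc d.2.flip]

/-- The vertex or face of the network that the region on the left of a medial dart belongs to. -/
def medialRegion : N.MedialDart → Quotient N.map.vertexRel ⊕ Quotient N.map.walkRel
  | Sum.inl (d, true) => Sum.inl (Quotient.mk _ d)
  | Sum.inl (d, false) => Sum.inr (Quotient.mk _ (N.map.flip d))
  | Sum.inr d => Sum.inr (Quotient.mk _ d.1)

theorem medialRegion_faceNext (x : N.MedialDart) :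
    medialRegion (N.medialMap.faceNext x) = medialRegion x := by
  rcases x with ⟨d, _ | _⟩ | d
  · obtain ⟨e, rfl⟩ : ∃ e, d = N.map.flip e := ⟨_, (N.map.flip_flip d).symm⟩
    by_cases h : N.IsArc (N.map.faceNext e)
    · rw [medialMap_faceNext_false_of_isArc h]
      refine congrArg Sum.inr (Quotient.sound ?_)
      rw [N.map.flip_flip]
      exact Setoid.symm' _ (N.map.walkRel_faceNext e)
    · rw [medialMap_faceNext_false h]
      refine congrArg Sum.inr (Quotient.sound ?_)
      rw [N.map.flip_flip, N.map.flip_flip]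
      exact Setoid.symm' _ (N.map.walkRel_faceNext e)
  · rw [medialMap_faceNext_true]
    exact congrArg Sum.inl (Quotient.sound (Setoid.symm' _ (N.map.vertexRel_rot d)))
  · rw [medialMap_faceNext_inr]
    refine congrArg Sum.inr (Quotient.sound ?_)
    rw [N.map.flip_flip]

/-- Each vertex and each walk of the network has a region of the medial graph of its own. This lower
bound is all that planarity of the medial graph needs. -/
theorem card_vertex_add_card_walk_le_medial :
    Nat.card (Quotient N.map.vertexRel) + Nat.card (Quotient N.map.walkRel) ≤
      Nat.card (Quotient N.medialMap.walkRel) := by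
  have := N.finite
  rw [← Nat.card_sum]
  refine Nat.card_le_card_of_surjective (Quotient.lift medialRegion fun x y h =>
    h.apply_eq_of_invariant medialRegion_faceNext) ?_
  rintro (q | q)
  · induction q using Quotient.inductionOn with | _ d
    exact ⟨Quotient.mk _ (Sum.inl (d, true)), rfl⟩
  · induction q using Quotient.inductionOn with | _ d
    refine ⟨Quotient.mk _ (Sum.inl (N.map.flip d, false)), congrArg Sum.inr ?_⟩
    rw [N.map.flip_flip]

theorem card_medialDart_le : Nat.card N.MedialDart ≤ 2 * Nat.card N.Dart + 2 * n := by
  have := N.finite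
  have h2 : Nat.card Bool = 2 := by simp
  rw [Nat.card_sum, Nat.card_prod, h2]
  have h1 : Nat.card {d : N.Dart // N.IsArc d} ≤ Nat.card (Fin n × Bool) := by
    refine Nat.card_le_card_of_surjective
      (fun p => ⟨if p.2 then N.arc p.1 else N.map.flip (N.arc p.1), ?_⟩) ?_
    · split_ifs
      · exact isArc_arc _
      · exact isArc_flip_arc _
    · rintro ⟨d, i, rfl | rfl⟩
      · exact ⟨(i, true), rfl⟩
      · exact ⟨(i, false), rfl⟩
  rw [Nat.card_prod, h2, Nat.card_fin] at h1
  omega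

end CactusNetwork

/-- The medial boundary point just before the boundary vertex `i`. -/
def evenPoint {n : ℕ} (i : Fin n) : Fin (2 * n) := ⟨2 * i.val, by omega⟩

/-- The medial boundary point just after the boundary vertex `i`. -/
def oddPoint {n : ℕ} (i : Fin n) : Fin (2 * n) := ⟨2 * i.val + 1, by omega⟩

section

variable {n : ℕ}

theorem point_cases {P : Fin (2 * n) → Prop} (h : ∀ i, P (evenPoint i)) (h' : ∀ i, P (oddPoint i))
    (j : Fin (2 * n)) : P j := by
  have hj := j.isLt
  rcases Nat.mod_two_eq_zero_or_one j.val with h2 | h2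
  · convert h ⟨j.val / 2, by omega⟩
    exact Fin.ext (by simp only [evenPoint]; omega)
  · convert h' ⟨j.val / 2, by omega⟩
    exact Fin.ext (by simp only [oddPoint]; omega)

theorem val_evenPoint (i : Fin n) : (evenPoint i).val = 2 * i.val := rfl

theorem val_oddPoint (i : Fin n) : (oddPoint i).val = 2 * i.val + 1 := rfl

theorem finRotate_evenPoint (i : Fin n) : finRotate _ (evenPoint i) = oddPoint i := by
  have h1 := val_finRotate (evenPoint i)
  rw [val_evenPoint, if_neg (by have := i.isLt; omega)] at h1
  exact Fin.ext h1

theorem finRotate_oddPoint (i : Fin n) : finRotate _ (oddPoint i) = evenPoint (finRotate _ i) := by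
  have h1 := val_finRotate (oddPoint i)
  have h2 := val_finRotate i
  refine Fin.ext ?_
  rw [h1, val_evenPoint, h2, val_oddPoint]
  by_cases h : i.val + 1 = n
  · rw [if_pos h, if_pos (by omega)]
  · rw [if_neg h, if_neg (by omega)]
    ring

variable {α : Type*}

/-- A family indexed by the medial boundary points. -/
def pointElim (f g : Fin n → α) (j : Fin (2 * n)) : α :=
  if j.val % 2 = 0 then f ⟨j.val / 2, by omega⟩ else g ⟨j.val / 2, by omega⟩

theorem pointElim_evenPoint (f g : Fin n → α) (i : Fin n) : pointElim f g (evenPoint i) = f i := by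
  simp [pointElim, evenPoint]

theorem pointElim_oddPoint (f g : Fin n → α) (i : Fin n) : pointElim f g (oddPoint i) = g i := by
  have h : (⟨(2 * i.val + 1) / 2, by omega⟩ : Fin n) = i := Fin.ext (by simp; omega)
  simp only [pointElim, oddPoint, h]
  exact if_neg (by omega)

theorem evenPoint_injective : Function.Injective (evenPoint (n := n)) := fun i j h =>
  Fin.ext (by have := congrArg Fin.val h; simp only [evenPoint] at this; omega)

theorem oddPoint_injective : Function.Injective (oddPoint (n := n)) := fun i j h =>
  Fin.ext (by have := congrArg Fin.val h; simp only [oddPoint] at this; omega)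

end

namespace CactusNetwork

open BoundedMap DiskDrawing

variable {n : ℕ} {N : CactusNetwork n}

theorem wireEnd_evenPoint (i : Fin n) :
    N.wireEnd (evenPoint i) = (N.arc ((finRotate n).symm i), true) :=
  pointElim_evenPoint (fun i => (N.arc ((finRotate n).symm i), true)) (fun i => (N.arc i, false)) i

theorem wireEnd_oddPoint (i : Fin n) : N.wireEnd (oddPoint i) = (N.arc i, false) :=
  pointElim_oddPoint (fun i => (N.arc ((finRotate n).symm i), true)) (fun i => (N.arc i, false)) i

variable (N) in
/-- The boundary arcs of the medial graph. -/
def medialArc : Fin (2 * n) → N.MedialDart :=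
  -- On the inner side of the boundary arc after `evenPoint i` lies the region of boundary vertex
  -- `i`, and on that of the arc after `oddPoint i` the inner face at the network arc `i`.
  pointElim (fun i => Sum.inl (N.map.flip (N.arc ((finRotate n).symm i)), false))
    (fun i => Sum.inr ⟨N.arc i, isArc_arc i⟩)

theorem medialArc_evenPoint (i : Fin n) : N.medialArc (evenPoint i) =
    Sum.inl (N.map.flip (N.arc ((finRotate n).symm i)), false) := pointElim_evenPoint _ _ _

theorem medialArc_oddPoint (i : Fin n) :
    N.medialArc (oddPoint i) = Sum.inr ⟨N.arc i, isArc_arc i⟩ := pointElim_oddPoint _ _ _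

theorem medialMap_rot_three {d : N.Dart} (h : N.IsArc d) :
    N.medialMap.rot (N.medialMap.rot (N.medialMap.rot (Sum.inl (d, false)))) =
      Sum.inl (d, false) := by
  rw [medialMap_rot_false_of_isArc h, medialMap_rot_inr, medialMap_rot_true]

theorem medialMap_rot_four {d : N.Dart} (h : ¬ N.IsArc d) (s : Bool) :
    N.medialMap.rot (N.medialMap.rot (N.medialMap.rot (N.medialMap.rot (Sum.inl (d, s))))) =
      Sum.inl (d, s) := by
  have h' : ¬ N.IsArc (N.map.flip d) := by rwa [isArc_flip_iff]
  cases s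
  · rw [medialMap_rot_false h, medialMap_rot_true, medialMap_rot_false h', medialMap_rot_true,
      N.map.flip_flip]
  · rw [medialMap_rot_true, medialMap_rot_false h, medialMap_rot_true, medialMap_rot_false h',
      N.map.flip_flip]

theorem medialMap_rot_rot {d : N.Dart} (h : ¬ N.IsArc d) (s : Bool) :
    N.medialMap.rot (N.medialMap.rot (Sum.inl (d, s))) = Sum.inl (N.map.flip d, s) := by
  cases s
  · rw [medialMap_rot_false h, medialMap_rot_true]
  · rw [medialMap_rot_true, medialMap_rot_false h]

variable (N) in
/-- The arc, if any, at whose medial vertex a dart departs. -/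
noncomputable def medialEnd : N.MedialDart → Option N.Dart := open scoped Classical in
  Sum.elim (fun p => if N.IsArc p.1 then some p.1 else none) fun d => some d.1

theorem medialEnd_eq_of_vertexRel {x y : N.MedialDart} (h : N.medialMap.vertexRel x y) :
    N.medialEnd x = N.medialEnd y := by
  classical
  refine h.apply_eq_of_invariant (g := N.medialEnd) ?_
  rintro (⟨d, _ | _⟩ | d)
  · by_cases h : N.IsArc d
    · rw [medialMap_rot_false_of_isArc h]
      exact (if_pos h).symm
    · rw [medialMap_rot_false h]
      have h' : ¬ N.IsArc (N.map.flip d) := by rwa [isArc_flip_iff]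
      exact (if_neg h').trans (if_neg h).symm
  · rfl
  · exact if_pos d.2

theorem medialEnd_medialArc_evenPoint (i : Fin n) :
    N.medialEnd (N.medialArc (evenPoint i)) = some (N.map.flip (N.arc ((finRotate n).symm i))) := by
  rw [medialArc_evenPoint]
  exact if_pos (isArc_flip_arc _)

theorem medialEnd_medialArc_oddPoint (i : Fin n) :
    N.medialEnd (N.medialArc (oddPoint i)) = some (N.arc i) := by
  rw [medialArc_oddPoint]
  rfl

theorem medialEnd_medialArc_injective {i j : Fin (2 * n)}
    (h : N.medialEnd (N.medialArc i) = N.medialEnd (N.medialArc j)) : i = j := by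
  induction i using point_cases with
  | h i =>
    induction j using point_cases with
    | h j =>
      rw [medialEnd_medialArc_evenPoint, medialEnd_medialArc_evenPoint] at h
      rw [(finRotate n).symm.injective (N.arc_injective (N.map.flip.injective (Option.some.inj h)))]
    | h' j =>
      rw [medialEnd_medialArc_evenPoint, medialEnd_medialArc_oddPoint] at h
      exact absurd (Option.some.inj h) (N.flip_arc_ne _ _)
  | h' i =>
    induction j using point_cases with
    | h j =>
      rw [medialEnd_medialArc_evenPoint, medialEnd_medialArc_oddPoint] at h
      exact absurd (Option.some.inj h).symm (N.flip_arc_ne _ _)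
    | h' j =>
      rw [medialEnd_medialArc_oddPoint, medialEnd_medialArc_oddPoint] at h
      rw [N.arc_injective (Option.some.inj h)]

/-- The darts at the boundary points of the medial graph. -/
theorem medialMap_vertexRel_medialArc {d : N.Dart} (h : N.IsArc d) : ∃ j, ∀ x : N.MedialDart,
    N.medialEnd x = some d → N.medialMap.vertexRel (N.medialArc j) x := by
  classical
  have h1 : ∀ x, N.medialEnd x = some d → N.medialMap.vertexRel (Sum.inl (d, false)) x ∧
      N.medialMap.vertexRel (Sum.inr ⟨d, h⟩) x := by
    have h2 : N.medialMap.vertexRel (Sum.inl (d, false)) (Sum.inr ⟨d, h⟩) := by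
      rw [← medialMap_rot_false_of_isArc h]
      exact N.medialMap.vertexRel_rot _
    have h3 : N.medialMap.vertexRel (Sum.inr ⟨d, h⟩) (Sum.inl (d, true)) :=
      N.medialMap.vertexRel_rot (Sum.inr ⟨d, h⟩)
    have h4 : ∀ x, N.medialEnd x = some d → N.medialMap.vertexRel (Sum.inl (d, false)) x := by
      rintro (⟨e, s⟩ | e) he
      · by_cases h5 : N.IsArc e
        · obtain rfl : e = d := Option.some.inj ((if_pos h5).symm.trans he)
          cases s
          · exact Setoid.refl' _ _
          · exact Setoid.trans' _ h2 h3
        · cases (if_neg h5).symm.trans he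
      · obtain rfl : e = ⟨d, h⟩ := Subtype.ext (Option.some.inj he)
        exact h2
    exact fun x hx => ⟨h4 x hx, Setoid.trans' _ (Setoid.symm' _ h2) (h4 x hx)⟩
  obtain ⟨i, rfl | rfl⟩ := h
  · exact ⟨oddPoint i, fun x hx => by rw [medialArc_oddPoint]; exact (h1 x hx).2⟩
  · refine ⟨evenPoint (finRotate n i), fun x hx => ?_⟩
    rw [medialArc_evenPoint, Equiv.symm_apply_apply]
    exact (h1 x hx).1

theorem exists_of_forall_not_vertexRel_medialArc {x : N.MedialDart}
    (h : ∀ j, ¬ N.medialMap.vertexRel (N.medialArc j) x) :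
    ∃ d s, ¬ N.IsArc d ∧ x = Sum.inl (d, s) := by
  classical
  rcases x with ⟨d, s⟩ | d
  · refine ⟨d, s, fun hd => ?_, rfl⟩
    obtain ⟨j, hj⟩ := medialMap_vertexRel_medialArc hd
    exact h j (hj _ (if_pos hd))
  · obtain ⟨j, hj⟩ := medialMap_vertexRel_medialArc d.2
    exact (h j (hj _ rfl)).elim

theorem ncard_medialArc_vertex (j : Fin (2 * n)) :
    {x | N.medialMap.vertexRel (N.medialArc j) x}.ncard = 3 := by
  have h1 : ∀ d, N.IsArc d → {x | N.medialMap.vertexRel (Sum.inl (d, false)) x}.ncard = 3 :=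
    fun d hd => by
      refine Equiv.Perm.ncard_sameCycle_three (medialMap_rot_three hd) fun h => ?_
      rw [medialMap_rot_false_of_isArc hd] at h
      cases h
  induction j using point_cases with
  | h i =>
    rw [medialArc_evenPoint]
    exact h1 _ (isArc_flip_arc _)
  | h' i =>
    rw [medialArc_oddPoint, ← h1 _ (isArc_arc i)]
    congr 1
    ext x
    have : N.medialMap.vertexRel (Sum.inl (N.arc i, false)) (Sum.inr ⟨N.arc i, isArc_arc i⟩) := by
      rw [← medialMap_rot_false_of_isArc (isArc_arc i)]
      exact N.medialMap.vertexRel_rot _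
    exact ⟨fun h => Setoid.trans' _ this h, fun h => Setoid.trans' _ (Setoid.symm' _ this) h⟩

theorem ncard_medial_vertex {x : N.MedialDart}
    (h : ∀ j, ¬ N.medialMap.vertexRel (N.medialArc j) x) :
    {y | N.medialMap.vertexRel x y}.ncard = 4 := by
  obtain ⟨d, s, hd, rfl⟩ := exists_of_forall_not_vertexRel_medialArc h
  refine Equiv.Perm.ncard_sameCycle_four (medialMap_rot_four hd s) fun h => ?_
  rw [medialMap_rot_rot hd] at h
  exact N.map.flip_ne _ (congrArg Prod.fst (Sum.inl.inj h))

theorem medialMap_componentRel (hc : ∀ d e, N.map.componentRel d e) (x y : N.MedialDart) :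
    N.medialMap.componentRel x y := by
  have h1 : ∀ d, N.medialMap.componentRel (Sum.inl (d, true)) (Sum.inl (d, false)) := fun d =>
    N.medialMap.componentRel_rot (Sum.inl (d, true))
  have h2 : ∀ d e, N.map.componentRel d e →
      N.medialMap.componentRel (Sum.inl (d, true)) (Sum.inl (e, true)) := by
    intro d e h
    induction h with
    | refl x => exact Setoid.refl' _ _
    | symm x y _ ih => exact Setoid.symm' _ ih
    | trans x y z _ _ h1 h2 => exact Setoid.trans' _ h1 h2
    | rel x y h =>
      rcases h with rfl | rfl
      · rw [← medialMap_faceNext_true]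
        exact Setoid.symm' _ (N.medialMap.componentRel_faceNext _)
      · by_cases hx : N.IsArc x
        · refine Setoid.trans' _ (h1 x) (Setoid.trans' _ (N.medialMap.componentRel_rot _) ?_)
          rw [medialMap_rot_false_of_isArc hx]
          refine Setoid.trans' _ (N.medialMap.componentRel_flip _) ?_
          rw [medialMap_flip_inr]
          exact N.medialMap.componentRel_rot _
        · rw [← medialMap_rot_false hx]
          exact Setoid.trans' _ (h1 x) (N.medialMap.componentRel_rot _)
  have h3 : ∀ x, ∃ d, N.medialMap.componentRel x (Sum.inl (d, true)) := by
    rintro (⟨d, _ | _⟩ | d)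
    · exact ⟨d, Setoid.symm' _ (h1 d)⟩
    · exact ⟨d, Setoid.refl' _ _⟩
    · exact ⟨d.1, N.medialMap.componentRel_rot (Sum.inr d)⟩
  obtain ⟨d, hd⟩ := h3 x
  obtain ⟨e, he⟩ := h3 y
  exact Setoid.trans' _ hd (Setoid.trans' _ (h2 d e (hc d e)) (Setoid.symm' _ he))

theorem medialMap_isPlanar (hn : n ≠ 0) (hc : ∀ d e, N.map.componentRel d e) :
    N.medialMap.IsPlanar := by
  have := N.finite
  have := Fintype.ofFinite N.Dart
  refine DartMap.isPlanar_of_degrees N.medialArc (medialMap_componentRel hc)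
    (fun i j h => medialEnd_medialArc_injective (medialEnd_eq_of_vertexRel h))
    ncard_medialArc_vertex (fun d => ncard_medial_vertex) ?_
  -- Euler's formula for the network gives `4 (V + F) ≥ 2 D + 8`, which matches the at most `2 D + 2
  -- n` medial darts.
  have h1 := N.planar.euler
  have h2 := N.map.card_eq_two_mul_card_edge
  have h3 := card_vertex_add_card_walk_le_medial (N := N)
  have h4 := card_medialDart_le (N := N)
  have h5 : 0 < Nat.card (Quotient N.map.componentRel) :=
    Nat.card_pos_iff.2 ⟨⟨Quotient.mk _ (N.arc ⟨0, Nat.pos_of_ne_zero hn⟩)⟩, inferInstance⟩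
  omega

/-- The medial graph of a connected network as a drawing in a disk. -/
noncomputable def medialDrawing (N : CactusNetwork n) (hn : n ≠ 0)
    (hc : ∀ d e, N.map.componentRel d e) : DiskDrawing n where
  Dart := N.MedialDart
  finite := have := N.finite; inferInstance
  map := N.medialMap
  planar := medialMap_isPlanar hn hc
  arc := N.medialArc
  arc_injective i j h := medialEnd_medialArc_injective (congrArg _ h)
  flip_arc_ne i j := by
    induction i using point_cases with
    | h i =>
      rw [medialArc_evenPoint, ← N.rot_arc, medialMap_flip_rot]
      induction j using point_cases with
      | h j =>
        rw [medialArc_evenPoint]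
        exact fun h => Bool.false_ne_true (congrArg Prod.snd (Sum.inl.inj h)).symm
      | h' j =>
        rw [medialArc_oddPoint]
        exact fun h => by cases h
    | h' i =>
      rw [medialArc_oddPoint, medialMap_flip_inr]
      induction j using point_cases with
      | h j =>
        rw [medialArc_evenPoint]
        exact fun h => by cases h
      | h' j =>
        rw [medialArc_oddPoint]
        exact fun h => N.flip_arc_ne _ _ (congrArg Subtype.val (Sum.inr.inj h))
  faceNext_arc i := by
    induction i using point_cases with
    | h i =>
      have h : N.IsArc (N.map.faceNext (N.arc ((finRotate n).symm i))) := by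
        rw [N.faceNext_arc]; exact isArc_arc _
      rw [finRotate_evenPoint, medialArc_evenPoint, medialArc_oddPoint,
        medialMap_faceNext_false_of_isArc h]
      refine congrArg Sum.inr (Subtype.ext ((N.faceNext_arc _).trans ?_))
      rw [Equiv.apply_symm_apply]
    | h' i =>
      rw [finRotate_oddPoint, medialArc_evenPoint, medialArc_oddPoint, medialMap_faceNext_inr,
        Equiv.symm_apply_apply]
  boundary_degree := ncard_medialArc_vertex
  crossing_degree d := ncard_medial_vertex

end CactusNetwork

namespace CactusNetwork

open BoundedMap DiskDrawing

variable {n : ℕ} {N : CactusNetwork n} {hn : n ≠ 0} {hc : ∀ d e, N.map.componentRel d e}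

theorem medial_isArc_flip_iff {x : N.MedialDart} : (N.medialDrawing hn hc).IsArc
    (N.medialMap.flip x) ↔ (N.medialDrawing hn hc).IsArc x :=
  isArc_flip_iff (B := (N.medialDrawing hn hc).toBoundedMap)

theorem medial_isArc_true_iff {d : N.Dart} :
    (N.medialDrawing hn hc).IsArc (Sum.inl (d, true)) ↔ ∃ i, d = N.arc i := by
  constructor
  · rintro ⟨j, h | h⟩
    · change Sum.inl (d, true) = N.medialArc j at h
      induction j using point_cases with
      | h i =>
        rw [medialArc_evenPoint] at h
        cases Bool.false_ne_true (congrArg Prod.snd (Sum.inl.inj h)).symm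
      | h' i =>
        rw [medialArc_oddPoint] at h
        cases h
    · change Sum.inl (d, true) = N.medialMap.flip (N.medialArc j) at h
      induction j using point_cases with
      | h i =>
        rw [medialArc_evenPoint, ← N.rot_arc, medialMap_flip_rot] at h
        exact ⟨i, congrArg Prod.fst (Sum.inl.inj h)⟩
      | h' i =>
        rw [medialArc_oddPoint] at h
        cases h
  · rintro ⟨i, rfl⟩
    refine ⟨evenPoint i, Or.inr ?_⟩
    change _ = N.medialMap.flip (N.medialArc _)
    rw [medialArc_evenPoint, ← N.rot_arc, medialMap_flip_rot]

theorem medial_isArc_false_iff {d : N.Dart} :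
    (N.medialDrawing hn hc).IsArc (Sum.inl (d, false)) ↔ ∃ i, d = N.map.flip (N.arc i) := by
  refine medial_isArc_flip_iff.symm.trans ?_
  change (N.medialDrawing hn hc).IsArc (Sum.inl (N.map.rot⁻¹ d, true)) ↔ _
  rw [medial_isArc_true_iff]
  constructor
  · rintro ⟨i, h⟩
    exact ⟨_, by rw [← N.rot_arc, ← h]; exact (N.map.rot.apply_symm_apply d).symm⟩
  · rintro ⟨i, rfl⟩
    exact ⟨finRotate _ i, by
      rw [← N.rot_arc_finRotate]; exact N.map.rot.symm_apply_apply _⟩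

theorem medial_isArc_inr (d : {d : N.Dart // N.IsArc d}) :
    (N.medialDrawing hn hc).IsArc (Sum.inr d) := by
  have h : ∀ i, (N.medialDrawing hn hc).IsArc (Sum.inr ⟨N.arc i, isArc_arc i⟩) := fun i =>
    ⟨oddPoint i, Or.inl (medialArc_oddPoint i).symm⟩
  obtain ⟨d, i, rfl | rfl⟩ := d
  · exact h i
  · exact (h i).flip

theorem medial_isInner_iff {d : N.Dart} {s : Bool} :
    (N.medialDrawing hn hc).IsInner (Sum.inl (d, s)) ↔ ¬ N.IsArc d := by
  classical
  constructor
  · intro h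
    obtain ⟨e, t, he, h1⟩ := exists_of_forall_not_vertexRel_medialArc h
    cases h1
    exact he
  · intro h j hj
    have h1 := medialEnd_eq_of_vertexRel hj
    have h2 : N.medialEnd (Sum.inl (d, s)) = none := if_neg h
    induction j using point_cases with
    | h i => cases (medialEnd_medialArc_evenPoint i).symm.trans (h1.trans h2)
    | h' i => cases (medialEnd_medialArc_oddPoint i).symm.trans (h1.trans h2)

theorem medial_strandStart_evenPoint (i : Fin n) : (N.medialDrawing hn hc).strandStart
    (evenPoint i) = Sum.inl (N.map.flip (N.arc ((finRotate n).symm i)), true) := by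
  refine N.medialMap.rot.injective (((N.medialDrawing hn hc).rot_strandStart _).trans ?_)
  exact (medialArc_evenPoint i)

theorem medial_strandStart_oddPoint (i : Fin n) :
    (N.medialDrawing hn hc).strandStart (oddPoint i) = Sum.inl (N.arc i, false) := by
  refine N.medialMap.rot.injective (((N.medialDrawing hn hc).rot_strandStart _).trans ?_)
  rw [medialMap_rot_false_of_isArc (isArc_arc i)]
  exact (medialArc_oddPoint i)

theorem wireRel_of_medial_strandRel {x y : N.MedialDart}
    (h : (N.medialDrawing hn hc).strandRel x y) :
    Sum.map (Quotient.mk N.wireRel) id x = Sum.map (Quotient.mk N.wireRel) id y := by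
  induction h with
  | refl x => rfl
  | symm x y _ ih => exact ih.symm
  | trans x y z _ _ h1 h2 => exact h1.trans h2
  | rel x y h =>
    have key : ∀ d : N.Dart, (∀ i, d ≠ N.arc i) →
        Sum.map (Quotient.mk N.wireRel) (id : {d : N.Dart // N.IsArc d} → _) (Sum.inl (d, true)) =
          Sum.map (Quotient.mk N.wireRel) id (Sum.inl (N.map.rot d, false)) := fun d hd =>
      congrArg Sum.inl (Quotient.sound (wireRel_rot hd))
    rcases h with ⟨h, rfl⟩ | ⟨h, rfl⟩
    · rcases x with ⟨d, _ | _⟩ | d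
      · replace h := mt medial_isArc_flip_iff.1 h
        obtain ⟨e, rfl⟩ : ∃ e, d = N.map.rot e := ⟨_, (N.map.rot.apply_symm_apply d).symm⟩
        have h1 : (N.medialDrawing hn hc).map.flip (Sum.inl (N.map.rot e, false)) =
          Sum.inl (e, true) := medialMap_flip_rot e
        rw [h1]
        rw [medialMap_flip_rot, medial_isArc_true_iff, not_exists] at h
        exact (key e h).symm
      · rw [medial_isArc_true_iff, not_exists] at h
        exact key d h
      · exact absurd (medial_isArc_inr d) h
    · obtain ⟨d, s, hd, rfl⟩ := exists_of_forall_not_vertexRel_medialArc h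
      have h1 : (N.medialDrawing hn hc).map.rot ((N.medialDrawing hn hc).map.rot
        (Sum.inl (d, s))) = Sum.inl (N.map.flip d, s) := medialMap_rot_rot hd s
      rw [h1]
      exact congrArg Sum.inl (Quotient.sound (wireRel_flip d s))

theorem wireRel_of_medial_strandRel_inl {x y : N.Dart × Bool}
    (h : (N.medialDrawing hn hc).strandRel (Sum.inl x) (Sum.inl y)) : N.wireRel x y :=
  Quotient.exact (Sum.inl.inj (wireRel_of_medial_strandRel h))

variable (hn hc) in
open scoped Classical in
/-- The medial dart along a wire, where wires on the arcs are represented by their ends. -/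
noncomputable def wireDart (x : N.Dart × Bool) : N.MedialDart :=
  if (N.medialDrawing hn hc).IsArc (Sum.inl x) then Sum.inl (N.map.flip x.1, x.2) else Sum.inl x

theorem wireDart_of_not_isArc {x : N.Dart × Bool}
    (h : ¬ (N.medialDrawing hn hc).IsArc (Sum.inl x)) : N.wireDart hn hc x = Sum.inl x := if_neg h

/-- The two darts of an arc name the same end of a wire, and exactly one of the corresponding medial
darts is off the boundary circle. -/
theorem wireDart_arc (i : Fin n) (s : Bool) :
    N.wireDart hn hc (N.arc i, s) = N.wireDart hn hc (N.map.flip (N.arc i), s) := by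
  cases s
  · rw [wireDart_of_not_isArc]
    · refine Eq.trans ?_ (if_pos (medial_isArc_false_iff.2 ⟨i, rfl⟩)).symm
      rw [N.map.flip_flip]
    · rw [medial_isArc_false_iff]
      rintro ⟨j, h⟩
      exact N.flip_arc_ne _ _ h.symm
  · rw [wireDart_of_not_isArc (x := (N.map.flip (N.arc i), true))]
    · exact if_pos (medial_isArc_true_iff.2 ⟨i, rfl⟩)
    · rw [medial_isArc_true_iff]
      rintro ⟨j, h⟩
      exact N.flip_arc_ne _ _ h

theorem medial_strandRel_of_wireRel {x y : N.Dart × Bool} (h : N.wireRel x y) :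
    (N.medialDrawing hn hc).strandRel (N.wireDart hn hc x) (N.wireDart hn hc y) := by
  induction h with
  | refl x => exact Setoid.refl' _ _
  | symm x y _ ih => exact Setoid.symm' _ ih
  | trans x y z _ _ h1 h2 => exact Setoid.trans' _ h1 h2
  | rel x y h =>
    rcases h with ⟨d, s, rfl, rfl⟩ | ⟨d, h, rfl, rfl⟩
    · by_cases hd : N.IsArc d
      · obtain ⟨i, rfl | rfl⟩ := hd
        · rw [wireDart_arc]
          exact Setoid.refl' _ _
        · rw [N.map.flip_flip, wireDart_arc]
          exact Setoid.refl' _ _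
      · have hd' : ¬ N.IsArc (N.map.flip d) := by rwa [isArc_flip_iff]
        have h1 := medial_isInner_iff (hn := hn) (hc := hc) (s := s).2 hd
        rw [wireDart_of_not_isArc h1.not_isArc,
          wireDart_of_not_isArc (medial_isInner_iff (s := s).2 hd').not_isArc,
          ← medialMap_rot_rot hd]
        exact strandRel_rot_rot h1
    · have h1 : ¬ (N.medialDrawing hn hc).IsArc (Sum.inl (d, true)) := by
        rw [medial_isArc_true_iff, not_exists]
        exact h
      have h2 : ¬ (N.medialDrawing hn hc).IsArc (Sum.inl (N.map.rot d, false)) := by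
        rwa [← medial_isArc_flip_iff, medialMap_flip_rot]
      rw [wireDart_of_not_isArc h1, wireDart_of_not_isArc h2]
      exact strandRel_flip h1

theorem wireDart_wireEnd (j : Fin (2 * n)) :
    N.wireDart hn hc (N.wireEnd j) = (N.medialDrawing hn hc).strandStart j := by
  induction j using point_cases with
  | h i =>
    rw [wireEnd_evenPoint, medial_strandStart_evenPoint]
    exact if_pos (medial_isArc_true_iff.2 ⟨_, rfl⟩)
  | h' i =>
    rw [wireEnd_oddPoint, medial_strandStart_oddPoint]
    refine if_neg ?_
    rw [medial_isArc_false_iff]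
    rintro ⟨j, h⟩
    exact N.flip_arc_ne _ _ h.symm

theorem wireRel_strandStart {j : Fin (2 * n)} : ∃ x, N.wireRel (N.wireEnd j) x ∧
    (N.medialDrawing hn hc).strandStart j = Sum.inl x := by
  induction j using point_cases with
  | h i =>
    rw [wireEnd_evenPoint, medial_strandStart_evenPoint]
    exact ⟨_, wireRel_flip _ _, rfl⟩
  | h' i =>
    rw [wireEnd_oddPoint, medial_strandStart_oddPoint]
    exact ⟨_, Setoid.refl' _ _, rfl⟩

theorem medial_strandRel_strandStart_iff {j k : Fin (2 * n)} : (N.medialDrawing hn hc).strandRel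
    ((N.medialDrawing hn hc).strandStart j) ((N.medialDrawing hn hc).strandStart k) ↔
      N.wireRel (N.wireEnd j) (N.wireEnd k) := by
  constructor
  · intro h
    obtain ⟨x, hx, ex⟩ := wireRel_strandStart (N := N) (hn := hn) (hc := hc) (j := j)
    obtain ⟨y, hy, ey⟩ := wireRel_strandStart (N := N) (hn := hn) (hc := hc) (j := k)
    rw [ex, ey] at h
    exact Setoid.trans' _ hx
      (Setoid.trans' _ (wireRel_of_medial_strandRel_inl h) (Setoid.symm' _ hy))
  · intro h
    rw [← wireDart_wireEnd, ← wireDart_wireEnd]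
    exact medial_strandRel_of_wireRel h

/-- The medial graph of a reduced network as a strand diagram. -/
noncomputable def medialDiagram (N : CactusNetwork n) (hn : n ≠ 0) (hN : N.IsReduced) :
    StrandDiagram n where
  toDiskDrawing := N.medialDrawing hn hN.componentRel
  no_closed_strand := by
    rintro (x | d) h
    · obtain ⟨j, hj⟩ := hN.exists_wireEnd x
      refine ⟨j, ?_⟩
      rw [← wireDart_wireEnd, ← wireDart_of_not_isArc h]
      exact medial_strandRel_of_wireRel hj
    · exact absurd (medial_isArc_inr d) h
  no_self_crossing x hx h := by
    obtain ⟨d, s, hd, rfl⟩ := exists_of_forall_not_vertexRel_medialArc hx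
    cases s
    · have h1 : (N.medialDrawing hn hN.componentRel).map.rot (Sum.inl (d, false)) =
        Sum.inl (N.map.flip d, true) := medialMap_rot_false hd
      rw [h1] at h
      exact hN.1 d hd (Setoid.trans' _ (wireRel_flip _ _)
        (Setoid.symm' _ (wireRel_of_medial_strandRel_inl h)))
    · exact hN.1 d hd (wireRel_of_medial_strandRel_inl h)
  no_double_crossing x y hx hy h h' := by
    obtain ⟨d, s, hd, rfl⟩ := exists_of_forall_not_vertexRel_medialArc hx
    obtain ⟨e, t, he, rfl⟩ := exists_of_forall_not_vertexRel_medialArc hy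
    have h1 : ∀ d, ¬ N.IsArc d → ∀ s, ∃ d', N.wireRel (d, !s) (d', !s) ∧
        (N.medialDrawing hn hN.componentRel).map.rot (Sum.inl (d, s)) = Sum.inl (d', !s) := by
      intro d hd s
      cases s
      · exact ⟨_, wireRel_flip _ _, medialMap_rot_false hd⟩
      · exact ⟨_, Setoid.refl' _ _, medialMap_rot_true d⟩
    obtain ⟨d', hd', e1⟩ := h1 d hd s
    obtain ⟨e', he', e2⟩ := h1 e he t
    rw [e1, e2] at h'
    have h2 := wireRel_of_medial_strandRel_inl h
    have h3 := Setoid.trans' _ hd' (Setoid.trans' _ (wireRel_of_medial_strandRel_inl h')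
      (Setoid.symm' _ he'))
    have h4 : e = d ∨ e = N.map.flip d := by
      cases s
      · exact hN.2 d e (!t) hd he h3 (by rwa [Bool.not_not])
      · exact hN.2 d e t hd he h2 h3
    have h5 : ∀ s t, N.medialMap.vertexRel (Sum.inl (d, s)) (Sum.inl (d, t)) := by
      have h6 : N.medialMap.vertexRel (Sum.inl (d, true)) (Sum.inl (d, false)) :=
        N.medialMap.vertexRel_rot (Sum.inl (d, true))
      rintro (_ | _) (_ | _)
      · exact Setoid.refl' _ _
      · exact Setoid.symm' _ h6
      · exact h6
      · exact Setoid.refl' _ _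
    rcases h4 with rfl | rfl
    · exact h5 s t
    · refine Setoid.trans' _ (h5 s t) ?_
      rw [← medialMap_rot_rot hd]
      exact Setoid.trans' _ (N.medialMap.vertexRel_rot _) (N.medialMap.vertexRel_rot _)

theorem HasMedialPairing.medialDiagram_isDiagramOf {τ : PointMatching n}
    (h : N.HasMedialPairing τ) (hn : n ≠ 0) (hN : N.IsReduced) :
    (N.medialDiagram hn hN).IsDiagramOf τ := fun j k =>
  (medial_strandRel_strandStart_iff (hn := hn) (hc := hN.componentRel)).trans (h j k)

/-- An interior region belongs to an interior vertex, with one side per edge there, or to a face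
whose sides are all edges. In a strand diagram an interior region never has fewer than three sides,
so excluding triangular faces suffices in the second case. -/
theorem medialDiagram_interiorRegionsHaveFourSides (hn : n ≠ 0) (hN : N.IsReduced)
    (hf : ∀ f, ¬ N.IsTriangularFace f) (hv : ∀ v, N.IsInteriorVertex v → 4 ≤ N.degree v) :
    (N.medialDiagram hn hN).InteriorRegionsHaveFourSides := by
  have := N.finite
  intro x hx
  have h3 := StrandDiagram.three_le_ncard_walk hx
  rcases x with ⟨d, _ | _⟩ | d
  · obtain ⟨d, rfl⟩ : ∃ e, d = N.map.flip e := ⟨_, (N.map.flip_flip d).symm⟩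
    have hnext : ∀ y, N.medialMap.walkRel (Sum.inl (N.map.flip d, false))
        (Sum.inl (N.map.flip y, false)) → ¬ N.IsArc (N.map.faceNext y) := by
      intro y hy h
      refine hx (Sum.inr ⟨_, h⟩) ?_ (medial_isArc_inr (hn := hn) (hc := hN.componentRel) _)
      rw [← medialMap_faceNext_false_of_isArc h]
      exact Setoid.trans' _ hy (N.medialMap.walkRel_faceNext _)
    have h1 : {z | N.medialMap.walkRel (Sum.inl (N.map.flip d, false)) z} = _ :=
      Equiv.Perm.setOf_sameCycle_of_semiconj (f := N.map.faceNext)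
      (φ := fun e => (Sum.inl (N.map.flip e, false) : N.MedialDart))
      (fun y hy => medialMap_faceNext_false (hnext y hy))
    have hinj : Function.Injective fun e => (Sum.inl (N.map.flip e, false) : N.MedialDart) :=
      fun a b h => N.map.flip.injective (congrArg Prod.fst (Sum.inl.inj h))
    have h2 : {z | N.medialMap.walkRel (Sum.inl (N.map.flip d, false)) z}.ncard =
        {e | N.map.walkRel d e}.ncard := by
      rw [h1, Set.ncard_image_of_injective _ hinj]
      rfl
    change 3 ≤ {z | N.medialMap.walkRel (Sum.inl (N.map.flip d, false)) z}.ncard at h3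
    change 4 ≤ {z | N.medialMap.walkRel (Sum.inl (N.map.flip d, false)) z}.ncard
    have h4 : {e | N.face e = N.face d} = {e | N.map.walkRel d e} := by
      ext e
      rw [Set.mem_ofPred_eq, Set.mem_ofPred_eq, eq_comm, face_eq_iff hN.componentRel]
    have h5 := hf (N.face d)
    rw [IsTriangularFace, h4, ← h2] at h5
    by_contra h6
    refine h5 ⟨fun e he => ?_, by omega⟩
    have he : N.map.walkRel d (N.map.faceNext⁻¹ e) := by
      rw [eq_comm, face_eq_iff hN.componentRel] at he
      exact Setoid.trans' _ he ⟨-1, by simp⟩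
    have h7 := hnext (N.map.faceNext⁻¹ e) (by
      have : Sum.inl (N.map.flip (N.map.faceNext⁻¹ e), false) ∈
        {z | N.medialMap.walkRel (Sum.inl (N.map.flip d, false)) z} := by
        rw [h1]
        exact ⟨_, he, rfl⟩
      exact this)
    rwa [show N.map.faceNext (N.map.faceNext⁻¹ e) = e from
      N.map.faceNext.apply_symm_apply e] at h7
  · have h1 : {z | N.medialMap.walkRel (Sum.inl (d, true)) z} = _ :=
      Equiv.Perm.setOf_sameCycle_of_semiconj (f := N.map.rot)
      (φ := fun e => (Sum.inl (e, true) : N.MedialDart)) (fun y _ => medialMap_faceNext_true y)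
    have hinj : Function.Injective fun e => (Sum.inl (e, true) : N.MedialDart) :=
      fun a b h => congrArg Prod.fst (Sum.inl.inj h)
    have h2 : {z | N.medialMap.walkRel (Sum.inl (d, true)) z}.ncard =
        {e | N.map.vertexRel d e}.ncard := by
      rw [h1, Set.ncard_image_of_injective _ hinj]
      rfl
    have harc : ∀ i, ¬ N.map.vertexRel d (N.arc i) := by
      intro i hi
      refine hx (Sum.inl (N.arc i, true)) ?_ ((medial_isArc_true_iff (hn := hn) (hc := hN.componentRel)).2 ⟨i, rfl⟩)
      have : Sum.inl (N.arc i, true) ∈ {z | N.medialMap.walkRel (Sum.inl (d, true)) z} := by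
        rw [h1]
        exact ⟨_, hi, rfl⟩
      exact this
    have h4 := hv (Sum.inl (Quotient.mk _ d)) fun i hi => harc i (Setoid.symm' _ (Quotient.exact hi))
    change 4 ≤ {z | N.medialMap.walkRel (Sum.inl (d, true)) z}.ncard
    rw [h2]
    refine h4.trans (Set.ncard_le_ncard fun e he => ?_)
    exact Setoid.symm' _ (Quotient.exact he.2)
  · exact absurd (medial_isArc_inr (hn := hn) (hc := hN.componentRel) d) (hx _ (Setoid.refl' _ _))

end CactusNetwork

/-! ### The network on the black regions of a strand diagram. -/

namespace DiskDrawing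

open BoundedMap

variable {n : ℕ}

/-- A coloring of the regions of a drawing and of the outside such that regions that share a side
have different colors, except that the outside has the same color as the regions next to the
boundary arcs that start at an odd point. A dart is black if the region on its left is. -/
structure Coloring (S : DiskDrawing n) where
  black : S.Dart → Prop
  black_faceNext : ∀ d, black (S.map.faceNext d) ↔ black d
  not_black_arc : ∀ j, ¬ black (S.arc j)
  not_black_flip_odd : ∀ i, ¬ black (S.map.flip (S.arc (oddPoint i)))
  black_flip : ∀ d, (∀ i, d ≠ S.arc (oddPoint i)) → (∀ i, d ≠ S.map.flip (S.arc (oddPoint i))) →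
    (black (S.map.flip d) ↔ ¬ black d)

end DiskDrawing

theorem finRotate_symm_oddPoint {n : ℕ} (i : Fin n) :
    (finRotate _).symm (oddPoint i) = evenPoint i := by
  rw [Equiv.symm_apply_eq, finRotate_evenPoint]

theorem finRotate_symm_evenPoint {n : ℕ} (i : Fin n) :
    (finRotate _).symm (evenPoint i) = oddPoint ((finRotate _).symm i) := by
  rw [Equiv.symm_apply_eq, finRotate_oddPoint, Equiv.apply_symm_apply]

theorem evenPoint_ne_oddPoint {n : ℕ} (i j : Fin n) : evenPoint i ≠ oddPoint j := fun h => by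
  have := congrArg Fin.val h
  simp only [evenPoint, oddPoint] at this
  omega

namespace DiskDrawing

open BoundedMap

variable {n : ℕ} {S : DiskDrawing n}

theorem nonempty_coloring (hn : n ≠ 0) : Nonempty S.Coloring := by
  classical
  have := S.finite
  have := Fintype.ofFinite S.Dart
  -- The colour is to change across every edge but the arcs that start at odd points. Four such
  -- edges meet at a crossing and two at a boundary point, so they form a cycle.
  let w : S.Dart → ZMod 2 := fun x =>
    if ∃ i, x = S.arc (oddPoint i) ∨ x = S.map.flip (S.arc (oddPoint i)) then 0 else 1
  have hflip : ∀ x, w (S.map.flip x) = w x := fun x => by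
    refine if_congr (exists_congr fun i => ?_) rfl rfl
    rw [S.map.flip.apply_eq_iff_eq, or_comm]
    refine or_congr Iff.rfl ⟨fun h => ?_, fun h => ?_⟩
    · rw [← h, S.map.flip_flip]
    · rw [h, S.map.flip_flip]
  have hodd : ∀ i, w (S.arc (oddPoint i)) = 0 := fun i => if_pos ⟨i, Or.inl rfl⟩
  have heven : ∀ i, w (S.arc (evenPoint i)) = 1 := fun i => if_neg (by
    rintro ⟨j, h | h⟩
    · exact evenPoint_ne_oddPoint _ _ (S.arc_injective h)
    · exact S.flip_arc_ne _ _ h.symm)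
  have hnon : ∀ x, ¬ S.IsArc x → w x = 1 := fun x hx => if_neg (by
    rintro ⟨i, rfl | rfl⟩
    · exact hx (isArc_arc _)
    · exact hx (isArc_flip_arc _))
  obtain ⟨g, hg1, hg2⟩ := S.planar.exists_face_potential w hflip (fun d => by
    by_cases hd : S.IsInner d
    · have h4 := S.crossing_degree d hd
      rw [Finset.sum_congr rfl fun x hx => hnon x ?_]
      · rw [Finset.sum_const, ← Set.ncard_coe_finset]
        simp only [Finset.coe_filter, Finset.mem_univ, true_and, h4]
        decide
      · simp only [Finset.mem_filter, Finset.mem_univ, true_and] at hx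
        exact ((isInner_congr hx).1 hd).not_isArc
    · simp only [IsInner, not_forall, not_not] at hd
      obtain ⟨j, hj⟩ := hd
      have hs : Finset.univ.filter (fun x => S.map.vertexRel d x) =
          {S.arc j, S.map.rot (S.arc j), S.strandStart j} := by
        ext x
        simp only [Finset.mem_filter, Finset.mem_univ, true_and, Finset.mem_insert,
          Finset.mem_singleton]
        rw [← S.vertexRel_arc_iff]
        exact ⟨S.map.vertexRel.trans' hj, S.map.vertexRel.trans' (S.map.vertexRel.symm' hj)⟩
      have n1 : S.arc j ≠ S.strandStart j := fun h =>
        S.not_isArc_strandStart j (h ▸ isArc_arc (B := S.toBoundedMap) j)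
      rw [hs, Finset.sum_insert, Finset.sum_insert, Finset.sum_singleton, S.rot_arc, hflip,
        hnon _ (S.not_isArc_strandStart j)]
      · induction j using point_cases with
        | h i =>
          rw [finRotate_symm_evenPoint, heven, hodd]
          decide
        | h' i =>
          rw [finRotate_symm_oddPoint, heven, hodd]
          decide
      · rw [S.rot_arc, Finset.mem_singleton]
        exact fun h => S.not_isArc_strandStart j (h ▸ isArc_flip_arc (B := S.toBoundedMap) _)
      · rw [S.rot_arc, Finset.mem_insert, Finset.mem_singleton, not_or]
        exact ⟨fun h => S.flip_arc_ne _ _ h.symm, n1⟩)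
  let p : Fin (2 * n) := ⟨0, by omega⟩
  have hout : ∀ j, g (S.arc j) = g (S.arc p) := fun j =>
    eq_of_finRotate_invariant (f := fun j => g (S.arc j))
      (fun i => by rw [← S.faceNext_arc]; exact hg1 _) j p
  have z1 : ∀ a b : ZMod 2, a + b = 0 → a = b := by decide
  have z2 : ∀ a b c : ZMod 2, a + b = 1 → (b ≠ c ↔ ¬ a ≠ c) := by decide
  refine ⟨⟨fun x => g x ≠ g (S.arc p), fun d => by rw [hg1], fun j => not_not.2 (hout j),
    fun i => not_not.2 ?_, fun d h1 h2 => ?_⟩⟩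
  · rw [← hout (oddPoint i)]
    have := hg2 (S.arc (oddPoint i))
    rw [hodd] at this
    exact (z1 _ _ this).symm
  · refine z2 _ _ _ ((hg2 d).trans (if_neg ?_))
    rintro ⟨i, h | h⟩
    · exact h1 i h
    · exact h2 i h

namespace Coloring

variable (c : S.Coloring)

theorem black_flip_of_not_isArc {d : S.Dart} (h : ¬ S.IsArc d) :
    c.black (S.map.flip d) ↔ ¬ c.black d :=
  c.black_flip d (fun _ hi => h ⟨_, Or.inl hi⟩) fun _ hi => h ⟨_, Or.inr hi⟩

theorem black_flip_even (i : Fin n) : c.black (S.map.flip (S.arc (evenPoint i))) :=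
  (c.black_flip _ (fun _ h => evenPoint_ne_oddPoint _ _ (S.arc_injective h))
    fun _ h => S.flip_arc_ne _ _ h.symm).2 (c.not_black_arc _)

theorem black_flip_rot (d : S.Dart) : c.black (S.map.flip (S.map.rot d)) ↔ c.black d := by
  rw [← c.black_faceNext, DartMap.faceNext_flip_rot]

theorem black_rot_of_not_isArc {d : S.Dart} (h : ¬ S.IsArc (S.map.rot d)) :
    c.black (S.map.rot d) ↔ ¬ c.black d := by
  have := c.black_flip_of_not_isArc h
  rw [c.black_flip_rot] at this
  rw [this, not_not]

theorem black_rot {d : S.Dart} (h : S.IsInner d) : c.black (S.map.rot d) ↔ ¬ c.black d :=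
  c.black_rot_of_not_isArc (isInner_rot_iff.2 h).not_isArc

theorem black_rot_rot {d : S.Dart} (h : S.IsInner d) :
    c.black (S.map.rot (S.map.rot d)) ↔ c.black d := by
  rw [c.black_rot (isInner_rot_iff.2 h), c.black_rot h, not_not]

theorem black_start_even (i : Fin n) : c.black (S.strandStart (evenPoint i)) := by
  rw [← c.black_flip_rot, S.rot_strandStart]
  exact c.black_flip_even i

theorem not_black_start_odd (i : Fin n) : ¬ c.black (S.strandStart (oddPoint i)) := by
  rw [← c.black_flip_rot, S.rot_strandStart]
  exact c.not_black_flip_odd i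

theorem not_isInner_flip_arc (j : Fin (2 * n)) : ¬ S.IsInner (S.map.flip (S.arc j)) := by
  rw [← S.rot_arc_finRotate, isInner_rot_iff]
  exact not_isInner_arc _

variable {c} in
theorem black_cases {x : S.Dart} (hx : c.black x) : S.IsInner x ∨
    (∃ i, x = S.map.flip (S.arc (evenPoint i))) ∨
      ∃ i, x = S.strandStart (evenPoint (finRotate _ i)) := by
  by_cases hi : S.IsInner x
  · exact Or.inl hi
  right
  by_cases ha : S.IsArc x
  · left
    obtain ⟨j, rfl | rfl⟩ := ha
    · exact absurd hx (c.not_black_arc j)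
    · induction j using point_cases with
      | h i => exact ⟨i, rfl⟩
      | h' i => exact absurd hx (c.not_black_flip_odd i)
  · right
    obtain ⟨j, rfl⟩ := S.exists_eq_strandStart ha hi
    induction j using point_cases with
    | h i => exact ⟨(finRotate _).symm i, by rw [Equiv.apply_symm_apply]⟩
    | h' i => exact absurd hx (c.not_black_start_odd i)

variable (S) in
open scoped Classical in
/-- The other end of an edge of the network, for a black dart at its medial vertex. -/
noncomputable def opposite (x : S.Dart) : S.Dart :=
  -- The two ends of a boundary arc that starts at an odd point act as one medial vertex, which lies
  -- on an arc of the network; `opposite` exchanges its two black darts.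
  if S.IsInner x then S.map.rot (S.map.rot x) else
    S.map.rot (S.map.flip (S.map.rot (S.map.rot x)))

theorem opposite_of_isInner {x : S.Dart} (h : S.IsInner x) :
    opposite S x = S.map.rot (S.map.rot x) := if_pos h

theorem opposite_flip_arc (i : Fin n) : opposite S (S.map.flip (S.arc (evenPoint i))) =
    S.strandStart (evenPoint (finRotate _ i)) := by
  rw [opposite, if_neg (not_isInner_flip_arc _), S.rot_flip_arc, S.rot_strandStart,
    S.rot_flip_arc, finRotate_evenPoint, finRotate_oddPoint]

theorem opposite_start (i : Fin n) : opposite S (S.strandStart (evenPoint (finRotate _ i))) =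
    S.map.flip (S.arc (evenPoint i)) := by
  rw [opposite, if_neg (S.not_isInner_strandStart _), S.rot_strandStart, S.rot_arc,
    finRotate_symm_evenPoint, Equiv.symm_apply_apply, S.map.flip_flip, S.rot_arc,
    finRotate_symm_oddPoint]

variable {c}

theorem opposite_opposite {x : S.Dart} (hx : c.black x) : opposite S (opposite S x) = x := by
  rcases black_cases hx with hi | ⟨i, rfl⟩ | ⟨i, rfl⟩
  · rw [opposite_of_isInner hi, opposite_of_isInner (isInner_rot_iff.2 (isInner_rot_iff.2 hi)),
      rot_four hi]
  · rw [opposite_flip_arc, opposite_start]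
  · rw [opposite_start, opposite_flip_arc]

theorem black_opposite {x : S.Dart} (hx : c.black x) : c.black (opposite S x) := by
  rcases black_cases hx with hi | ⟨i, rfl⟩ | ⟨i, rfl⟩
  · rw [opposite_of_isInner hi]
    exact (c.black_rot_rot hi).2 hx
  · rw [opposite_flip_arc]
    exact c.black_start_even _
  · rw [opposite_start]
    exact c.black_flip_even _

theorem opposite_ne {x : S.Dart} (hx : c.black x) : opposite S x ≠ x := by
  rcases black_cases hx with hi | ⟨i, rfl⟩ | ⟨i, rfl⟩
  · rw [opposite_of_isInner hi]
    exact rot_rot_ne hi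
  · rw [opposite_flip_arc]
    exact fun h => S.not_isArc_strandStart _ (h ▸ isArc_flip_arc (B := S.toBoundedMap) _)
  · rw [opposite_start]
    exact fun h => S.not_isArc_strandStart _ (h ▸ isArc_flip_arc (B := S.toBoundedMap) _)

variable (c) in
/-- The network on the black regions: its vertices are the black regions, its edges are the
crossings. -/
noncomputable def netMap : DartMap {x // c.black x} where
  rot := S.map.faceNext.subtypePerm c.black_faceNext
  flip := Function.Involutive.toPerm (fun x => ⟨opposite S x.1, black_opposite x.2⟩)
    fun x => Subtype.ext (opposite_opposite x.2)
  flip_flip x := Subtype.ext (opposite_opposite x.2)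
  flip_ne x h := opposite_ne x.2 (congrArg Subtype.val h)

theorem coe_netMap_rot (x : {x // c.black x}) :
    (c.netMap.rot x).1 = S.map.faceNext x.1 := rfl

theorem coe_netMap_flip (x : {x // c.black x}) :
    (c.netMap.flip x).1 = opposite S x.1 := rfl

theorem coe_netMap_faceNext (x : {x // c.black x}) :
    (c.netMap.faceNext x).1 = S.map.flip (S.map.rot (opposite S x.1)) := by
  apply S.map.faceNext.injective
  rw [← coe_netMap_rot, DartMap.rot_faceNext, DartMap.faceNext_flip_rot, coe_netMap_flip]

theorem flip_faceNext_of_isInner {x : {x // c.black x}} (h : S.IsInner x.1) :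
    S.map.faceNext (S.map.flip x.1) = S.map.flip (c.netMap.faceNext x).1 := by
  rw [coe_netMap_faceNext, S.map.flip_flip, opposite_of_isInner h, DartMap.faceNext_flip]
  exact S.map.rot.injective ((S.map.rot.apply_symm_apply x.1).trans (rot_four h).symm)

/-- The faces of the network are the regions that are not black, traversed by reversed black darts.
At an arc of the network one step corresponds to two steps in the drawing. -/
theorem walkRel_flip_faceNext (x : {x // c.black x}) :
    S.map.walkRel (S.map.flip x.1) (S.map.flip (c.netMap.faceNext x).1) := by
  rcases black_cases x.2 with hi | ⟨i, hi⟩ | ⟨i, hi⟩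
  · rw [← flip_faceNext_of_isInner hi]
    exact S.map.walkRel_faceNext _
  · rw [coe_netMap_faceNext, hi, S.map.flip_flip, S.map.flip_flip, opposite_flip_arc,
      S.rot_strandStart, ← finRotate_oddPoint, ← finRotate_evenPoint, ← S.faceNext_arc,
      ← S.faceNext_arc]
    exact Setoid.trans' _ (S.map.walkRel_faceNext _) (S.map.walkRel_faceNext _)
  · have h1 : S.map.faceNext (S.map.faceNext (S.map.flip x.1)) =
        S.strandStart (oddPoint i) := by
      rw [hi, DartMap.faceNext_flip]
      apply S.map.rot.injective
      rw [DartMap.rot_faceNext, S.rot_strandStart]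
      have h2 : S.map.rot⁻¹ (S.strandStart (evenPoint (finRotate _ i))) =
          S.map.flip (S.arc (oddPoint i)) := by
        apply S.map.rot.injective
        rw [S.rot_flip_arc, finRotate_oddPoint]
        exact S.map.rot.apply_symm_apply _
      rw [h2, S.map.flip_flip]
    rw [coe_netMap_faceNext, hi, opposite_start, S.map.flip_flip, S.rot_flip_arc,
      finRotate_evenPoint, ← hi, ← h1]
    exact Setoid.trans' _ (S.map.walkRel_faceNext _) (S.map.walkRel_faceNext _)

end Coloring

end DiskDrawing

namespace DiskDrawing

open BoundedMap

variable {n : ℕ} {S : DiskDrawing n}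

theorem eq_of_vertexRel_arc {i j : Fin (2 * n)} (h : S.map.vertexRel (S.arc i) (S.arc j)) :
    i = j := by
  rcases S.vertexRel_arc_iff.1 h with h | h | h
  · exact (S.arc_injective h).symm
  · rw [S.rot_arc] at h
    exact absurd h.symm (S.flip_arc_ne _ _)
  · exact absurd (h ▸ isArc_arc (B := S.toBoundedMap) j) (S.not_isArc_strandStart _)

theorem exists_vertexRel_arc {x : S.Dart} (h : ¬ S.IsInner x) :
    ∃ j, S.map.vertexRel (S.arc j) x := by
  simpa only [IsInner, not_forall, not_not] using h

namespace Coloring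

variable {c : S.Coloring}

theorem black_eq_or_eq_opposite {x y : S.Dart} (hx : c.black x) (hy : c.black y)
    (h : S.map.vertexRel x y) : y = x ∨ y = opposite S x := by
  rcases black_cases hx with hi | ⟨i, rfl⟩ | ⟨i, rfl⟩
  · rw [opposite_of_isInner hi]
    rcases (vertexRel_iff_of_isInner hi).1 h with rfl | rfl | rfl | rfl
    · exact Or.inl rfl
    · exact absurd hx ((c.black_rot hi).1 hy)
    · exact Or.inr rfl
    · have h1 := (c.black_rot (isInner_rot_iff.2 (isInner_rot_iff.2 hi))).1 hy
      rw [c.black_rot_rot hi] at h1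
      exact absurd hx h1
  · left
    have h1 : S.map.flip (S.arc (evenPoint i)) = S.map.rot (S.arc (oddPoint i)) := by
      rw [S.rot_arc, finRotate_symm_oddPoint]
    rw [h1] at h ⊢
    rcases S.vertexRel_arc_iff.1 (Setoid.trans' _ (S.map.vertexRel_rot _) h) with rfl | rfl | rfl
    · exact absurd hy (c.not_black_arc _)
    · rfl
    · exact absurd hy (c.not_black_start_odd _)
  · left
    have h1 := S.map.vertexRel_rot (S.strandStart (evenPoint (finRotate _ i)))
    rw [S.rot_strandStart] at h1
    rcases S.vertexRel_arc_iff.1 (Setoid.trans' _ (Setoid.symm' _ h1) h) with rfl | rfl | rfl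
    · exact absurd hy (c.not_black_arc _)
    · rw [S.rot_arc, finRotate_symm_evenPoint] at hy
      exact absurd hy (c.not_black_flip_odd _)
    · rfl

variable (c) in
theorem exists_black_vertexRel (y : S.Dart) : ∃ x, c.black x ∧ S.map.vertexRel y x := by
  by_cases hi : S.IsInner y
  · by_cases hy : c.black y
    · exact ⟨y, hy, Setoid.refl' _ _⟩
    · exact ⟨_, (c.black_rot hi).2 hy, S.map.vertexRel_rot _⟩
  · obtain ⟨j, hj⟩ := exists_vertexRel_arc hi
    suffices h : ∃ x, c.black x ∧ S.map.vertexRel (S.arc j) x by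
      obtain ⟨x, hx, h⟩ := h
      exact ⟨x, hx, Setoid.trans' _ (Setoid.symm' _ hj) h⟩
    induction j using point_cases with
    | h i => exact ⟨_, c.black_start_even i, S.vertexRel_arc_iff.2 (Or.inr (Or.inr rfl))⟩
    | h' i =>
      refine ⟨S.map.rot (S.arc (oddPoint i)), ?_, S.map.vertexRel_rot _⟩
      rw [S.rot_arc, finRotate_symm_oddPoint]
      exact c.black_flip_even i

theorem componentRel_netMap_of_black_flip {y : S.Dart} (hy : c.black y) {x' : {x // c.black x}}
    (h : S.map.vertexRel (S.map.flip y) x'.1) : c.netMap.componentRel ⟨y, hy⟩ x' := by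
  have h1 : S.map.vertexRel (c.netMap.rot ⟨y, hy⟩).1 x'.1 := by
    refine Setoid.trans' _ (Setoid.trans' _ (S.map.vertexRel_rot _) ?_) h
    rw [coe_netMap_rot, DartMap.rot_faceNext]
  rcases black_eq_or_eq_opposite (c.netMap.rot ⟨y, hy⟩).2 x'.2 h1 with h2 | h2
  · rw [Subtype.ext h2]
    exact c.netMap.componentRel_rot _
  · rw [Subtype.ext (h2.trans (coe_netMap_flip _).symm)]
    exact Setoid.trans' _ (c.netMap.componentRel_rot _) (c.netMap.componentRel_flip _)

/-- A path in the drawing is followed by black darts at its vertices. Only a boundary arc that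
starts at an odd point has no black side, and its ends are joined by an arc of the network. -/
theorem netMap_componentRel {x y : {x // c.black x}} (h : S.map.componentRel x.1 y.1) :
    c.netMap.componentRel x y := by
  have key : ∀ y y' : S.Dart, S.map.componentRel y y' → ∀ x x' : {x // c.black x},
      S.map.vertexRel y x.1 → S.map.vertexRel y' x'.1 → c.netMap.componentRel x x' := by
    have same : ∀ x x' : {x // c.black x}, S.map.vertexRel x.1 x'.1 →
        c.netMap.componentRel x x' := by
      intro x x' h
      rcases black_eq_or_eq_opposite x.2 x'.2 h with h2 | h2
      · rw [Subtype.ext h2]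
      · rw [Subtype.ext (h2.trans (coe_netMap_flip x).symm)]
        exact c.netMap.componentRel_flip x
    intro y y' h
    induction h with
    | refl y => exact fun x x' h h' => same x x' (Setoid.trans' _ (Setoid.symm' _ h) h')
    | symm y y' _ ih => exact fun x x' h h' => Setoid.symm' _ (ih x' x h' h)
    | trans y z y' _ _ h1 h2 =>
      intro x x' h h'
      obtain ⟨z', hz, h3⟩ := c.exists_black_vertexRel z
      exact Setoid.trans' _ (h1 x ⟨z', hz⟩ h h3) (h2 ⟨z', hz⟩ x' h3 h')
    | rel y y' hyy =>
      intro x x' h h'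
      rcases hyy with rfl | rfl
      · exact same x x' (Setoid.trans' _ (Setoid.symm' _ h)
          (Setoid.trans' _ (S.map.vertexRel_rot y) h'))
      by_cases hy : c.black y
      · exact Setoid.trans' _ (same x ⟨y, hy⟩ (Setoid.symm' _ h))
          (componentRel_netMap_of_black_flip hy h')
      by_cases hy' : c.black (S.map.flip y)
      · refine Setoid.symm' _ (Setoid.trans' _ (same x' ⟨_, hy'⟩ (Setoid.symm' _ h'))
          (componentRel_netMap_of_black_flip hy' ?_))
        rwa [S.map.flip_flip]
      have hodd : ∃ i, y = S.arc (oddPoint i) ∨ y = S.map.flip (S.arc (oddPoint i)) := by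
        by_contra hne
        push Not at hne
        exact hy' ((c.black_flip y (fun i => (hne i).1) fun i => (hne i).2).2 hy)
      obtain ⟨i, hi⟩ := hodd
      have h1 : S.map.vertexRel (S.arc (oddPoint i)) (S.map.flip (S.arc (evenPoint i))) := by
        have := S.map.vertexRel_rot (S.arc (oddPoint i))
        rwa [S.rot_arc, finRotate_symm_oddPoint] at this
      have h2 : S.map.vertexRel (S.map.flip (S.arc (oddPoint i)))
          (S.strandStart (evenPoint (finRotate _ i))) := by
        have := S.map.vertexRel_rot (S.map.flip (S.arc (oddPoint i)))
        rwa [S.rot_flip_arc, finRotate_oddPoint] at this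
      have h3 : c.netMap.componentRel ⟨_, c.black_flip_even i⟩
          ⟨_, c.black_start_even (finRotate _ i)⟩ := by
        have := c.netMap.componentRel_flip ⟨_, c.black_flip_even i⟩
        rwa [show c.netMap.flip ⟨_, c.black_flip_even i⟩ = ⟨_, c.black_start_even (finRotate _ i)⟩
          from Subtype.ext (opposite_flip_arc i)] at this
      rcases hi with rfl | rfl
      · exact Setoid.trans' _ (same x ⟨_, c.black_flip_even i⟩ (Setoid.trans' _
          (Setoid.symm' _ h) h1)) (Setoid.trans' _ h3 (same ⟨_, c.black_start_even _⟩ x'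
          (Setoid.trans' _ (Setoid.symm' _ h2) h')))
      · rw [S.map.flip_flip] at h'
        refine Setoid.symm' _ ?_
        exact Setoid.trans' _ (same x' ⟨_, c.black_flip_even i⟩ (Setoid.trans' _
          (Setoid.symm' _ h') h1)) (Setoid.trans' _ h3 (same ⟨_, c.black_start_even _⟩ x
          (Setoid.trans' _ (Setoid.symm' _ h2) h)))
  exact key x.1 y.1 h x y (Setoid.refl' _ _) (Setoid.refl' _ _)

variable (c)

/-- A region is black, hence a vertex, or it borders on a black one, hence is met by a face. A dart
on a boundary arc from an odd point has no black side, but the next dart on its walk has one. -/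
theorem card_walk_le_net : Nat.card (Quotient S.map.walkRel) ≤
    Nat.card (Quotient c.netMap.vertexRel) + Nat.card (Quotient c.netMap.walkRel) := by
  have := S.finite
  rw [← Nat.card_sum]
  let F : Quotient c.netMap.vertexRel → Quotient S.map.walkRel :=
    Quotient.lift (fun x => Quotient.mk _ x.1) fun x y h => h.apply_eq_of_invariant
      (g := fun x : {x // c.black x} => Quotient.mk S.map.walkRel x.1)
      fun x => Quotient.sound (Setoid.symm' _ (S.map.walkRel_faceNext x.1))
  let G : Quotient c.netMap.walkRel → Quotient S.map.walkRel :=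
    Quotient.lift (fun x => Quotient.mk _ (S.map.flip x.1)) fun x y h => h.apply_eq_of_invariant
      (g := fun x : {x // c.black x} => Quotient.mk S.map.walkRel (S.map.flip x.1))
      fun x => Quotient.sound (Setoid.symm' _ (walkRel_flip_faceNext x))
  refine Nat.card_le_card_of_surjective (Sum.elim F G) fun q => ?_
  induction q using Quotient.inductionOn with | _ y
  have key : ∀ y : S.Dart, (c.black y ∨ c.black (S.map.flip y)) →
      ∃ p, Sum.elim F G p = Quotient.mk _ y := by
    rintro y (hy | hy)
    · exact ⟨Sum.inl (Quotient.mk _ ⟨y, hy⟩), rfl⟩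
    · refine ⟨Sum.inr (Quotient.mk _ ⟨_, hy⟩), ?_⟩
      change Quotient.mk S.map.walkRel (S.map.flip (S.map.flip y)) = _
      rw [S.map.flip_flip]
  by_cases hy : c.black y
  · exact key y (Or.inl hy)
  by_cases hy' : c.black (S.map.flip y)
  · exact key y (Or.inr hy')
  have hodd : ∃ i, y = S.arc (oddPoint i) ∨ y = S.map.flip (S.arc (oddPoint i)) := by
    by_contra hne
    push Not at hne
    exact hy' ((c.black_flip y (fun i => (hne i).1) fun i => (hne i).2).2 hy)
  have h1 : c.black (S.map.flip (S.map.faceNext y)) := by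
    obtain ⟨i, rfl | rfl⟩ := hodd
    · rw [S.faceNext_arc, finRotate_oddPoint]
      exact c.black_flip_even _
    · have : S.map.faceNext (S.map.flip (S.arc (oddPoint i))) = S.strandStart (oddPoint i) := by
        apply S.map.rot.injective
        rw [DartMap.rot_faceNext, S.map.flip_flip, S.rot_strandStart]
      rw [this, c.black_flip_of_not_isArc (S.not_isArc_strandStart _)]
      exact c.not_black_start_odd i
  obtain ⟨p, hp⟩ := key _ (Or.inr h1)
  exact ⟨p, hp.trans (Quotient.sound (Setoid.symm' _ (S.map.walkRel_faceNext y)))⟩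

/-- Black darts, their reversals and both directions of the arcs from odd points are different
darts. -/
theorem two_mul_card_black_add_le : 2 * Nat.card {x // c.black x} + 2 * n ≤ Nat.card S.Dart := by
  have := S.finite
  have h1 : Nat.card (({x // c.black x} ⊕ {x // c.black x}) ⊕ (Fin n ⊕ Fin n)) ≤
      Nat.card S.Dart := by
    refine Nat.card_le_card_of_injective (Sum.elim (Sum.elim Subtype.val fun x => S.map.flip x.1)
      (Sum.elim (fun i => S.arc (oddPoint i)) fun i => S.map.flip (S.arc (oddPoint i)))) ?_
    have h2 : ∀ x : {x // c.black x}, ¬ c.black (S.map.flip x.1) := fun x => by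
      rw [c.black_flip]
      · exact not_not.2 x.2
      · exact fun i h => c.not_black_arc _ (h ▸ x.2)
      · exact fun i h => c.not_black_flip_odd _ (h ▸ x.2)
    refine Function.Injective.sumElim (Function.Injective.sumElim Subtype.val_injective
      (S.map.flip.injective.comp Subtype.val_injective) fun x y h => h2 y (h ▸ x.2))
      (Function.Injective.sumElim (S.arc_injective.comp oddPoint_injective)
        (S.map.flip.injective.comp (S.arc_injective.comp oddPoint_injective))
        fun i j h => S.flip_arc_ne _ _ h.symm) ?_
    rintro (x | x) (i | i) h
    · exact c.not_black_arc _ ((show x.1 = S.arc _ from h) ▸ x.2)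
    · exact c.not_black_flip_odd _ ((show x.1 = S.map.flip (S.arc _) from h) ▸ x.2)
    · refine c.not_black_flip_odd i ?_
      have h3 : S.map.flip x.1 = S.arc (oddPoint i) := h
      rw [← h3, S.map.flip_flip]
      exact x.2
    · have h3 : S.map.flip x.1 = S.map.flip (S.arc (oddPoint i)) := h
      exact c.not_black_arc _ (S.map.flip.injective h3 ▸ x.2)
  rw [Nat.card_sum, Nat.card_sum, Nat.card_sum, Nat.card_fin] at h1
  omega

theorem netMap_isPlanar (hn : n ≠ 0) (hc : ∀ x y, S.map.componentRel x y) :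
    c.netMap.IsPlanar := by
  have := S.finite
  have := Fintype.ofFinite S.Dart
  have := Fintype.ofFinite {x // c.black x}
  refine DartMap.isPlanar_of_connected (fun x y => netMap_componentRel (hc x.1 y.1)) ?_
  -- By the vertex degrees Euler's formula for the drawing reads `4 F = D - 2 n + 8 C`, where `D - 2
  -- n` is at least twice the number of black darts, that is, four times the number of edges of the
  -- network.
  have h1 := S.planar.euler
  have h2 := DartMap.four_mul_card_vertex S.arc (fun _ _ => eq_of_vertexRel_arc) S.boundary_degree
    S.crossing_degree
  have h3 := S.map.card_eq_two_mul_card_edge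
  have h4 := c.netMap.card_eq_two_mul_card_edge
  have h5 := c.two_mul_card_black_add_le
  have h6 := c.card_walk_le_net
  have h7 : 0 < Nat.card (Quotient S.map.componentRel) :=
    Nat.card_pos_iff.2 ⟨⟨Quotient.mk _ (S.arc ⟨0, by omega⟩)⟩, inferInstance⟩
  omega

end Coloring

end DiskDrawing

/-- There are no closed strands, so every strand is attached to the boundary circle. -/
theorem StrandDiagram.componentRel {n : ℕ} (S : StrandDiagram n) (x y : S.Dart) :
    S.map.componentRel x y := by
  have h1 : ∀ i j, Quotient.mk S.map.componentRel (S.arc i) = Quotient.mk _ (S.arc j) :=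
    eq_of_finRotate_invariant fun i => by
      rw [← S.faceNext_arc]
      exact Quotient.sound (S.map.componentRel_faceNext _)
  have h2 : ∀ x y, S.strandRel x y → S.map.componentRel x y := by
    intro x y h
    induction h with
    | refl x => exact Setoid.refl' _ _
    | symm x y _ ih => exact Setoid.symm' _ ih
    | trans x y z _ _ h1 h2 => exact Setoid.trans' _ h1 h2
    | rel x y h =>
      rcases h with ⟨-, rfl⟩ | ⟨-, rfl⟩
      · exact S.map.componentRel_flip _
      · exact Setoid.trans' _ (S.map.componentRel_rot _) (S.map.componentRel_rot _)
  have h3 : ∀ x, ∃ j, S.map.componentRel (S.arc j) x := by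
    intro x
    by_cases hx : S.IsArc x
    · obtain ⟨i, rfl | rfl⟩ := hx
      · exact ⟨i, Setoid.refl' _ _⟩
      · exact ⟨i, S.map.componentRel_flip _⟩
    · obtain ⟨j, hj⟩ := S.no_closed_strand x hx
      refine ⟨j, Setoid.trans' _ (Setoid.symm' _ ?_) (h2 _ _ hj)⟩
      have := S.map.componentRel_rot (S.strandStart j)
      rwa [S.rot_strandStart] at this
  obtain ⟨i, hi⟩ := h3 x
  obtain ⟨j, hj⟩ := h3 y
  exact Setoid.trans' _ (Setoid.symm' _ hi) (Setoid.trans' _ (Quotient.exact (h1 i j)) hj)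

namespace StrandDiagram

open BoundedMap DiskDrawing DiskDrawing.Coloring

variable {n : ℕ} {S : StrandDiagram n}

/-- The network on the black regions of a strand diagram. -/
noncomputable def network (c : S.Coloring) (hn : n ≠ 0) : CactusNetwork n where
  Dart := {x // c.black x}
  finite := have := S.finite; inferInstance
  map := c.netMap
  planar := c.netMap_isPlanar hn S.componentRel
  arc i := ⟨S.map.flip (S.arc (evenPoint i)), c.black_flip_even i⟩
  arc_injective i j h :=
    evenPoint_injective (S.arc_injective (S.map.flip.injective (congrArg Subtype.val h)))
  flip_arc_ne i j h := by
    have h1 := congrArg Subtype.val h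
    rw [coe_netMap_flip, opposite_flip_arc] at h1
    exact S.not_isArc_strandStart _ ⟨_, Or.inr h1⟩
  faceNext_arc i := Subtype.ext (by
    rw [coe_netMap_faceNext, opposite_flip_arc, S.rot_strandStart])
  Isolated := Empty
  finite_isolated := inferInstance
  Face := Quotient c.netMap.walkRel
  finite_face := have := S.finite; inferInstance
  face := Quotient.mk _
  isolatedFace := Empty.elim
  face_faceNext d := Quotient.sound (Setoid.symm' _ (c.netMap.walkRel_faceNext d))
  faces_connected := by
    have hd : ∀ x : {x // c.black x} ⊕ Quotient c.netMap.walkRel, ∃ d, Relation.EqvGen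
        (fun x y => (∃ d e, c.netMap.componentRel d e ∧ x = Sum.inl d ∧ y = Sum.inl e) ∨
          ∃ d, x = Sum.inl d ∧ y = Sum.inr (Quotient.mk c.netMap.walkRel d)) (Sum.inl d) x := by
      rintro (d | f)
      · exact ⟨d, .refl _⟩
      · induction f using Quotient.inductionOn with | _ d
        exact ⟨d, .rel _ _ (Or.inr ⟨d, rfl, rfl⟩)⟩
    intro x y
    obtain ⟨d, hd1⟩ := hd x
    obtain ⟨e, he1⟩ := hd y
    exact .trans _ _ _ (.symm _ _ hd1) (.trans _ _ _ (.rel _ _ (Or.inl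
      ⟨d, e, netMap_componentRel (S.componentRel _ _), rfl, rfl⟩)) he1)
  faces_tree := by
    have h : Nat.card (Quotient c.netMap.componentRel) = 1 := by
      rw [Nat.card_eq_one_iff_unique]
      refine ⟨⟨fun a b => ?_⟩,
        ⟨Quotient.mk _ ⟨_, c.black_flip_even ⟨0, Nat.pos_of_ne_zero hn⟩⟩⟩⟩
      induction a using Quotient.inductionOn
      induction b using Quotient.inductionOn
      exact Quotient.sound (netMap_componentRel (S.componentRel _ _))
    rw [h, add_comm]
  outside_only_arcs i d h := by
    have h1 : c.netMap.walkRel d ⟨_, c.black_flip_even i⟩ := Quotient.exact h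
    have key : ∀ i, c.netMap.faceNext ⟨_, c.black_flip_even i⟩ =
        ⟨_, c.black_flip_even (finRotate _ i)⟩ := fun i => Subtype.ext (by
      rw [coe_netMap_faceNext, opposite_flip_arc, S.rot_strandStart])
    have h2 : ∀ d : {x // c.black x}, (∃ j, c.netMap.faceNext d = ⟨_, c.black_flip_even j⟩) =
        ∃ j, d = ⟨_, c.black_flip_even j⟩ := by
      refine fun d => propext (Iff.intro ?_ ?_)
      · rintro ⟨j, hj⟩
        refine ⟨(finRotate _).symm j, c.netMap.faceNext.injective ?_⟩
        rw [hj, key]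
        exact Subtype.ext (by rw [Equiv.apply_symm_apply])
      · rintro ⟨j, hj⟩
        exact ⟨_, by rw [hj, key]⟩
    have h3 := h1.apply_eq_of_invariant
      (g := fun d : {x // c.black x} => ∃ j, d = ⟨_, c.black_flip_even j⟩) h2
    exact h3.mpr ⟨i, rfl⟩
  outside_not_isolated _ v := v.elim

variable {c : S.Coloring} {hn : n ≠ 0}

theorem network_isArc_iff {x : {x // c.black x}} :
    (network c hn).IsArc x ↔ ¬ S.IsInner x.1 := by
  constructor
  · rintro ⟨i, rfl | rfl⟩
    · exact not_isInner_flip_arc _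
    · change ¬ S.IsInner (opposite S.toDiskDrawing (S.map.flip (S.arc (evenPoint i))))
      rw [opposite_flip_arc]
      exact S.not_isInner_strandStart _
  · intro h
    rcases black_cases x.2 with hi | ⟨i, hi⟩ | ⟨i, hi⟩
    · exact absurd hi h
    · exact ⟨i, Or.inl (Subtype.ext hi)⟩
    · refine ⟨i, Or.inr (Subtype.ext (hi.trans ?_))⟩
      exact (opposite_flip_arc i).symm

variable (S) in
open scoped Classical in
/-- The dart of a strand diagram along a wire of its network. -/
noncomputable def alongWire (x : S.Dart) (s : Bool) : S.Dart :=
  let y := if S.IsInner x ∨ (s = true ↔ ¬ S.IsArc x) then x else opposite S.toDiskDrawing x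
  if s then y else S.map.rot y

theorem alongWire_of_pos {x : S.Dart} {s : Bool} (h : S.IsInner x ∨ (s = true ↔ ¬ S.IsArc x)) :
    S.alongWire x s = if s then x else S.map.rot x := by
  simp only [alongWire, if_pos h]

theorem alongWire_of_neg {x : S.Dart} {s : Bool}
    (h : ¬ (S.IsInner x ∨ (s = true ↔ ¬ S.IsArc x))) : S.alongWire x s =
      if s then opposite S.toDiskDrawing x else S.map.rot (opposite S.toDiskDrawing x) := by
  simp only [alongWire, if_neg h]

theorem alongWire_of_isInner {x : S.Dart} (h : S.IsInner x) (s : Bool) :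
    S.alongWire x s = if s then x else S.map.rot x := alongWire_of_pos (Or.inl h)

theorem alongWire_flip_arc (i : Fin n) (s : Bool) :
    S.alongWire (S.map.flip (S.arc (evenPoint i))) s = if s then
      S.strandStart (evenPoint (finRotate _ i)) else S.strandStart (oddPoint i) := by
  have h1 := not_isInner_flip_arc (S := S.toDiskDrawing) (evenPoint i)
  have h2 := isArc_flip_arc (B := S.toBoundedMap) (evenPoint i)
  cases s
  · rw [alongWire_of_pos (Or.inr (by simp [h2])), S.rot_flip_arc, finRotate_evenPoint]
    rfl
  · rw [alongWire_of_neg (by simp [h1, h2]), opposite_flip_arc]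
    rfl

theorem alongWire_start (i : Fin n) (s : Bool) :
    S.alongWire (S.strandStart (evenPoint (finRotate _ i))) s = if s then
      S.strandStart (evenPoint (finRotate _ i)) else S.strandStart (oddPoint i) := by
  have h1 := S.not_isInner_strandStart (evenPoint (finRotate _ i))
  have h2 := S.not_isArc_strandStart (evenPoint (finRotate _ i))
  cases s
  · rw [alongWire_of_neg (not_or.2 ⟨h1, fun h => Bool.false_ne_true (h.2 h2)⟩), opposite_start,
      S.rot_flip_arc, finRotate_evenPoint]
    rfl
  · rw [alongWire_of_pos (Or.inr ⟨fun _ => h2, fun _ => rfl⟩)]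
    rfl

/-- The angle between a black dart `x` and the next one around its region is the edge of `x`; seen
from its two ends, `alongWire` gives `x` and `flip x`. Going straight through a medial vertex is a
half turn at the crossing. -/
theorem strandRel_alongWire {x y : {x // c.black x} × Bool} (h : (network c hn).wireRel x y) :
    S.strandRel (S.alongWire x.1.1 x.2) (S.alongWire y.1.1 y.2) := by
  induction h with
  | refl x => exact Setoid.refl' _ _
  | symm x y _ ih => exact Setoid.symm' _ ih
  | trans x y z _ _ h1 h2 => exact Setoid.trans' _ h1 h2
  | rel x y h =>
    rcases h with ⟨d, s, rfl, rfl⟩ | ⟨d, h, rfl, rfl⟩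
    · change S.strandRel (S.alongWire d.1 s) (S.alongWire (opposite S.toDiskDrawing d.1) s)
      rcases black_cases d.2 with hi | ⟨i, hi⟩ | ⟨i, hi⟩
      · rw [opposite_of_isInner hi, alongWire_of_isInner hi,
          alongWire_of_isInner (isInner_rot_iff.2 (isInner_rot_iff.2 hi))]
        cases s
        · exact strandRel_rot_rot (isInner_rot_iff.2 hi)
        · exact strandRel_rot_rot hi
      · rw [hi, opposite_flip_arc, alongWire_flip_arc, alongWire_start]
      · rw [hi, opposite_start, alongWire_flip_arc, alongWire_start]
    · change S.strandRel (S.alongWire d.1 true) (S.alongWire (S.map.faceNext d.1) false)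
      have hd : ¬ S.IsArc d.1 := by
        intro hd
        rcases black_cases d.2 with hi | ⟨i, hi⟩ | ⟨i, hi⟩
        · exact hi.not_isArc hd
        · exact h i (Subtype.ext hi)
        · exact S.not_isArc_strandStart _ (hi ▸ hd)
      have h1 : S.alongWire d.1 true = d.1 := by
        simp [alongWire, hd]
      have h2 : S.alongWire (S.map.faceNext d.1) false = S.map.flip d.1 := by
        have h3 : S.IsInner (S.map.faceNext d.1) ∨ S.IsArc (S.map.faceNext d.1) := by
          rcases black_cases ((c.black_faceNext d.1).2 d.2) with hi | ⟨i, hi⟩ | ⟨i, hi⟩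
          · exact Or.inl hi
          · exact Or.inr (hi ▸ isArc_flip_arc (B := S.toBoundedMap) _)
          · refine absurd ?_ hd
            rw [← isArc_flip_iff, ← DartMap.rot_faceNext, hi, S.rot_strandStart]
            exact isArc_arc (B := S.toBoundedMap) _
        have h4 : S.IsInner (S.map.faceNext d.1) ∨
            (false = true ↔ ¬ S.IsArc (S.map.faceNext d.1)) := h3.imp id fun h => by simp [h]
        simp only [alongWire, if_pos h4]
        exact DartMap.rot_faceNext _ _
      rw [h1, h2]
      exact strandRel_flip hd

variable (c hn) in
open scoped Classical in
/-- The wire along which a dart runs. -/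
noncomputable def wireAlong (y : S.Dart) : Option (Quotient (network c hn).wireRel) :=
  if h : c.black y then some (Quotient.mk _ (⟨y, h⟩, true)) else
    -- Around a crossing black and white alternate, so `none` is possible on the boundary circle
    -- only.
    if h : c.black (S.map.rot⁻¹ y) then some (Quotient.mk _ (⟨_, h⟩, false)) else none

theorem wireAlong_of_black {y : S.Dart} (h : c.black y) :
    wireAlong c hn y = some (Quotient.mk _ (⟨y, h⟩, true)) := dif_pos h

theorem wireAlong_rot {x : S.Dart} (h : c.black x) (h' : ¬ c.black (S.map.rot x)) :
    wireAlong c hn (S.map.rot x) = some (Quotient.mk _ (⟨x, h⟩, false)) := by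
  have h1 : S.map.rot⁻¹ (S.map.rot x) = x := S.map.rot.symm_apply_apply x
  rw [wireAlong, dif_neg h', dif_pos (h1.symm ▸ h)]
  simp only [h1]

theorem wireAlong_flip {x : S.Dart} (h : c.black x) (hx : ¬ S.IsArc x) :
    wireAlong c hn (S.map.flip x) = wireAlong c hn x := by
  have h1 := (c.black_flip_of_not_isArc hx).not.2 (not_not.2 h)
  have h2 : S.map.flip x = S.map.rot (S.map.faceNext x) := (DartMap.rot_faceNext _ _).symm
  rw [h2] at h1 ⊢
  rw [wireAlong_rot ((c.black_faceNext x).2 h) h1, wireAlong_of_black h]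
  refine congrArg some (Quotient.sound (Setoid.symm' _ ?_))
  refine CactusNetwork.wireRel_rot (N := network c hn) (d := ⟨x, h⟩) fun i hi => hx ?_
  exact ⟨evenPoint i, Or.inr (congrArg Subtype.val hi)⟩

theorem wireAlong_rot_rot {x : S.Dart} (hx : S.IsInner x) :
    wireAlong c hn (S.map.rot (S.map.rot x)) = wireAlong c hn x := by
  have key : ∀ x, ∀ hx : S.IsInner x, ∀ h : c.black x, ∀ s,
      (network c hn).wireRel (⟨_, (c.black_rot_rot hx).2 h⟩, s) (⟨x, h⟩, s) := by
    intro x hx h s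
    have h1 := CactusNetwork.wireRel_flip (N := network c hn) ⟨x, h⟩ s
    rw [show (network c hn).map.flip ⟨x, h⟩ = ⟨_, (c.black_rot_rot hx).2 h⟩ from
      Subtype.ext (opposite_of_isInner hx)] at h1
    exact Setoid.symm' _ h1
  by_cases h : c.black x
  · rw [wireAlong_of_black h, wireAlong_of_black ((c.black_rot_rot hx).2 h)]
    exact congrArg some (Quotient.sound (key x hx h true))
  · obtain ⟨z, rfl⟩ : ∃ z, x = S.map.rot z := ⟨_, (S.map.rot.apply_symm_apply x).symm⟩
    have hz := isInner_rot_iff.1 hx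
    have h1 := h
    rw [c.black_rot hz, not_not] at h1
    rw [wireAlong_rot h1 h, wireAlong_rot ((c.black_rot_rot hz).2 h1)
      (by rwa [c.black_rot_rot hx])]
    exact congrArg some (Quotient.sound (key z hz h1 false))

theorem wireAlong_eq_of_strandRel {x y : S.Dart} (h : S.strandRel x y) :
    wireAlong c hn x = wireAlong c hn y := by
  induction h with
  | refl x => rfl
  | symm x y _ ih => exact ih.symm
  | trans x y z _ _ h1 h2 => exact h1.trans h2
  | rel x y h =>
    rcases h with ⟨h, rfl⟩ | ⟨h, rfl⟩
    · by_cases hx : c.black x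
      · exact (wireAlong_flip hx h).symm
      · have h1 := wireAlong_flip (c := c) (hn := hn) ((c.black_flip_of_not_isArc h).2 hx)
          (by rwa [isArc_flip_iff])
        rwa [S.map.flip_flip] at h1
    · exact (wireAlong_rot_rot h).symm

theorem wireAlong_strandStart (j : Fin (2 * n)) : wireAlong c hn (S.strandStart j) =
    some (Quotient.mk _ ((network c hn).wireEnd j)) := by
  induction j using point_cases with
  | h i =>
    rw [wireAlong_of_black (c.black_start_even i), CactusNetwork.wireEnd_evenPoint]
    refine congrArg some (Quotient.sound (Setoid.symm' _ ?_))
    have h1 := CactusNetwork.wireRel_flip (N := network c hn)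
      ((network c hn).arc ((finRotate n).symm i)) true
    rwa [show (network c hn).map.flip ((network c hn).arc ((finRotate n).symm i)) =
      ⟨_, c.black_start_even i⟩ from Subtype.ext ((opposite_flip_arc _).trans
        (by rw [Equiv.apply_symm_apply]))] at h1
  | h' i =>
    have h1 : S.strandStart (oddPoint i) = S.map.rot (S.map.flip (S.arc (evenPoint i))) := by
      rw [S.rot_flip_arc, finRotate_evenPoint]
    have h2 := c.not_black_start_odd i
    rw [h1] at h2 ⊢
    rw [wireAlong_rot (c.black_flip_even i) h2, CactusNetwork.wireEnd_oddPoint]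
    rfl

theorem alongWire_wireEnd (j : Fin (2 * n)) :
    S.alongWire ((network c hn).wireEnd j).1.1 ((network c hn).wireEnd j).2 =
      S.strandStart j := by
  induction j using point_cases with
  | h i =>
    rw [CactusNetwork.wireEnd_evenPoint]
    refine (alongWire_flip_arc _ true).trans ?_
    rw [Equiv.apply_symm_apply]
    rfl
  | h' i =>
    rw [CactusNetwork.wireEnd_oddPoint]
    exact alongWire_flip_arc _ false

theorem IsDiagramOf.network_hasMedialPairing {τ : PointMatching n} (h : S.IsDiagramOf τ) :
    (network c hn).HasMedialPairing τ := fun j k => by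
  rw [← h j k]
  constructor
  · intro h1
    have := strandRel_alongWire h1
    rwa [alongWire_wireEnd, alongWire_wireEnd] at this
  · intro h1
    have := wireAlong_eq_of_strandRel (c := c) (hn := hn) h1
    rw [wireAlong_strandStart, wireAlong_strandStart] at this
    exact Quotient.exact (Option.some.inj this)

theorem network_isReduced : (network c hn).IsReduced := by
  refine ⟨fun d hd h => ?_, fun d e s hd he h h' => ?_⟩
  · replace hd := not_not.1 (mt network_isArc_iff.2 hd)
    have := strandRel_alongWire h
    simp only [alongWire_of_isInner hd, if_true, Bool.false_eq_true, if_false] at this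
    exact S.no_self_crossing d.1 hd this
  · replace hd := not_not.1 (mt network_isArc_iff.2 hd)
    replace he := not_not.1 (mt network_isArc_iff.2 he)
    have h1 := strandRel_alongWire h
    have h2 := strandRel_alongWire h'
    simp only [alongWire_of_isInner hd, alongWire_of_isInner he, if_true, Bool.false_eq_true,
      if_false] at h1 h2
    have h3 : S.map.vertexRel d.1 e.1 := by
      cases s
      · simp only [Bool.not_false, if_true, Bool.false_eq_true, if_false] at h1 h2
        refine Setoid.trans' _ (S.no_double_crossing _ _ hd (isInner_rot_iff.2 he) h1
          (Setoid.trans' _ h2 (strandRel_rot_rot he))) (Setoid.symm' _ (S.map.vertexRel_rot _))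
      · simp only [Bool.not_true, if_true, Bool.false_eq_true, if_false] at h1 h2
        exact S.no_double_crossing _ _ hd he h1 h2
    exact (black_eq_or_eq_opposite d.2 e.2 h3).imp (fun h => Subtype.ext h)
      fun h => Subtype.ext h

/-- As no side of the face is an arc, reversing its darts gives the whole boundary walk of an
interior region, with the same number of sides. -/
theorem InteriorRegionsHaveFourSides.not_isTriangularFace (h : S.InteriorRegionsHaveFourSides)
    (f : (network c hn).Face) : ¬ (network c hn).IsTriangularFace f := by
  have := S.finite
  rintro ⟨h1, h2⟩
  obtain ⟨d, rfl⟩ := Quotient.exists_rep f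
  have h3 : ∀ e, (network c hn).face e = Quotient.mk c.netMap.walkRel d ↔
      c.netMap.walkRel d e := fun e =>
    ⟨fun h => Setoid.symm' _ (Quotient.exact h), fun h => Quotient.sound (Setoid.symm' _ h)⟩
  have hin : ∀ e, c.netMap.walkRel d e → S.IsInner e.1 := fun e he => by
    exact not_not.1 (mt network_isArc_iff.2 (h1 e ((h3 e).2 he)))
  have h4 : {z | c.netMap.walkRel d z}.ncard = 3 := by
    rw [← h2]
    congr 1
    ext e
    exact (h3 e).symm
  have h5 : {z | S.map.walkRel (S.map.flip d.1) z} =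
      (fun e : {x // c.black x} => S.map.flip e.1) '' {e | c.netMap.walkRel d e} := by
    have key : ∀ k : ℕ, (S.map.faceNext ^ k) (S.map.flip d.1) =
        S.map.flip ((c.netMap.faceNext ^ k) d).1 := by
      intro k
      induction k with
      | zero => rfl
      | succ k ih =>
        rw [pow_succ', pow_succ', Equiv.Perm.mul_apply, Equiv.Perm.mul_apply, ih]
        exact flip_faceNext_of_isInner (hin _ ⟨k, by simp⟩)
    ext z
    simp only [Set.mem_ofPred_eq, Set.mem_image]
    constructor
    · intro hz
      obtain ⟨k, -, hk⟩ := Equiv.Perm.SameCycle.exists_pow_eq' hz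
      exact ⟨(c.netMap.faceNext ^ k) d, ⟨k, by simp⟩, by rw [← hk, key]⟩
    · rintro ⟨y, hy, rfl⟩
      obtain ⟨k, -, hk⟩ := Equiv.Perm.SameCycle.exists_pow_eq' hy
      exact ⟨k, by rw [zpow_natCast, key, hk]⟩
  have h6 := h (S.map.flip d.1) fun x hx hxa => by
    have hx' : x ∈ {z | S.map.walkRel (S.map.flip d.1) z} := hx
    rw [h5] at hx'
    obtain ⟨e, he, rfl⟩ := hx'
    exact (hin e he).not_isArc (isArc_flip_iff.1 hxa)
  have hinj : Function.Injective fun e : {x // c.black x} => S.map.flip e.1 :=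
    S.map.flip.injective.comp Subtype.val_injective
  rw [h5, Set.ncard_image_of_injective _ hinj, h4] at h6
  omega

/-- The darts at the vertex are those around its black region. At an interior vertex none of them is
an arc, so the region is interior and every side counts for the degree. -/
theorem InteriorRegionsHaveFourSides.four_le_degree (h : S.InteriorRegionsHaveFourSides)
    (v : (network c hn).Vertex) (hv : (network c hn).IsInteriorVertex v) :
    4 ≤ (network c hn).degree v := by
  have := S.finite
  rcases v with q | v
  swap
  · exact v.elim
  induction q using Quotient.inductionOn with | _ d
  have h1 : {z | S.map.walkRel d.1 z} = Subtype.val '' {e | c.netMap.vertexRel d e} :=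
    Equiv.Perm.setOf_sameCycle_of_semiconj (f := c.netMap.rot) (g := S.map.faceNext)
      (φ := fun e : {x // c.black x} => e.1) fun y _ => rfl
  have h2 : ∀ i, ¬ c.netMap.vertexRel d ((network c hn).arc i) := fun i hi =>
    hv i (Quotient.sound (Setoid.symm' _ hi))
  have h3 : ∀ e, c.netMap.vertexRel d e → ¬ (network c hn).IsArc e := by
    rintro e he ⟨i, rfl | rfl⟩
    · exact h2 i he
    · rw [← (network c hn).rot_arc_finRotate] at he
      exact h2 _ (Setoid.trans' _ he (Setoid.symm' _ (c.netMap.vertexRel_rot _)))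
  have h4 := h d.1 fun x hx hxa => by
    have hx' : x ∈ {z | S.map.walkRel d.1 z} := hx
    rw [h1] at hx'
    obtain ⟨e, he, rfl⟩ := hx'
    exact (not_not.1 (mt network_isArc_iff.2 (h3 e he))).not_isArc hxa
  rw [h1, Set.ncard_image_of_injective _ Subtype.val_injective] at h4
  have : Finite (network c hn).Dart := (network c hn).finite
  refine h4.trans (Set.ncard_le_ncard (t := {e : (network c hn).Dart | _}) fun e he =>
    ⟨h3 e he, Quotient.sound (Setoid.symm' _ he)⟩)

end StrandDiagram

/-! ### The case without boundary points, and the equivalence. -/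

/-- The network without boundary vertices, edges and vertices. -/
def emptyNetwork : CactusNetwork 0 where
  Dart := Empty
  finite := inferInstance
  map := { rot := 1, flip := 1, flip_flip := Empty.rec, flip_ne := Empty.rec }
  planar := Empty.rec
  arc i := i.elim0
  arc_injective i := i.elim0
  flip_arc_ne i := i.elim0
  faceNext_arc i := i.elim0
  Isolated := Empty
  finite_isolated := inferInstance
  Face := Unit
  finite_face := inferInstance
  face _ := ()
  isolatedFace := Empty.elim
  face_faceNext := Empty.rec
  faces_connected := by
    rintro (⟨⟨⟩⟩ | ⟨⟩) (⟨⟨⟩⟩ | ⟨⟩)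
    exact .refl _
  faces_tree := by
    have h : ∀ r : Setoid Empty, Nat.card (Quotient r) = 0 := fun r => by
      have : IsEmpty (Quotient r) := ⟨fun q => (Quotient.exists_rep q).choose.elim⟩
      exact Nat.card_of_isEmpty
    rw [h, h]
    simp
  outside_only_arcs i := i.elim0
  outside_not_isolated i := i.elim0

theorem mainTheorem7 (n : ℕ) (τ : PointMatching n) :
    List.TFAE [
      τ.IsNoncrossing 3,
      ∀ S : StrandDiagram n, S.IsDiagramOf τ → S.InteriorRegionsHaveFourSides,
      ∃ S : StrandDiagram n, S.IsDiagramOf τ ∧ S.InteriorRegionsHaveFourSides,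
      ∃ S : StrandDiagram n, S.IsDiagramOf τ ∧
        ∀ T : StrandDiagram n, T.IsDiagramOf τ → Nonempty (S.Iso T),
      ∃ N : CactusNetwork n, N.IsReduced ∧ N.HasMedialPairing τ ∧
        (∀ f, ¬ N.IsTriangularFace f) ∧ ∀ v, N.IsInteriorVertex v → 4 ≤ N.degree v] := by
  -- The passages between networks and diagrams use a boundary point to reach the outside, so `n =
  -- 0` is treated separately.
  have h0 : n = 0 → τ.IsNoncrossing 3 := by
    rintro rfl ⟨L, hL, -⟩
    rw [Finset.card_eq_zero.2 (Finset.eq_empty_of_forall_notMem fun i => i.elim0)] at hL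
    cases hL
  tfae_have 1 → 2 := fun h S hS => hS.interiorRegionsHaveFourSides h
  tfae_have 2 → 3 := fun h => ⟨_, PointMatching.gridDiagram_isDiagramOf, h _
    PointMatching.gridDiagram_isDiagramOf⟩
  tfae_have 3 → 1 := fun ⟨S, hS, h⟩ => by
    by_contra h1
    obtain ⟨p, q, r, hpq, hqr, hpr⟩ := PointMatching.not_isNoncrossing_three_iff.1 h1
    exact hS.not_fourSides_of_cross hpq hqr hpr h
  tfae_have 1 → 4 := fun h => ⟨_, PointMatching.gridDiagram_isDiagramOf, fun T hT =>
    PointMatching.gridDiagram_isDiagramOf.nonempty_iso hT h⟩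
  tfae_have 4 → 1 := fun ⟨S, _, h⟩ => PointMatching.isNoncrossing_of_unique h
  tfae_have 3 → 5 := fun ⟨S, hS, h⟩ => by
    rcases eq_or_ne n 0 with rfl | hn
    · refine ⟨emptyNetwork, ⟨fun d => d.elim, fun d => d.elim⟩, fun j => j.elim0, fun f hf => ?_,
        ?_⟩
      · have h1 : {d | emptyNetwork.face d = f} = ∅ := Set.eq_empty_of_forall_notMem fun d => d.elim
        have h2 := hf.2
        rw [h1, Set.ncard_empty] at h2
        cases h2
      · rintro (q | v)
        · exact (Quotient.exists_rep q).choose.elim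
        · exact v.elim
    · obtain ⟨c⟩ := S.nonempty_coloring hn
      exact ⟨StrandDiagram.network c hn, StrandDiagram.network_isReduced, hS.network_hasMedialPairing,
        h.not_isTriangularFace, h.four_le_degree⟩
  tfae_have 5 → 1 := fun ⟨N, hN, hτ, hf, hv⟩ => by
    rcases eq_or_ne n 0 with rfl | hn
    · exact h0 rfl
    · by_contra h1
      obtain ⟨p, q, r, hpq, hqr, hpr⟩ := PointMatching.not_isNoncrossing_three_iff.1 h1
      exact (hτ.medialDiagram_isDiagramOf hn hN).not_fourSides_of_cross hpq hqr hpr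
        (CactusNetwork.medialDiagram_interiorRegionsHaveFourSides hn hN hf hv)
  tfae_finish
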